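/- **Setting.** Fix integers $N=N(n)\ge n+2$ with $N=(1+o(1))n$. Let $\phi>0$ and suppose we have a deterministic procedure that, for every $d$ with $3\le d\le N$ and all sufficiently large $N$, lists the edges of a simple bipartite $d$-regular graph with $N$ vertices on each side satisfying $e(S,\overline S)\ge \phi d|S|$ for every nonempty set $S$ of at most half of its vertices, in time $\tilde O(Nd)$, i.e. at most $K\,Nd\,(\log N)^a$ for constants $K,a$. Let $G$ be a dynamic simple graph with vertex set $V$, $|V|=n$, undergoing edge insertions and deletions, with initially $m$ edges (below, $m_{\rm cur}$ is the current number of edges). The *dynamic core gadget* maintains a simple graph $G_{exp}$ on $V\cup L\cup R$, $|L|=|R|=N$, consisting of $G$, edges between $V$ and $L$, and a regular bipartite expander $X$ between $L$ and $R$. Write $\deg_L(v)$ for the number of neighbours of $v\in V$ in $L$, $m_t$ for the number of edges of $G$ at the last call of RECOMPUTE (or after preprocessing), and $\Delta_L,\delta_L$ for the maximum and minimum degree in $G_{exp}$ of a vertex of $L$. The vertices of $L$ are kept sorted by their degree in $G_{exp}$. * *Preprocessing* applies the static core gadget: every $v$ gets $\deg_G(v)+3$ neighbours in $L$, chosen consecutively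 in a circular order of $L$ (Round-Robin), and $X$ is the expander of degree $\lceil (2m+3n)/N\rceil$ given by the procedure. * *Insertion of $uv$*: insert $uv$ into $G_{exp}$. If $m_{\rm cur}\ge 2m_t+n$, call RECOMPUTE and finish. Otherwise, for $v$ and then for $u$ in the role of $w$: if $\deg_G(w)\ge 2\deg_L(w)$, call UPDATE$(w)$, and then, if $\Delta_L\ge 2\delta_L$, call BALANCE. * *Deletion of $uv$*: delete $uv$ from $G_{exp}$; then, if $n\le m_{\rm cur}\le m_t/2$, call RECOMPUTE. * UPDATE$(w)$: with $k=\deg_L(w)$, join $w$ to $k+3$ vertices of minimum degree in $L\setminus N(w)$, found by scanning $L$ in the order of degrees. * BALANCE: compute a new Round-Robin set of edges from $V$ to $L$ ($\deg_G(v)+3$ at each $v$), insert its missing edges, then remove the old $V$-to-$L$ edges that do not belong to it. * RECOMPUTE: construct a new expander $X'$ of degree $\lceil (2m_{\rm cur}+3n)/N\rceil$, insert $X'\setminus X$, remove $X\setminus X'$, and replace the $V$-to-$L$ edges as in BALANCE. Time is counted on a unit-cost random access machine; the time spent inside the expander procedure is recorded separately. **Proposition.** There are constants $C,b$, depending only on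 $K,a$, such that for all sufficiently large $n$, every initial graph $G_0$ with $n$ vertices and $m$ edges, and every sequence of $M$ edge updates to $G$: 1. preprocessing takes $\tilde O(m+n)$ time, namely at most $C(m+n)(\log n)^b$, including the construction of the expander; 2. the gadget turns the $M$ updates of $G$ into a legal sequence of at most $CM$ edge updates of $G_{exp}$; 3. it does so in at most $CM$ steps outside the expander procedure and at most $CM(\log n)^b$ time inside it; 4. if every call of the expander procedure but the first (with the same $N$) takes at most $K\,Nd$ time, then the $M$ updates take at most $CM$ time altogether, that is, the amortized update time is $O(1)$, and the total time including preprocessing is $\tilde O(m+n)+O(M)$. Moreover, after preprocessing and after the updates, $G_{exp}$ has the following form: it consists of $G$, edges between $V$ and $L$, and the constructed expander of degree $\lceil(2m_t+3n)/N\rceil$ between $L$ and $R$, for some $m_t$ such that $m_{\rm cur}<2m_t+n$ and not $n\le m_{\rm cur}\le m_t/2$; every $v\in V$ has $\deg_L(v)\ge 3$ and $\deg_G(v)<2\deg_L(v)$; and $\Delta_L<2\delta_L$. -/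

import Mathlib

open Filter Topology

namespace CoreGadget

/-! ### Dynamic graphs -/

/-- An edge insertion or an edge deletion. -/
inductive EdgeUpdate (V : Type) where
  | ins (u v : V)
  | del (u v : V)

/-- The graph after one update. -/
def EdgeUpdate.apply {V : Type} (G : SimpleGraph V) : EdgeUpdate V → SimpleGraph V
  | .ins u v => G ⊔ SimpleGraph.edge u v
  | .del u v => G.deleteEdges {s(u, v)}

/-- One may insert a missing edge (never a loop) and delete a present one. -/
def EdgeUpdate.Legal {V : Type} (G : SimpleGraph V) : EdgeUpdate V → Prop
  | .ins u v => u ≠ v ∧ ¬ G.Adj u v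
  | .del u v => G.Adj u v

/-- The graph after a sequence of updates. -/
def replay {V : Type} (G : SimpleGraph V) : List (EdgeUpdate V) → SimpleGraph V
  | [] => G
  | e :: es => replay (e.apply G) es

/-- Every update of the sequence is legal at its time. -/
def LegalSeq {V : Type} (G : SimpleGraph V) : List (EdgeUpdate V) → Prop
  | [] => True
  | e :: es => e.Legal G ∧ LegalSeq (e.apply G) es

/-- `es` lists every edge of `G` exactly once. -/
def IsEdgeList {V : Type} (G : SimpleGraph V) (es : List (V × V)) : Prop :=
  (es.map fun e => s(e.1, e.2)).Nodup ∧ ∀ e, e ∈ es.map (fun e => s(e.1, e.2)) ↔ e ∈ G.edgeSet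

/-! ### Expanders and the procedure that constructs them -/

/-- `e(S, V \ S) ≥ h |S|` for every nonempty `S` with `|S| ≤ |V| / 2`. -/
def IsEdgeExpander {V : Type} [Fintype V] (h : ℝ) (G : SimpleGraph V) : Prop :=
  ∀ S : Finset V, S.Nonempty → 2 * S.card ≤ Fintype.card V →
    h * S.card ≤ ({p : V × V | p.1 ∈ S ∧ p.2 ∉ S ∧ G.Adj p.1 p.2}.ncard : ℝ)

/-- A deterministic procedure that, given `N` and `d`, produces for every `x ∈ {0, …, N-1}` a table
`nbr N d x 0, …, nbr N d x (d-1)` of elements of `{0, …, N-1}`. Its running time is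
`firstTime N d` when it is called for the first time with the parameter `N` (this includes all work
that depends on `N` only), and `time N d` in a later call with the same `N`. -/
structure ExpanderProcedure where
  nbr : ℕ → ℕ → ℕ → ℕ → ℕ
  firstTime : ℕ → ℕ → ℕ
  time : ℕ → ℕ → ℕ

/-- The bipartite graph on `L ∪ R` (two copies of `{0, …, N-1}`) described by the table. -/
def ExpanderProcedure.graph (P : ExpanderProcedure) (N d : ℕ) :
    SimpleGraph (Fin N ⊕ Fin N) :=
  SimpleGraph.fromRel fun a b => ∃ x y : Fin N, a = Sum.inl x ∧ b = Sum.inr y ∧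
    ∃ i < d, P.nbr N d x i = y

/-- For all `d ≥ 3` and `N ≥ N₀` (and `d ≤ N`, without which there is no simple bipartite
`d`-regular graph with `N` vertices on each side), the table lists without repetition the
neighbourhoods of a `d`-regular bipartite graph that is a `φ d`-edge expander. -/
structure ExpanderProcedure.Correct (P : ExpanderProcedure) (φ : ℝ) (N₀ : ℕ) : Prop where
  nbr_lt : ∀ N d, N₀ ≤ N → 3 ≤ d → d ≤ N → ∀ x < N, ∀ i < d, P.nbr N d x i < N
  nbr_inj : ∀ N d, N₀ ≤ N → 3 ≤ d → d ≤ N → ∀ x < N, ∀ i < d, ∀ j < d,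
    P.nbr N d x i = P.nbr N d x j → i = j
  regular : ∀ N d, N₀ ≤ N → 3 ≤ d → d ≤ N → ∀ w, ((P.graph N d).neighborSet w).ncard = d
  expander : ∀ N d, N₀ ≤ N → 3 ≤ d → d ≤ N → IsEdgeExpander (φ * d) (P.graph N d)

/-- Every call takes time `Õ(N d)`: at most `K N d (log N) ^ a`. -/
def ExpanderProcedure.NearLinearTime (P : ExpanderProcedure) (N₀ K a : ℕ) : Prop :=
  ∀ N d, N₀ ≤ N → 3 ≤ d → d ≤ N →
    P.firstTime N d ≤ K * (N * d) * Nat.log 2 N ^ a ∧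
    P.time N d ≤ K * (N * d) * Nat.log 2 N ^ a

/-- Every call but the first takes time `O(N d)`, that is, `O(1)` per edge of the expander. -/
def ExpanderProcedure.LinearLaterTime (P : ExpanderProcedure) (N₀ K : ℕ) : Prop :=
  ∀ N d, N₀ ≤ N → 3 ≤ d → d ≤ N → P.time N d ≤ K * (N * d)

/-! ### The random access machine

Programs run on a random access memory that consists of arrays of words, initially `0` (all words
and indices that occur are polynomial in `n`). Every read, every write, every output of an edge
update and every loop test costs one step; between two such operations a program does only a
bounded number of arithmetic operations on local variables. Calls to the expander procedure are
charged with the running time of that procedure, on a separate clock. -/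

/-- The vertices of `G_exp`: the `i`-th vertex of `G`, of `L`, of `R`. -/
inductive XVertex where
  | orig (i : ℕ)
  | left (i : ℕ)
  | right (i : ℕ)

open XVertex EdgeUpdate

/-- The arrays in memory. -/
inductive Arr where
  /-- `edges[0] = m`, the current number of edges of `G` -/
  | edges
  /-- `edgesLast[0] = m_t`, the number of edges of `G` at the last `recompute` -/
  | edgesLast
  /-- `degG[v]`, the degree of `v` in `G` -/
  | degG
  /-- `degVL[v]`, the number of neighbours of `v` in `L` -/
  | degVL
  /-- `nbrVL[v * N + i]`, the `i`-th neighbour of `v` in `L` -/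
  | nbrVL
  /-- `adjVL[v * N + x] = 1` if `v` and `x ∈ L` are adjacent, otherwise `0` -/
  | adjVL
  /-- `degX[0]`, the degree of the current expander -/
  | degX
  /-- `nbrX[x * N + i]`, the `i`-th neighbour of `x ∈ L` in the current expander -/
  | nbrX
  /-- `newX[x * N + i]`, the same for the expander constructed last -/
  | newX
  /-- `adjX[x * N + y] ≠ 0` if `x ∈ L` and `y ∈ R` are adjacent -/
  | adjX
  /-- `degL[x]`, the degree in `G_exp` of `x ∈ L` -/
  | degL
  /-- `order[0], …, order[N-1]`, the vertices of `L` sorted by degree in `G_exp` -/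
  | order
  /-- `pos[x]`, the position of `x ∈ L` in `order` -/
  | pos
  /-- `start[k]`, the number of vertices in `L` of degree less than `k` -/
  | start
  /-- `offset[v]`, the position at which the Round-Robin allocation of `v` begins -/
  | offset
  /-- scratch memory -/
  | scratch
  deriving DecidableEq

structure State where
  mem : Arr → ℕ → ℕ
  /-- the updates of `G_exp` output so far, in chronological order -/
  out : List (EdgeUpdate XVertex)
  /-- the number of steps so far, without those inside the expander procedure -/
  time : ℕ
  /-- the time spent so far inside the expander procedure -/
  procTime : ℕ

def State.empty : State := ⟨fun _ _ => 0, [], 0, 0⟩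

abbrev Prog (α : Type) := StateM State α

def tick : Prog Unit := fun s => ((), { s with time := s.time + 1 })

def read (a : Arr) (i : ℕ) : Prog ℕ := fun s => (s.mem a i, { s with time := s.time + 1 })

def write (a : Arr) (i w : ℕ) : Prog Unit := fun s =>
  ((), { s with
    mem := Function.update s.mem a (Function.update (s.mem a) i w)
    time := s.time + 1 })

def emit (e : EdgeUpdate XVertex) : Prog Unit := fun s =>
  ((), { s with out := s.out ++ [e], time := s.time + 1 })

/-- `body 0; …; body (k - 1)` -/
def loop : ℕ → (ℕ → Prog Unit) → Prog Unit
  | 0, _ => tick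
  | k + 1, body => do
    loop k body
    tick
    body k

/-- Call the expander procedure, which writes its table to the array `newX`. -/
def construct (P : ExpanderProcedure) (first : Bool) (N d : ℕ) : Prog Unit := fun s =>
  ((), { s with
    mem := Function.update s.mem Arr.newX fun j => P.nbr N d (j / N) (j % N)
    procTime := s.procTime + (if first then P.firstTime N d else P.time N d) })

/-! ### The vertices of `L`, sorted by degree -/

/-- The degree of `x ∈ L` increases by one: `x` moves to the end of its block of vertices of equal
degree, and the boundary to the next block moves down by one. -/
def bump (x : ℕ) : Prog Unit := do
  let k ← read .degL x
  let i ← read .pos x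
  let e ← read .start (k + 1)
  let j := e - 1
  let y ← read .order j
  write .order i y
  write .pos y i
  write .order j x
  write .pos x j
  write .start (k + 1) j
  write .degL x (k + 1)

/-- The degree of `x ∈ L` decreases by one. -/
def drop (x : ℕ) : Prog Unit := do
  let k ← read .degL x
  let i ← read .pos x
  let j ← read .start k
  let y ← read .order j
  write .order i y
  write .pos y i
  write .order j x
  write .pos x j
  write .start k (j + 1)
  write .degL x (k - 1)

/-! ### The procedures UPDATE, BALANCE and RECOMPUTE -/

/-- Go through `L` in the order of degrees, from position `p` on, skip the neighbours of `v`, and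
append the others to the `c` vertices in the scratch memory, until there are `need` of them. -/
def collect (N v need : ℕ) : ℕ → ℕ → ℕ → Prog Unit
  | 0, _, _ => tick
  | fuel + 1, p, c => do
    tick
    if c < need then
      let x ← read .order p
      let b ← read .adjVL (v * N + x)
      if b = 0 then
        write .scratch c x
        collect N v need fuel (p + 1) (c + 1)
      else
        collect N v need fuel (p + 1) c

/-- UPDATE: with `k = deg_L(v)`, join `v` to `k + 3` vertices of minimum degree in `L \ N(v)`. -/
def update (N v : ℕ) : Prog Unit := do
  let k ← read .degVL v
  collect N v (k + 3) N 0 0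
  loop (k + 3) fun i => do
    let x ← read .scratch i
    emit (ins (orig v) (left x))
    bump x
    write .adjVL (v * N + x) 1
    write .nbrVL (v * N + (k + i)) x
  write .degVL v (k + (k + 3))

/-- BALANCE: let `R` be the set of `V`-to-`L` edges that the Round-Robin algorithm computes, which
gives every `v` the next `deg_G(v) + 3` vertices in the circular order of `L`. Insert the edges of
`R` that are missing, in Round-Robin order, and then remove `E(V,L) \ R`. -/
def balance (n N : ℕ) : Prog Unit := do
  write .offset 0 0
  loop n fun v => do
    let s ← read .offset v
    let g ← read .degG v
    write .offset (v + 1) ((s + (g + 3)) % N)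
  loop n fun v => do
    let s ← read .offset v
    let g ← read .degG v
    loop (g + 3) fun i => do
      let x := (s + i) % N
      let b ← read .adjVL (v * N + x)
      if b = 0 then
        emit (ins (orig v) (left x))
        bump x
  loop n fun v => do
    let s ← read .offset v
    let g ← read .degG v
    let k ← read .degVL v
    loop k fun i => do
      let x ← read .nbrVL (v * N + i)
      write .adjVL (v * N + x) 0
      -- `x` is not among the `g + 3` vertices that follow position `s` in the circular order
      if g + 3 ≤ (x + N - s) % N then
        emit (del (orig v) (left x))
        drop x
  loop n fun v => do
    let s ← read .offset v
    let g ← read .degG v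
    write .degVL v (g + 3)
    loop (g + 3) fun i => do
      let x := (s + i) % N
      write .nbrVL (v * N + i) x
      write .adjVL (v * N + x) 1

/-- `⌈(2m + 3n) / N⌉`, the degree of the expander for a graph with `n` vertices and `m` edges. -/
def expanderDegree (n N m : ℕ) : ℕ := (2 * m + 3 * n + (N - 1)) / N

/-- RECOMPUTE: construct a new expander `X'`, of the degree that fits the current number of edges;
insert `X' \ X`, remove `X \ X'`, and replace the `V`-to-`L` edges as in BALANCE. -/
def recompute (P : ExpanderProcedure) (first : Bool) (n N : ℕ) : Prog Unit := do
  let m ← read .edges 0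
  let d ← read .degX 0
  let d' := expanderDegree n N m
  construct P first N d'
  loop N fun x => loop d' fun i => do
    let y ← read .newX (x * N + i)
    let b ← read .adjX (x * N + y)
    if b = 0 then
      emit (ins (left x) (right y))
      bump x
    write .adjX (x * N + y) 2
  loop N fun x => loop d fun i => do
    let y ← read .nbrX (x * N + i)
    let b ← read .adjX (x * N + y)
    if b = 1 then
      emit (del (left x) (right y))
      drop x
      write .adjX (x * N + y) 0
  loop N fun x => loop d' fun i => do
    let y ← read .newX (x * N + i)
    write .nbrX (x * N + i) y
    write .adjX (x * N + y) 1
  write .degX 0 d'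
  write .edgesLast 0 m
  balance n N

/-! ### The dynamic core gadget -/

/-- Read the edges of the initial graph. -/
def readGraph {n : ℕ} : List (Fin n × Fin n) → Prog Unit
  | [] => tick
  | e :: es => do
    tick
    emit (ins (orig e.1) (orig e.2))
    let m ← read .edges 0
    write .edges 0 (m + 1)
    let g ← read .degG e.1
    write .degG e.1 (g + 1)
    let h ← read .degG e.2
    write .degG e.2 (h + 1)
    readGraph es

/-- Preprocessing: initialize the sorted order of `L`, all of whose vertices still have degree `0`,
and apply the static core gadget, that is, RECOMPUTE without an old expander and old edges. -/
def preprocess (P : ExpanderProcedure) {n : ℕ} (N : ℕ) (es : List (Fin n × Fin n)) :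
    Prog Unit := do
  readGraph es
  loop N fun x => do
    write .order x x
    write .pos x x
  loop (2 * N + 1) fun k => write .start (k + 1) N
  recompute P true n N

/-- What is done for an endpoint `v` of an inserted edge. -/
def serveEndpoint (n N v : ℕ) : Prog Unit := do
  let g ← read .degG v
  let k ← read .degVL v
  if 2 * k ≤ g then
    update N v
    let x ← read .order 0
    let y ← read .order (N - 1)
    let lo ← read .degL x
    let hi ← read .degL y
    if 2 * lo ≤ hi then
      balance n N

def insertEdge (P : ExpanderProcedure) (n N u v : ℕ) : Prog Unit := do
  emit (ins (orig u) (orig v))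
  let m ← read .edges 0
  write .edges 0 (m + 1)
  let g ← read .degG u
  write .degG u (g + 1)
  let h ← read .degG v
  write .degG v (h + 1)
  let mt ← read .edgesLast 0
  if 2 * mt + n ≤ m + 1 then
    recompute P false n N
  else
    serveEndpoint n N v
    serveEndpoint n N u

def deleteEdge (P : ExpanderProcedure) (n N u v : ℕ) : Prog Unit := do
  emit (del (orig u) (orig v))
  let m ← read .edges 0
  write .edges 0 (m - 1)
  let g ← read .degG u
  write .degG u (g - 1)
  let h ← read .degG v
  write .degG v (h - 1)
  let mt ← read .edgesLast 0
  if n ≤ m - 1 ∧ 2 * (m - 1) ≤ mt then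
    recompute P false n N

/-- Process the updates of `G` one by one. -/
def serve (P : ExpanderProcedure) {n : ℕ} (N : ℕ) : List (EdgeUpdate (Fin n)) → Prog Unit
  | [] => pure ()
  | .ins u v :: es => do
    insertEdge P n N u v
    serve P N es
  | .del u v :: es => do
    deleteEdge P n N u v
    serve P N es

/-- The state after preprocessing the graph listed by `es`. -/
def initial (P : ExpanderProcedure) {n : ℕ} (N : ℕ) (es : List (Fin n × Fin n)) : State :=
  (preprocess P N es State.empty).2

/-- The state after preprocessing and the updates `us`. -/
def final (P : ExpanderProcedure) {n : ℕ} (N : ℕ) (es : List (Fin n × Fin n))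
    (us : List (EdgeUpdate (Fin n))) : State :=
  (serve P N us (initial P N es)).2

/-- `H` is a graph `G_exp` for `G`, as the dynamic core gadget maintains it: `H` consists of `G`,
edges between `V` and `L`, and an expander between `L` and `R`; the number of neighbours in `L` of a
vertex is more than half its degree in `G` and at least 3; the degrees in `L` are balanced; and the
degree of the expander fits a number `m_t` of edges that is close to the number of edges of `G`. -/
structure IsGadget (P : ExpanderProcedure) {n : ℕ} (N : ℕ) (G : SimpleGraph (Fin n))
    (H : SimpleGraph XVertex) : Prop where
  orig_orig : ∀ i j, H.Adj (orig i) (orig j) ↔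
    ∃ (hi : i < n) (hj : j < n), G.Adj ⟨i, hi⟩ ⟨j, hj⟩
  orig_left : ∀ i x, H.Adj (orig i) (left x) → i < n ∧ x < N
  orig_right : ∀ i y, ¬ H.Adj (orig i) (right y)
  left_left : ∀ x y, ¬ H.Adj (left x) (left y)
  right_right : ∀ x y, ¬ H.Adj (right x) (right y)
  left_right : ∃ mt : ℕ,
    (∀ x y, H.Adj (left x) (right y) ↔ ∃ (hx : x < N) (hy : y < N),
      (P.graph N (expanderDegree n N mt)).Adj (Sum.inl ⟨x, hx⟩) (Sum.inr ⟨y, hy⟩)) ∧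
    G.edgeSet.ncard < 2 * mt + n ∧
    ¬ (n ≤ G.edgeSet.ncard ∧ 2 * G.edgeSet.ncard ≤ mt)
  three_le : ∀ v : Fin n, 3 ≤ {x | H.Adj (orig v) (left x)}.ncard
  degree_lt : ∀ v : Fin n, (G.neighborSet v).ncard < 2 * {x | H.Adj (orig v) (left x)}.ncard
  balanced : ∀ x < N, ∀ y < N,
    (H.neighborSet (left x)).ncard < 2 * (H.neighborSet (left y)).ncard

end CoreGadget

/-!
The proof has two layers.

**Programs.** `Run A p m o c Q` is a weakest precondition with a budget: `p` takes at most `c`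
steps, spends at most `A c` time in the expander procedure, and outputs at most `c` updates. The
contents of memory are tied to the graph by `Base` (the output so far is legal and produces
`expGraph G B X`, and `L` is sorted by degree) and by the descriptions of the adjacency arrays. All
loops run over tables of neighbours, so that their invariants speak of the initial segments `tab`.
This gives `balance_run`, `recompute_run` and `update_run`: BALANCE and RECOMPUTE take time linear
in the number of vertices and of old and new edges, UPDATE takes time `O(deg_L(v))`. The Round-Robin
degrees in `L` are `⌊T / N⌋` or `⌊T / N⌋ + 1`, where `T = 2 m + 3 n` (`colDeg_rrSet`).

**Amortization.** `Am` is a Hoare triple with credits, and the potential `pot` is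
`1300 |m_cur - m_t| + 1260 ∑ v, (deg_G(v) - deg_L(v))⁺ + 600 E`, where `E` is the number of edges
inserted by UPDATE since the last BALANCE or RECOMPUTE. An edge update raises it by a constant.

* RECOMPUTE takes place only after `m_t + n` insertions, or after `m_t / 2` deletions with
  `m_t ≥ 2 n`, and is paid for by the first term (`recompute_am`).
* UPDATE is called when `deg_G(v) = 2 deg_L(v) = 2 k`. The potential `k` of `v` then vanishes, and
  pays for the `O(k)` steps and for the growth of `E` by `k + 3 ≤ 2 k` (`serveEndpoint_am`).
  There are enough vertices to choose from, since `2 k + 3 ≤ n + 2 ≤ N`.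
* BALANCE is paid for by `E` (`balance_inv_run`). Let `δ₀ = d + ⌊(2 m₀ + 3 n) / N⌋` be the minimum
  degree in `L` after the last BALANCE or RECOMPUTE, when `G` had `m₀` edges. The invariant
  `N Δ ≤ N (δ₀ + 3) + 4 E` holds: if UPDATE raises the degree of some `x` and `2 (2 k + 3) ≤ N`,
  then at least half of the vertices of `L` are neither old nor new neighbours of `v`; by minimality
  their degrees are at least that of `x`, so `E` is large already (`Inv.high_of_choice`). Otherwise `E`
  itself grows by at least `N / 4`. As `N ≤ 5 n / 4` gives `δ₀ ≥ 5`, the condition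
  `Δ ≥ 2 δ ≥ 2 δ₀` implies that `E` is proportional to `N δ₀`, hence to `m_t + m₀ + n`.
-/

namespace CoreGadget

open XVertex EdgeUpdate

/-! ### Reasoning about programs -/

/-- The contents of the arrays in memory. -/
abbrev Mem := Arr → ℕ → ℕ

/-- Lists of updates of `G_exp`, in chronological order. -/
abbrev Out := List (EdgeUpdate XVertex)

/-- Weakest precondition with a budget: started with memory `m` and output `o`, the program `p` ends
with a result, a memory and an output that satisfy `Q`; it takes at most `c` steps, spends time at
most `A * c` in the expander procedure, and appends at most `c` updates to the output. The single
budget `c` thus bounds all the quantities of interest. -/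
def Run {α : Type} (A : ℕ) (p : Prog α) (m : Mem) (o : Out) (c : ℕ) (Q : α → Mem → Out → Prop) :
    Prop :=
  ∀ t pt, Q (p ⟨m, o, t, pt⟩).1 (p ⟨m, o, t, pt⟩).2.mem (p ⟨m, o, t, pt⟩).2.out ∧
    (p ⟨m, o, t, pt⟩).2.time ≤ t + c ∧ (p ⟨m, o, t, pt⟩).2.procTime ≤ pt + A * c ∧
    ∃ es, (p ⟨m, o, t, pt⟩).2.out = o ++ es ∧ es.length ≤ c

/-- Write one cell of an array. -/
def put (m : Mem) (a : Arr) (i w : ℕ) : Mem :=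
  Function.update m a (Function.update (m a) i w)

@[simp] theorem put_same (m : Mem) (a : Arr) (i w : ℕ) :
    put m a i w a = Function.update (m a) i w := by simp [put]

theorem put_ne (m : Mem) {a b : Arr} (i w : ℕ) (h : b ≠ a) : put m a i w b = m b := by
  simp [put, h]

namespace Run

variable {α β : Type} {A : ℕ} {m : Mem} {o : Out} {c : ℕ}

theorem mono {p : Prog α} {c' : ℕ} {Q Q' : α → Mem → Out → Prop} (h : Run A p m o c Q)
    (hc : c ≤ c') (hQ : ∀ r m' o', Q r m' o' → Q' r m' o') : Run A p m o c' Q' := by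
  intro t pt
  obtain ⟨h1, h2, h3, es, h4, h5⟩ := h t pt
  exact ⟨hQ _ _ _ h1, h2.trans (by omega), h3.trans (by gcongr), es, h4, h5.trans hc⟩

theorem pure {a : α} {Q : α → Mem → Out → Prop} (h : Q a m o) :
    Run A (Pure.pure a : Prog α) m o c Q := by
  intro t pt
  exact ⟨h, Nat.le_add_right _ _, Nat.le_add_right _ _, [], by simp [Pure.pure, StateT.pure],
    by simp⟩

theorem bind {p : Prog α} {f : α → Prog β} {c₁ c₂ : ℕ} {Q : α → Mem → Out → Prop}
    {Q' : β → Mem → Out → Prop} (h : Run A p m o c₁ Q)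
    (hf : ∀ r m' o', Q r m' o' → Run A (f r) m' o' c₂ Q') :
    Run A (p >>= f) m o (c₁ + c₂) Q' := by
  intro t pt
  obtain ⟨h1, h2, h3, es, h4, h5⟩ := h t pt
  have e : (p >>= f) ⟨m, o, t, pt⟩ = f (p ⟨m, o, t, pt⟩).1 (p ⟨m, o, t, pt⟩).2 := rfl
  rw [e]
  obtain ⟨g1, g2, g3, es', g4, g5⟩ := hf _ _ _ h1 (p ⟨m, o, t, pt⟩).2.time
    (p ⟨m, o, t, pt⟩).2.procTime
  refine ⟨g1, g2.trans (by omega), g3.trans (by rw [mul_add]; omega), es ++ es', ?_, ?_⟩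
  · rw [← List.append_assoc, ← h4, ← g4]
  · simp; omega

theorem read {a : Arr} {i : ℕ} {f : ℕ → Prog β} {Q : β → Mem → Out → Prop}
    (h : Run A (f (m a i)) m o c Q) : Run A (CoreGadget.read a i >>= f) m o (c + 1) Q := by
  rw [add_comm]
  refine bind (Q := fun r m' o' => r = m a i ∧ m' = m ∧ o' = o) (fun t pt => ?_) ?_
  · exact ⟨⟨rfl, rfl, rfl⟩, le_rfl, Nat.le_add_right _ _, [], by simp [CoreGadget.read], by simp⟩
  · rintro r m' o' ⟨rfl, rfl, rfl⟩
    exact h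

theorem write_last {a : Arr} {i w : ℕ} {Q : Unit → Mem → Out → Prop} (h : Q () (put m a i w) o) :
    Run A (CoreGadget.write a i w) m o (c + 1) Q := by
  intro t pt
  exact ⟨h, by simp [write], Nat.le_add_right _ _, [], by simp [write], by simp⟩

theorem write {a : Arr} {i w : ℕ} {f : Unit → Prog β} {Q : β → Mem → Out → Prop}
    (h : Run A (f ()) (put m a i w) o c Q) :
    Run A (CoreGadget.write a i w >>= f) m o (c + 1) Q := by
  rw [add_comm]
  refine bind (Q := fun r m' o' => m' = put m a i w ∧ o' = o) ?_ ?_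
  · exact write_last (c := 0) ⟨rfl, rfl⟩
  · rintro r m' o' ⟨rfl, rfl⟩
    exact h

theorem emit {e : EdgeUpdate XVertex} {f : Unit → Prog β} {Q : β → Mem → Out → Prop}
    (h : Run A (f ()) m (o ++ [e]) c Q) : Run A (CoreGadget.emit e >>= f) m o (c + 1) Q := by
  rw [add_comm]
  refine bind (Q := fun r m' o' => m' = m ∧ o' = o ++ [e]) (fun t pt => ?_) ?_
  · exact ⟨⟨rfl, rfl⟩, le_rfl, Nat.le_add_right _ _, [e], rfl, by simp⟩
  · rintro r m' o' ⟨rfl, rfl⟩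
    exact h

theorem tick_last {Q : Unit → Mem → Out → Prop} (h : Q () m o) :
    Run A CoreGadget.tick m o (c + 1) Q := by
  intro t pt
  exact ⟨h, by simp [CoreGadget.tick], Nat.le_add_right _ _, [], by simp [CoreGadget.tick], by simp⟩

theorem tick {f : Unit → Prog β} {Q : β → Mem → Out → Prop}
    (h : Run A (f ()) m o c Q) : Run A (CoreGadget.tick >>= f) m o (c + 1) Q := by
  rw [add_comm]
  refine bind (Q := fun r m' o' => m' = m ∧ o' = o) (tick_last (c := 0) ⟨rfl, rfl⟩) ?_
  rintro r m' o' ⟨rfl, rfl⟩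
  exact h

/-- The rule for loops, with the invariant `I i` before the `i`-th round. -/
theorem loop {k : ℕ} {body : ℕ → Prog Unit} (I : ℕ → Mem → Out → Prop) (c : ℕ → ℕ) (h0 : I 0 m o)
    (hs : ∀ i < k, ∀ m' o', I i m' o' → Run A (body i) m' o' (c i) fun _ => I (i + 1)) :
    Run A (CoreGadget.loop k body) m o (1 + ∑ i ∈ Finset.range k, (c i + 1)) fun _ => I k := by
  induction k with
  | zero => exact tick_last (c := 0) h0
  | succ k ih =>
    rw [Finset.sum_range_succ, ← add_assoc]
    refine bind (ih fun i hi => hs i (by omega)) fun r m' o' h => ?_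
    exact tick (hs k (by omega) _ _ h)

theorem loop_const {k : ℕ} {body : ℕ → Prog Unit} (I : ℕ → Mem → Out → Prop) (c : ℕ)
    (h0 : I 0 m o)
    (hs : ∀ i < k, ∀ m' o', I i m' o' → Run A (body i) m' o' c fun _ => I (i + 1)) :
    Run A (CoreGadget.loop k body) m o ((c + 1) * k + 1) fun _ => I k := by
  refine (loop I (fun _ => c) h0 hs).mono ?_ fun _ _ _ h => h
  simp; ring_nf; omega

theorem construct {P : ExpanderProcedure} {first : Bool} {N d : ℕ} {f : Unit → Prog β}
    {Q : β → Mem → Out → Prop}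
    (hA : (if first then P.firstTime N d else P.time N d) ≤ A * (N * d))
    (h : Run A (f ()) (Function.update m Arr.newX fun j => P.nbr N d (j / N) (j % N)) o c Q) :
    Run A (CoreGadget.construct P first N d >>= f) m o (c + N * d) Q := by
  rw [add_comm]
  refine bind (Q := fun r m' o' =>
    m' = (Function.update m Arr.newX fun j => P.nbr N d (j / N) (j % N)) ∧ o' = o)
    (fun t pt => ?_) ?_
  · refine ⟨⟨rfl, rfl⟩, Nat.le_add_right _ _, ?_, [], by simp [CoreGadget.construct], by simp⟩
    simpa [CoreGadget.construct] using hA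
  · rintro r m' o' ⟨rfl, rfl⟩
    exact h

end Run

/-! ### The vertices of `L` in sorted order -/

/-- The arrays `order` and `pos` are inverse bijections of `{0, …, N-1}`, and the first `start k`
vertices in the order are those of degree less than `k`. -/
structure Sorted (N : ℕ) (deg order pos start : ℕ → ℕ) : Prop where
  pos_lt : ∀ x < N, pos x < N
  order_lt : ∀ i < N, order i < N
  order_pos : ∀ x < N, order (pos x) = x
  pos_order : ∀ i < N, pos (order i) = i
  start_le : ∀ k ≤ 2 * N + 1, start k ≤ N
  lt_iff : ∀ k ≤ 2 * N + 1, ∀ i < N, deg (order i) < k ↔ i < start k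

namespace Sorted

variable {N : ℕ} {deg order pos start : ℕ → ℕ}

theorem mono (h : Sorted N deg order pos start) {i j : ℕ} (hij : i ≤ j) (hj : j < N)
    (hd : deg (order j) ≤ 2 * N) : deg (order i) ≤ deg (order j) := by
  have h1 := h.lt_iff (deg (order j) + 1) (by omega) j hj
  have h2 := h.lt_iff (deg (order j) + 1) (by omega) i (by omega)
  omega

/-- Increasing the degree of `x` keeps the order after `x` is swapped with the last vertex `y` of
its degree. -/
theorem bump (h : Sorted N deg order pos start) {x : ℕ} (hx : x < N) (hd : deg x ≤ 2 * N)
    {i j y : ℕ} (hi : i = pos x) (hj : j = start (deg x + 1) - 1) (hy : y = order j) :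
    Sorted N (Function.update deg x (deg x + 1))
      (Function.update (Function.update order i y) j x)
      (Function.update (Function.update pos y i) x j)
      (Function.update start (deg x + 1) j) := by
  have hiN := h.pos_lt x hx
  have hox := h.order_pos x hx
  rw [← hi] at hiN hox
  have h1 := (h.lt_iff (deg x + 1) (by omega) i hiN)
  have h2 := h.start_le (deg x + 1) (by omega)
  rw [hox] at h1
  have hij : i ≤ j := by omega
  have hjN : j < N := by omega
  have h3 := (h.lt_iff (deg x + 1) (by omega) j hjN)
  have h4 := (h.lt_iff (deg x) (by omega) j hjN)
  have h5 := (h.lt_iff (deg x) (by omega) i hiN)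
  rw [← hy] at h3 h4
  rw [hox] at h5
  have hydeg : deg y = deg x := by omega
  have hyN : y < N := hy ▸ h.order_lt j hjN
  have hpy : pos y = j := by rw [hy]; exact h.pos_order j hjN
  have inj : ∀ p < N, ∀ q < N, order p = order q → p = q := fun p hp q hq e => by
    rw [← h.pos_order p hp, e, h.pos_order q hq]
  have op := h.order_pos
  have po := h.pos_order
  refine ⟨?_, ?_, ?_, ?_, ?_, ?_⟩
  · intro z hz
    have := h.pos_lt z hz
    simp only [Function.update_apply]; split_ifs <;> omega
  · intro p hp
    have := h.order_lt p hp
    simp only [Function.update_apply]; split_ifs <;> omega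
  · intro z hz
    simp only [Function.update_apply]
    have := op z hz
    grind
  · intro p hp
    simp only [Function.update_apply]
    have := po p hp
    grind
  · intro k hk
    have := h.start_le k hk
    simp only [Function.update_apply]; split_ifs <;> omega
  · intro k hk p hp
    have a1 := h.lt_iff k hk p hp
    have a2 := h.lt_iff k hk j hjN
    have a3 := h.lt_iff k hk i hiN
    have a4 := inj p hp i hiN
    have a5 := inj p hp j hjN
    simp only [Function.update_apply]
    grind

/-- Decreasing the degree of `x` keeps the order after `x` is swapped with the first vertex `y` of
its degree. -/
theorem drop (h : Sorted N deg order pos start) {x : ℕ} (hx : x < N) (hd : deg x ≤ 2 * N)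
    (hpos : 0 < deg x) {i j y : ℕ} (hi : i = pos x) (hj : j = start (deg x)) (hy : y = order j) :
    Sorted N (Function.update deg x (deg x - 1))
      (Function.update (Function.update order i y) j x)
      (Function.update (Function.update pos y i) x j)
      (Function.update start (deg x) (j + 1)) := by
  have hiN := h.pos_lt x hx
  have hox := h.order_pos x hx
  rw [← hi] at hiN hox
  have h5 := (h.lt_iff (deg x) (by omega) i hiN)
  rw [hox] at h5
  have hij : j ≤ i := by omega
  have hjN : j < N := by omega
  have h1 := (h.lt_iff (deg x + 1) (by omega) i hiN)
  rw [hox] at h1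
  have h3 := (h.lt_iff (deg x + 1) (by omega) j hjN)
  have h4 := (h.lt_iff (deg x) (by omega) j hjN)
  rw [← hy] at h3 h4
  have hydeg : deg y = deg x := by omega
  have hyN : y < N := hy ▸ h.order_lt j hjN
  have hpy : pos y = j := by rw [hy]; exact h.pos_order j hjN
  have inj : ∀ p < N, ∀ q < N, order p = order q → p = q := fun p hp q hq e => by
    rw [← h.pos_order p hp, e, h.pos_order q hq]
  have op := h.order_pos
  have po := h.pos_order
  refine ⟨?_, ?_, ?_, ?_, ?_, ?_⟩
  · intro z hz
    have := h.pos_lt z hz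
    simp only [Function.update_apply]; split_ifs <;> omega
  · intro p hp
    have := h.order_lt p hp
    simp only [Function.update_apply]; split_ifs <;> omega
  · intro z hz
    simp only [Function.update_apply]
    have := op z hz
    grind
  · intro p hp
    simp only [Function.update_apply]
    have := po p hp
    grind
  · intro k hk
    have := h.start_le k hk
    simp only [Function.update_apply]; split_ifs <;> omega
  · intro k hk p hp
    have a1 := h.lt_iff k hk p hp
    have a2 := h.lt_iff k hk j hjN
    have a3 := h.lt_iff k hk i hiN
    have a4 := inj p hp i hiN
    have a5 := inj p hp j hjN
    simp only [Function.update_apply]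
    grind

end Sorted

/-- The two memories differ at most in the arrays in `S`. -/
def Same (S : List Arr) (m m' : Mem) : Prop := ∀ a, a ∉ S → m' a = m a

namespace Same

variable {S S' : List Arr} {m m' m'' : Mem}

theorem rfl : Same S m m := fun _ _ => Eq.refl _

theorem trans (h : Same S m m') (h' : Same S m' m'') : Same S m m'' :=
  fun a ha => (h' a ha).trans (h a ha)

theorem mono (h : Same S m m') (hS : S ⊆ S') : Same S' m m' := fun a ha => h a fun h' => ha (hS h')

theorem put (h : Same S m m') {a : Arr} {i w : ℕ} (ha : a ∈ S) :
    Same S m (CoreGadget.put m' a i w) :=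
  fun b hb => (put_ne _ _ _ fun e => hb (by rw [e]; exact ha)).trans (h b hb)

end Same

/-- The arrays that describe the degrees and the order of `L`. -/
abbrev orderArrs : List Arr := [.degL, .order, .pos, .start]

theorem bump_run {A N x : ℕ} {m : Mem} {o : Out} (hx : x < N) (hd : m .degL x ≤ 2 * N)
    (h : Sorted N (m .degL) (m .order) (m .pos) (m .start)) :
    Run A (bump x) m o 10 fun _ m' o' => o' = o ∧ Same orderArrs m m' ∧
      m' .degL = Function.update (m .degL) x (m .degL x + 1) ∧
      Sorted N (m' .degL) (m' .order) (m' .pos) (m' .start) := by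
  unfold bump
  iterate 3 refine Run.read ?_
  dsimp only
  refine Run.read ?_
  iterate 5 refine Run.write ?_
  refine Run.write_last ⟨rfl, ?_, ?_, ?_⟩
  · intro a ha
    simp only [List.mem_cons, List.not_mem_nil, not_or] at ha
    simp [put_ne, ha]
  · simp [put_ne]
  · simpa [put_ne] using h.bump hx hd rfl rfl rfl

theorem drop_run {A N x : ℕ} {m : Mem} {o : Out} (hx : x < N) (hd : m .degL x ≤ 2 * N)
    (hpos : 0 < m .degL x)
    (h : Sorted N (m .degL) (m .order) (m .pos) (m .start)) :
    Run A (drop x) m o 10 fun _ m' o' => o' = o ∧ Same orderArrs m m' ∧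
      m' .degL = Function.update (m .degL) x (m .degL x - 1) ∧
      Sorted N (m' .degL) (m' .order) (m' .pos) (m' .start) := by
  unfold drop
  iterate 4 refine Run.read ?_
  iterate 5 refine Run.write ?_
  refine Run.write_last ⟨rfl, ?_, ?_, ?_⟩
  · intro a ha
    simp only [List.mem_cons, List.not_mem_nil, not_or] at ha
    simp [put_ne, ha]
  · simp [put_ne]
  · simpa [put_ne] using h.drop hx hd hpos rfl rfl rfl

/-! ### The graph `G_exp` -/

/-- The graph that consists of `G`, the edges `B` between `V` and `L`, and the edges `X` between
`L` and `R`. -/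
def expGraph {n : ℕ} (G : SimpleGraph (Fin n)) (B X : Finset (ℕ × ℕ)) : SimpleGraph XVertex where
  Adj
    | orig i, orig j => ∃ (hi : i < n) (hj : j < n), G.Adj ⟨i, hi⟩ ⟨j, hj⟩
    | orig v, left x => (v, x) ∈ B
    | left x, orig v => (v, x) ∈ B
    | left x, right y => (x, y) ∈ X
    | right y, left x => (x, y) ∈ X
    | _, _ => False
  symm := ⟨by
    rintro (i | i | i) (j | j | j) h <;> try exact h
    obtain ⟨hi, hj, h⟩ := h
    exact ⟨hj, hi, h.symm⟩⟩
  loopless := ⟨by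
    rintro (i | i | i) h
    · obtain ⟨hi, hj, h⟩ := h
      exact h.ne rfl
    · exact h
    · exact h⟩

/-- The number of neighbours in `V` of `x ∈ L`. -/
def colDeg (B : Finset (ℕ × ℕ)) (x : ℕ) : ℕ := (B.filter fun p => p.2 = x).card

/-- The number of neighbours in `R` of `x ∈ L`. -/
def rowDeg (X : Finset (ℕ × ℕ)) (x : ℕ) : ℕ := (X.filter fun p => p.1 = x).card

theorem replay_append {V : Type} (G : SimpleGraph V) (l₁ l₂ : List (EdgeUpdate V)) :
    replay G (l₁ ++ l₂) = replay (replay G l₁) l₂ := by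
  induction l₁ generalizing G with
  | nil => rfl
  | cons e es ih => exact ih _

theorem legalSeq_append {V : Type} (G : SimpleGraph V) (l₁ l₂ : List (EdgeUpdate V)) :
    LegalSeq G (l₁ ++ l₂) ↔ LegalSeq G l₁ ∧ LegalSeq (replay G l₁) l₂ := by
  induction l₁ generalizing G with
  | nil => simp [LegalSeq, replay]
  | cons e es ih => simp [LegalSeq, replay, ih, and_assoc]

section expGraph

variable {n : ℕ} (G : SimpleGraph (Fin n)) (B X : Finset (ℕ × ℕ))

theorem expGraph_ins_VL (v x : ℕ) :
    (ins (orig v) (left x)).apply (expGraph G B X) = expGraph G (insert (v, x) B) X := by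
  ext a b
  rcases a with i | i | i <;> rcases b with j | j | j <;>
    simp [EdgeUpdate.apply, SimpleGraph.edge_adj, expGraph] <;> tauto

theorem expGraph_del_VL (v x : ℕ) :
    (del (orig v) (left x)).apply (expGraph G B X) = expGraph G (B.erase (v, x)) X := by
  ext a b
  rcases a with i | i | i <;> rcases b with j | j | j <;>
    simp [EdgeUpdate.apply, expGraph] <;> tauto

theorem expGraph_ins_LR (x y : ℕ) :
    (ins (left x) (right y)).apply (expGraph G B X) = expGraph G B (insert (x, y) X) := by
  ext a b
  rcases a with i | i | i <;> rcases b with j | j | j <;>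
    simp [EdgeUpdate.apply, SimpleGraph.edge_adj, expGraph] <;> tauto

theorem expGraph_del_LR (x y : ℕ) :
    (del (left x) (right y)).apply (expGraph G B X) = expGraph G B (X.erase (x, y)) := by
  ext a b
  rcases a with i | i | i <;> rcases b with j | j | j <;>
    simp [EdgeUpdate.apply, expGraph] <;> tauto

theorem expGraph_ins_V (u v : Fin n) :
    (ins (orig u) (orig v)).apply (expGraph G B X) = expGraph ((ins u v).apply G) B X := by
  ext a b
  rcases a with i | i | i <;> rcases b with j | j | j <;>
    simp [EdgeUpdate.apply, SimpleGraph.edge_adj, expGraph]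
  constructor
  · rintro (⟨hi, hj, h⟩ | ⟨h, h'⟩)
    · exact ⟨hi, hj, Or.inl h⟩
    · have hi : i < n := by omega
      have hj : j < n := by omega
      refine ⟨hi, hj, Or.inr ⟨?_, h'⟩⟩
      simpa [Fin.ext_iff] using h
  · rintro ⟨hi, hj, h | ⟨h, h'⟩⟩
    · exact Or.inl ⟨hi, hj, h⟩
    · refine Or.inr ⟨?_, h'⟩
      simpa [Fin.ext_iff] using h

theorem expGraph_del_V (u v : Fin n) :
    (del (orig u) (orig v)).apply (expGraph G B X) = expGraph ((del u v).apply G) B X := by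
  ext a b
  rcases a with i | i | i <;> rcases b with j | j | j <;>
    simp [EdgeUpdate.apply, expGraph]
  constructor
  · rintro ⟨⟨hi, hj, h⟩, h'⟩
    refine ⟨hi, hj, h, ?_⟩
    simpa [Fin.ext_iff] using h'
  · rintro ⟨hi, hj, h, h'⟩
    refine ⟨⟨hi, hj, h⟩, ?_⟩
    simpa [Fin.ext_iff] using h'

end expGraph

/-- The output is a legal sequence of updates that turns the empty graph into
`expGraph G B X`, and the degrees and the sorted order of `L` in memory are those of this graph. -/
structure Base {n : ℕ} (N : ℕ) (G : SimpleGraph (Fin n)) (B X : Finset (ℕ × ℕ)) (m : Mem)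
    (o : Out) : Prop where
  legal : LegalSeq ⊥ o
  graph : replay ⊥ o = expGraph G B X
  B_sub : B ⊆ Finset.range n ×ˢ Finset.range N
  X_sub : X ⊆ Finset.range N ×ˢ Finset.range N
  deg : ∀ x < N, m .degL x = colDeg B x + rowDeg X x
  sorted : Sorted N (m .degL) (m .order) (m .pos) (m .start)

theorem colDeg_le {n N : ℕ} {B : Finset (ℕ × ℕ)} (h : B ⊆ Finset.range n ×ˢ Finset.range N)
    (x : ℕ) : colDeg B x ≤ n := by
  calc colDeg B x ≤ ((Finset.range n).image fun v => (v, x)).card := by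
        refine Finset.card_le_card fun p hp => ?_
        rw [Finset.mem_filter] at hp
        have := h hp.1
        simp only [Finset.mem_product, Finset.mem_range] at this
        simp only [Finset.mem_image, Finset.mem_range]
        exact ⟨p.1, this.1, by rw [← hp.2]⟩
    _ ≤ n := Finset.card_image_le.trans (by simp)

theorem rowDeg_le {n N : ℕ} {B : Finset (ℕ × ℕ)} (h : B ⊆ Finset.range n ×ˢ Finset.range N)
    (x : ℕ) : rowDeg B x ≤ N := by
  calc rowDeg B x ≤ ((Finset.range N).image fun v => (x, v)).card := by
        refine Finset.card_le_card fun p hp => ?_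
        rw [Finset.mem_filter] at hp
        have := h hp.1
        simp only [Finset.mem_product, Finset.mem_range] at this
        simp only [Finset.mem_image, Finset.mem_range]
        exact ⟨p.2, this.2, by rw [← hp.2]⟩
    _ ≤ N := Finset.card_image_le.trans (by simp)

theorem colDeg_insert {B : Finset (ℕ × ℕ)} {v x : ℕ} (h : (v, x) ∉ B) (y : ℕ) :
    colDeg (insert (v, x) B) y = colDeg B y + if y = x then 1 else 0 := by
  unfold colDeg
  rw [Finset.filter_insert]
  by_cases hy : y = x
  · subst hy
    rw [if_pos rfl, if_pos rfl, Finset.card_insert_of_notMem (by simp [h])]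
  · rw [if_neg hy, if_neg (by simpa using Ne.symm hy), add_zero]

theorem rowDeg_insert {B : Finset (ℕ × ℕ)} {v x : ℕ} (h : (v, x) ∉ B) (y : ℕ) :
    rowDeg (insert (v, x) B) y = rowDeg B y + if y = v then 1 else 0 := by
  unfold rowDeg
  rw [Finset.filter_insert]
  by_cases hy : y = v
  · subst hy
    rw [if_pos rfl, if_pos rfl, Finset.card_insert_of_notMem (by simp [h])]
  · rw [if_neg hy, if_neg (by simpa using Ne.symm hy), add_zero]

theorem colDeg_erase {B : Finset (ℕ × ℕ)} {v x : ℕ} (h : (v, x) ∈ B) (y : ℕ) :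
    colDeg B y = colDeg (B.erase (v, x)) y + if y = x then 1 else 0 := by
  rw [← colDeg_insert (Finset.notMem_erase _ _), Finset.insert_erase h]

theorem rowDeg_erase {B : Finset (ℕ × ℕ)} {v x : ℕ} (h : (v, x) ∈ B) (y : ℕ) :
    rowDeg B y = rowDeg (B.erase (v, x)) y + if y = v then 1 else 0 := by
  rw [← rowDeg_insert (Finset.notMem_erase _ _), Finset.insert_erase h]

namespace Base

variable {A n N : ℕ} {G : SimpleGraph (Fin n)} {B X : Finset (ℕ × ℕ)} {m : Mem} {o : Out}

theorem deg_le (h : Base N G B X m o) (hn : n ≤ N) {x : ℕ} (hx : x < N) : m .degL x ≤ 2 * N := by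
  rw [h.deg x hx]
  have := colDeg_le h.B_sub x
  have := rowDeg_le h.X_sub x
  omega

/-- `Base` depends only on four arrays. -/
theorem congr (h : Base N G B X m o) {m' : Mem} (h1 : m' .degL = m .degL)
    (h2 : m' .order = m .order) (h3 : m' .pos = m .pos) (h4 : m' .start = m .start) :
    Base N G B X m' o :=
  ⟨h.legal, h.graph, h.B_sub, h.X_sub, by rw [h1]; exact h.deg,
    by rw [h1, h2, h3, h4]; exact h.sorted⟩

theorem put (h : Base N G B X m o) {a : Arr} {i w : ℕ} (h1 : Arr.degL ≠ a := by decide)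
    (h2 : Arr.order ≠ a := by decide) (h3 : Arr.pos ≠ a := by decide)
    (h4 : Arr.start ≠ a := by decide) :
    Base N G B X (put m a i w) o :=
  h.congr (put_ne _ _ _ h1) (put_ne _ _ _ h2) (put_ne _ _ _ h3) (put_ne _ _ _ h4)

theorem legal_snoc (h : Base N G B X m o) {e : EdgeUpdate XVertex} (he : e.Legal (expGraph G B X)) :
    LegalSeq ⊥ (o ++ [e]) := by
  rw [legalSeq_append, h.graph]
  exact ⟨h.legal, he, trivial⟩

theorem replay_snoc (h : Base N G B X m o) (e : EdgeUpdate XVertex) :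
    replay ⊥ (o ++ [e]) = e.apply (expGraph G B X) := by
  rw [replay_append, h.graph]
  rfl

theorem run_ins_VL (h : Base N G B X m o) (hn : n ≤ N) {v x : ℕ} (hv : v < n) (hx : x < N)
    (hB : (v, x) ∉ B) :
    Run A (do emit (ins (orig v) (left x)); bump x) m o 11 fun _ m' o' =>
      Base N G (insert (v, x) B) X m' o' ∧ Same orderArrs m m' := by
  refine Run.emit ((bump_run hx (h.deg_le hn hx) h.sorted).mono le_rfl ?_)
  rintro _ m' o' ⟨rfl, hr, hd, hs⟩
  refine ⟨⟨h.legal_snoc ⟨by simp, hB⟩, ?_, ?_, h.X_sub, ?_, hs⟩, hr⟩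
  · rw [h.replay_snoc, expGraph_ins_VL]
  · exact Finset.insert_subset (by simp [hv, hx]) h.B_sub
  · intro y hy
    rw [hd, colDeg_insert hB, Function.update_apply, h.deg x hx, h.deg y hy]
    split_ifs with e
    · subst e; omega
    · omega

theorem run_del_VL (h : Base N G B X m o) (hn : n ≤ N) {v x : ℕ}
    (hB : (v, x) ∈ B) :
    Run A (do emit (del (orig v) (left x)); drop x) m o 11 fun _ m' o' =>
      Base N G (B.erase (v, x)) X m' o' ∧ Same orderArrs m m' := by
  have hx : x < N := by simpa using (Finset.mem_product.1 (h.B_sub hB)).2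
  have he := fun y => colDeg_erase hB y
  have hp : 0 < m .degL x := by
    rw [h.deg x hx, he]; simp
  refine Run.emit ((drop_run hx (h.deg_le hn hx) hp h.sorted).mono le_rfl ?_)
  rintro _ m' o' ⟨rfl, hr, hd, hs⟩
  refine ⟨⟨h.legal_snoc hB, ?_, (Finset.erase_subset _ _).trans h.B_sub, h.X_sub, ?_, hs⟩, hr⟩
  · rw [h.replay_snoc, expGraph_del_VL]
  · intro y hy
    have := he y
    rw [hd, Function.update_apply, h.deg x hx, h.deg y hy]
    split_ifs with e
    · subst e; simp at this; omega
    · simp [e] at this; omega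

theorem run_ins_LR (h : Base N G B X m o) (hn : n ≤ N) {x y : ℕ} (hx : x < N) (hy : y < N)
    (hX : (x, y) ∉ X) :
    Run A (do emit (ins (left x) (right y)); bump x) m o 11 fun _ m' o' =>
      Base N G B (insert (x, y) X) m' o' ∧ Same orderArrs m m' := by
  refine Run.emit ((bump_run hx (h.deg_le hn hx) h.sorted).mono le_rfl ?_)
  rintro _ m' o' ⟨rfl, hr, hd, hs⟩
  refine ⟨⟨h.legal_snoc ⟨by simp, hX⟩, ?_, h.B_sub, ?_, ?_, hs⟩, hr⟩
  · rw [h.replay_snoc, expGraph_ins_LR]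
  · exact Finset.insert_subset (by simp [hy, hx]) h.X_sub
  · intro z hz
    rw [hd, rowDeg_insert hX, Function.update_apply, h.deg x hx, h.deg z hz]
    split_ifs with e
    · subst e; omega
    · omega

theorem run_del_LR (h : Base N G B X m o) (hn : n ≤ N) {x y : ℕ}
    (hX : (x, y) ∈ X) :
    Run A (do emit (del (left x) (right y)); drop x) m o 11 fun _ m' o' =>
      Base N G B (X.erase (x, y)) m' o' ∧ Same orderArrs m m' := by
  have hx : x < N := by simpa using (Finset.mem_product.1 (h.X_sub hX)).1
  have he := fun y => rowDeg_erase hX y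
  have hp : 0 < m .degL x := by
    rw [h.deg x hx, he]; simp
  refine Run.emit ((drop_run hx (h.deg_le hn hx) hp h.sorted).mono le_rfl ?_)
  rintro _ m' o' ⟨rfl, hr, hd, hs⟩
  refine ⟨⟨h.legal_snoc hX, ?_, h.B_sub, (Finset.erase_subset _ _).trans h.X_sub, ?_, hs⟩, hr⟩
  · rw [h.replay_snoc, expGraph_del_LR]
  · intro y hy
    have := he y
    rw [hd, Function.update_apply, h.deg x hx, h.deg y hy]
    split_ifs with e
    · subst e; simp at this; omega
    · simp [e] at this; omega

end Base

/-! ### Tables of neighbours -/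

/-- The pairs `(v, f v j)` for `j < i`. -/
def tabRow (f : ℕ → ℕ → ℕ) (v i : ℕ) : Finset (ℕ × ℕ) := (Finset.range i).image fun j => (v, f v j)

/-- The set of pairs described by a table whose row `v` is `f v 0, …, f v (len v - 1)`, restricted
to the rows before `v` and the first `i` entries of row `v`. -/
def tab (f : ℕ → ℕ → ℕ) (len : ℕ → ℕ) (v i : ℕ) : Finset (ℕ × ℕ) :=
  ((Finset.range v).biUnion fun w => tabRow f w (len w)) ∪ tabRow f v i

section tab

variable {f : ℕ → ℕ → ℕ} {len : ℕ → ℕ} {v i : ℕ}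

theorem mem_tab {w x : ℕ} : (w, x) ∈ tab f len v i ↔
    (w < v ∧ ∃ j < len w, f w j = x) ∨ (w = v ∧ ∃ j < i, f w j = x) := by
  simp only [tab, tabRow, Finset.mem_union, Finset.mem_biUnion, Finset.mem_range, Finset.mem_image,
    Prod.mk.injEq]
  constructor
  · rintro (⟨u, hu, j, hj, rfl, rfl⟩ | ⟨j, hj, rfl, rfl⟩)
    · exact Or.inl ⟨hu, j, hj, rfl⟩
    · exact Or.inr ⟨rfl, j, hj, rfl⟩
  · rintro (⟨hu, j, hj, rfl⟩ | ⟨rfl, j, hj, rfl⟩)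
    · exact Or.inl ⟨w, hu, j, hj, rfl, rfl⟩
    · exact Or.inr ⟨j, hj, rfl, rfl⟩

theorem mem_tab_zero {w x : ℕ} : (w, x) ∈ tab f len v 0 ↔ w < v ∧ ∃ j < len w, f w j = x := by
  simp [mem_tab]

@[simp] theorem tab_zero_zero : tab f len 0 0 = ∅ := by
  ext ⟨w, x⟩; simp [mem_tab]

theorem tab_succ : tab f len v (i + 1) = insert (v, f v i) (tab f len v i) := by
  simp [tab, tabRow, Finset.range_add_one, Finset.union_insert]

theorem tab_len : tab f len v (len v) = tab f len (v + 1) 0 := by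
  ext ⟨w, x⟩
  simp only [mem_tab, Nat.lt_succ_iff_lt_or_eq]
  constructor
  · rintro (h | ⟨rfl, h⟩)
    · exact Or.inl ⟨Or.inl h.1, h.2⟩
    · exact Or.inl ⟨Or.inr rfl, h⟩
  · rintro (⟨h | rfl, h'⟩ | ⟨_, j, hj, _⟩)
    · exact Or.inl ⟨h, h'⟩
    · exact Or.inr ⟨rfl, h'⟩
    · omega

theorem tab_congr {f' : ℕ → ℕ → ℕ} {len' : ℕ → ℕ} (h1 : ∀ w < v, len w = len' w)
    (h2 : ∀ w < v, ∀ j < len w, f w j = f' w j) : tab f len v 0 = tab f' len' v 0 := by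
  ext ⟨w, x⟩
  rw [mem_tab_zero, mem_tab_zero]
  refine and_congr_right fun hw => ?_
  rw [← h1 w hw]
  refine exists_congr fun j => and_congr_right fun hj => ?_
  rw [h2 w hw j hj]

theorem notMem_tab_of_inj (h : ∀ j < i, f v j ≠ f v i) : (v, f v i) ∉ tab f len v i := by
  rw [mem_tab]
  rintro (⟨h1, -⟩ | ⟨-, j, hj, e⟩)
  · omega
  · exact h j hj e

theorem card_tab_zero (h : ∀ w < v, ∀ i < len w, ∀ j < len w, f w i = f w j → i = j) :
    (tab f len v 0).card = ∑ w ∈ Finset.range v, len w := by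
  induction v with
  | zero => simp
  | succ v ih =>
    have key : ∀ i ≤ len v, (tab f len v i).card = (tab f len v 0).card + i := by
      intro i hi
      induction i with
      | zero => rfl
      | succ i ihi =>
        rw [tab_succ, Finset.card_insert_of_notMem, ihi (by omega), add_assoc]
        refine notMem_tab_of_inj fun j hj e => ?_
        have := h v (by omega) j (by omega) i (by omega) e
        omega
    rw [← tab_len, key _ le_rfl, ih fun w hw => h w (by omega), Finset.sum_range_succ]

end tab

theorem rowDeg_tab {f : ℕ → ℕ → ℕ} {len : ℕ → ℕ} {n v : ℕ} (hv : v < n)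
    (h : ∀ i < len v, ∀ j < len v, f v i = f v j → i = j) : rowDeg (tab f len n 0) v = len v := by
  unfold rowDeg
  have : ((tab f len n 0).filter fun p => p.1 = v) =
      (Finset.range (len v)).image fun i => (v, f v i) := by
    ext ⟨w, x⟩
    rw [Finset.mem_filter, mem_tab_zero]
    simp only [Finset.mem_image, Finset.mem_range, Prod.mk.injEq]
    constructor
    · rintro ⟨⟨_, j, hj, rfl⟩, rfl⟩
      exact ⟨j, hj, rfl, rfl⟩
    · rintro ⟨j, hj, rfl, rfl⟩
      exact ⟨⟨hv, j, hj, rfl⟩, rfl⟩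
  rw [this, Finset.card_image_of_injOn, Finset.card_range]
  intro i hi j hj e
  simp only [Finset.coe_range, Set.mem_Iio] at hi hj
  exact h i hi j hj (Prod.mk.inj e).2

/-- The indices into an array that stores a matrix with `N` columns determine row and column. -/
theorem cell_inj {N v w x y : ℕ} (hx : x < N) (hy : y < N) (h : v * N + x = w * N + y) :
    v = w ∧ x = y := by
  have h1 : (v * N + x) / N = v := by
    rw [Nat.mul_comm, Nat.mul_add_div (by omega), Nat.div_eq_of_lt hx, add_zero]
  have h2 : (w * N + y) / N = w := by
    rw [Nat.mul_comm, Nat.mul_add_div (by omega), Nat.div_eq_of_lt hy, add_zero]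
  have : v = w := by rw [← h1, h, h2]
  subst this
  exact ⟨rfl, by omega⟩

theorem update_cell {N : ℕ} (F : ℕ → ℕ) {v w x y : ℕ} (c : ℕ) (hx : x < N) (hy : y < N) :
    Function.update F (v * N + x) c (w * N + y) =
      if w = v ∧ y = x then c else F (w * N + y) := by
  rw [Function.update_apply]
  refine if_congr ⟨fun h => ?_, ?_⟩ rfl rfl
  · exact cell_inj hy hx h
  · rintro ⟨rfl, rfl⟩; rfl

/-! ### The Round-Robin allocation -/

/-- The position in `L` at which the allocation of `v` starts. -/
def rrStart (N : ℕ) (g : ℕ → ℕ) (v : ℕ) : ℕ := (∑ u ∈ Finset.range v, (g u + 3)) % N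

/-- The `i`-th neighbour of `v`. -/
def rrNbr (N : ℕ) (g : ℕ → ℕ) (v i : ℕ) : ℕ := (rrStart N g v + i) % N

/-- The Round-Robin edges. -/
def rrSet (N : ℕ) (g : ℕ → ℕ) (n : ℕ) : Finset (ℕ × ℕ) := tab (rrNbr N g) (fun v => g v + 3) n 0

section RoundRobin

variable {N n : ℕ} {g : ℕ → ℕ}

theorem rrStart_succ (v : ℕ) : rrStart N g (v + 1) = (rrStart N g v + (g v + 3)) % N := by
  simp [rrStart, Finset.sum_range_succ]

/-- The `i`-th neighbour of `v` is the vertex at circular distance `i` from the starting position;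
this is how BALANCE tests whether an edge is a Round-Robin edge. -/
theorem rrNbr_eq_iff {v i x : ℕ} (hx : x < N) (hi : i < N) :
    rrNbr N g v i = x ↔ (x + N - rrStart N g v) % N = i := by
  have hs : rrStart N g v < N := Nat.mod_lt _ (by omega)
  unfold rrNbr
  generalize rrStart N g v = s at *
  have h1 : (s + i) % N = if s + i < N then s + i else s + i - N := by
    split_ifs with h
    · exact Nat.mod_eq_of_lt h
    · rw [Nat.mod_eq_sub_mod (by omega), Nat.mod_eq_of_lt (by omega)]
  have h2 : (x + N - s) % N = if x < s then x + N - s else x - s := by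
    split_ifs with h
    · exact Nat.mod_eq_of_lt (by omega)
    · rw [show x + N - s = (x - s) + N by omega, Nat.add_mod_right, Nat.mod_eq_of_lt (by omega)]
  rw [h1, h2]
  split_ifs <;> omega

theorem rrNbr_inj {v i j : ℕ} (hi : i < N) (hj : j < N) (h : rrNbr N g v i = rrNbr N g v j) :
    i = j := by
  have hx : rrNbr N g v j < N := Nat.mod_lt _ (by omega)
  rw [rrNbr_eq_iff hx hi] at h
  have := (rrNbr_eq_iff (g := g) (v := v) hx hj).1 rfl
  omega

theorem mem_rrSet {v x : ℕ} (hx : x < N) (hg : g v + 3 ≤ N) :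
    (v, x) ∈ rrSet N g n ↔ v < n ∧ (x + N - rrStart N g v) % N < g v + 3 := by
  unfold rrSet
  rw [mem_tab_zero]
  refine and_congr_right fun _ => ⟨?_, fun h => ⟨_, h, ?_⟩⟩
  · rintro ⟨j, hj, e⟩
    rw [rrNbr_eq_iff hx (by omega)] at e
    omega
  · rw [rrNbr_eq_iff hx (by omega)]

/-- The Round-Robin algorithm walks around the circle `L` without a gap, so that `x ∈ L` receives
as many edges as there are numbers congruent to `x` among the first ones. -/
theorem colDeg_rrSet_eq_count (hg : ∀ v < n, g v + 3 ≤ N) {x : ℕ} (hx : x < N) :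
    colDeg (rrSet N g n) x = Nat.count (· ≡ x [MOD N]) (∑ v ∈ Finset.range n, (g v + 3)) := by
  induction n with
  | zero => simp [rrSet, colDeg]
  | succ n ih =>
    have key : ∀ i ≤ g n + 3, colDeg (tab (rrNbr N g) (fun v => g v + 3) n i) x =
        Nat.count (· ≡ x [MOD N]) (∑ v ∈ Finset.range n, (g v + 3) + i) := by
      intro i hi
      induction i with
      | zero => exact ih fun v hv => hg v (by omega)
      | succ i ihi =>
        have := hg n (by omega)
        rw [tab_succ, colDeg_insert, ihi (by omega), ← add_assoc, Nat.count_succ]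
        · congr 1
          refine if_congr ?_ rfl rfl
          simp only [rrNbr, rrStart, Nat.mod_add_mod, Nat.ModEq, Nat.mod_eq_of_lt hx]
          exact eq_comm
        · refine notMem_tab_of_inj fun j hj e => ?_
          have := rrNbr_inj (by omega) (by omega) e
          omega
    have := key _ le_rfl
    rw [tab_len (len := fun v => g v + 3)] at this
    rw [rrSet, this, Finset.sum_range_succ]

/-- The Round-Robin degrees in `L` differ by at most one. -/
theorem colDeg_rrSet (hg : ∀ v < n, g v + 3 ≤ N) {x : ℕ} (hx : x < N) :
    (∑ v ∈ Finset.range n, (g v + 3)) / N ≤ colDeg (rrSet N g n) x ∧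
      colDeg (rrSet N g n) x ≤ (∑ v ∈ Finset.range n, (g v + 3)) / N + 1 := by
  rw [colDeg_rrSet_eq_count hg hx, Nat.count_modEq_card _ (by omega)]
  split_ifs <;> omega

end RoundRobin

/-! ### BALANCE -/

/-- The arrays `degVL`, `nbrVL`, `adjVL` describe the set `B` of edges between `V` and `L`. -/
structure VLArrays (n N : ℕ) (B : Finset (ℕ × ℕ)) (m : Mem) : Prop where
  eq_tab : B = tab (fun v i => m .nbrVL (v * N + i)) (m .degVL) n 0
  inj : ∀ v < n, ∀ i < m .degVL v, ∀ j < m .degVL v,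
    m .nbrVL (v * N + i) = m .nbrVL (v * N + j) → i = j
  adj : ∀ v < n, ∀ x < N, m .adjVL (v * N + x) = if (v, x) ∈ B then 1 else 0

namespace VLArrays

variable {n N : ℕ} {B : Finset (ℕ × ℕ)} {m m' : Mem}

theorem congr (h : VLArrays n N B m) (h1 : m' .degVL = m .degVL) (h2 : m' .nbrVL = m .nbrVL)
    (h3 : m' .adjVL = m .adjVL) : VLArrays n N B m' :=
  ⟨by rw [h1, h2]; exact h.eq_tab, by rw [h1, h2]; exact h.inj, by rw [h3]; exact h.adj⟩

theorem nbr_mem (h : VLArrays n N B m) {v i : ℕ} (hv : v < n) (hi : i < m .degVL v) :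
    (v, m .nbrVL (v * N + i)) ∈ B := by
  rw [h.eq_tab, mem_tab_zero]
  exact ⟨hv, i, hi, rfl⟩

theorem nbr_lt (h : VLArrays n N B m) (hB : B ⊆ Finset.range n ×ˢ Finset.range N) {v i : ℕ}
    (hv : v < n) (hi : i < m .degVL v) : m .nbrVL (v * N + i) < N := by
  have := hB (h.nbr_mem hv hi)
  simp at this
  exact this.2

theorem card_eq (h : VLArrays n N B m) : B.card = ∑ v ∈ Finset.range n, m .degVL v := by
  conv_lhs => rw [h.eq_tab]
  exact card_tab_zero h.inj

/-- `degVL v` is the number of neighbours of `v`. -/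
theorem rowDeg_eq (h : VLArrays n N B m) {v : ℕ} (hv : v < n) : rowDeg B v = m .degVL v := by
  rw [h.eq_tab]
  exact rowDeg_tab hv (h.inj v hv)

end VLArrays

/-- The arrays that BALANCE may change. -/
abbrev balanceArrs : List Arr :=
  [.degL, .order, .pos, .start, .offset, .adjVL, .nbrVL, .degVL]

section balance

variable {A n N : ℕ} {G : SimpleGraph (Fin n)} {B X : Finset (ℕ × ℕ)} {m : Mem} {o : Out}

/-- BALANCE, first loop: the starting positions of the Round-Robin allocation. -/
theorem offsets_run : Run A (loop n fun v => do
      let s ← read .offset v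
      let g ← read .degG v
      write .offset (v + 1) ((s + (g + 3)) % N)) (put m .offset 0 0) o (4 * n + 1)
    fun _ m' o' => o' = o ∧ Same [.offset] m m' ∧
      ∀ v ≤ n, m' .offset v = rrStart N (m .degG) v := by
  refine Run.loop_const (c := 3) (fun v m' o' => o' = o ∧ Same [.offset] m m' ∧
    ∀ u ≤ v, m' .offset u = rrStart N (m .degG) u) ?_ ?_
  · refine ⟨rfl, Same.rfl.put (by simp), ?_⟩
    intro u hu
    obtain rfl : u = 0 := by omega
    simp [rrStart]
  · rintro v hv m' o' ⟨rfl, h1, h2⟩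
    refine Run.read (Run.read (Run.write_last ⟨rfl, h1.put (by simp), ?_⟩))
    intro u hu
    rw [put_same, Function.update_apply]
    split_ifs with e
    · rw [e, rrStart_succ, h2 v le_rfl, h1 .degG (by simp)]
    · exact h2 u (by omega)

/-- BALANCE, second loop. The array `adjVL` keeps describing the old edges `B`; a Round-Robin edge
is never met twice, since a row of the allocation has no repetitions. -/
theorem balance_insert_run (hn : n ≤ N) (hN : 0 < N) (hB : Base N G B X m o)
    (hadj : ∀ v < n, ∀ x < N, m .adjVL (v * N + x) = if (v, x) ∈ B then 1 else 0)
    (hg : ∀ v < n, m .degG v + 3 ≤ N)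
    (hoff : ∀ v < n, m .offset v = rrStart N (m .degG) v) :
    Run A (loop n fun v => do
        let s ← read .offset v
        let g ← read .degG v
        loop (g + 3) fun i => do
          let x := (s + i) % N
          let b ← read .adjVL (v * N + x)
          if b = 0 then
            emit (ins (orig v) (left x))
            bump x) m o
      (1 + ∑ v ∈ Finset.range n, ((13 * (m .degG v + 3) + 3) + 1))
      fun _ m' o' => Base N G (B ∪ rrSet N (m .degG) n) X m' o' ∧ Same orderArrs m m' := by
  set g := m .degG with hgdef
  set T := tab (rrNbr N g) (fun v => g v + 3) with hT
  refine Run.loop (fun v m' o' => Base N G (B ∪ T v 0) X m' o' ∧ Same orderArrs m m')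
    (fun v => 13 * (g v + 3) + 3) (by simpa [hT] using ⟨hB, Same.rfl⟩) ?_
  rintro v hv m₁ o₁ ⟨h1, h2⟩
  refine Run.read (Run.read ?_)
  rw [h2 .offset (by simp), h2 .degG (by simp), hoff v hv, ← hgdef]
  refine (Run.loop_const (c := 12) (fun i m' o' => Base N G (B ∪ T v i) X m' o' ∧
    Same orderArrs m m') ⟨h1, h2⟩ ?_).mono le_rfl ?_
  · rintro i hi m₂ o₂ ⟨h3, h4⟩
    have hgv := hg v hv
    have hx : rrNbr N g v i < N := Nat.mod_lt _ hN
    change Run A (read .adjVL (v * N + rrNbr N g v i) >>= fun b => if b = 0 then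
      (do emit (ins (orig v) (left (rrNbr N g v i))); bump (rrNbr N g v i)) else pure ()) _ _ _ _
    refine Run.read (c := 11) ?_
    rw [h4 .adjVL (by simp), hadj v hv _ hx, hT, tab_succ, ← hT]
    have hT' : (v, rrNbr N g v i) ∉ T v i := notMem_tab_of_inj fun j hj e => by
      have := rrNbr_inj (by omega) (by omega) e
      omega
    by_cases hb : (v, rrNbr N g v i) ∈ B
    · rw [if_pos hb, if_neg (by simp)]
      refine Run.pure ⟨?_, h4⟩
      rwa [Finset.union_insert, Finset.insert_eq_of_mem (Finset.mem_union_left _ hb)]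
    · rw [if_neg hb, if_pos rfl, Finset.union_insert]
      refine (h3.run_ins_VL hn hv hx ?_).mono le_rfl ?_
      · simp [hb, hT']
      · exact fun _ m' o' h => ⟨h.1, h4.trans h.2⟩
  · rintro _ m' o' ⟨h3, h4⟩
    refine ⟨?_, h4⟩
    rwa [hT, tab_len (len := fun v => g v + 3)] at h3

/-- BALANCE, third loop: every old edge is unmarked in `adjVL`, and removed unless it is a
Round-Robin edge. -/
theorem balance_remove_run (hn : n ≤ N) (hV : VLArrays n N B m)
    (hBsub : B ⊆ Finset.range n ×ˢ Finset.range N)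
    (hB : Base N G (B ∪ rrSet N (m .degG) n) X m o)
    (hg : ∀ v < n, m .degG v + 3 ≤ N)
    (hoff : ∀ v < n, m .offset v = rrStart N (m .degG) v) :
    Run A (loop n fun v => do
        let s ← read .offset v
        let g ← read .degG v
        let k ← read .degVL v
        loop k fun i => do
          let x ← read .nbrVL (v * N + i)
          write .adjVL (v * N + x) 0
          if g + 3 ≤ (x + N - s) % N then
            emit (del (orig v) (left x))
            drop x) m o
      (1 + ∑ v ∈ Finset.range n, ((14 * m .degVL v + 4) + 1))
      fun _ m' o' => Base N G (rrSet N (m .degG) n) X m' o' ∧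
        Same (.adjVL :: orderArrs) m m' ∧ ∀ v < n, ∀ x < N, m' .adjVL (v * N + x) = 0 := by
  set g := m .degG with hgdef
  set R := rrSet N g n with hR
  set f : ℕ → ℕ → ℕ := fun v i => m .nbrVL (v * N + i) with hf
  set T := tab f (m .degVL) with hT
  have hBT : B = T n 0 := hV.eq_tab
  -- `B \ T v i` are the old edges that are still to be considered
  let I : ℕ → ℕ → Mem → Out → Prop := fun v i m' o' =>
    Base N G (B \ T v i ∪ R) X m' o' ∧ Same (.adjVL :: orderArrs) m m' ∧
      ∀ w < n, ∀ x < N, m' .adjVL (w * N + x) = if (w, x) ∈ B \ T v i then 1 else 0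
  refine (Run.loop (fun v => I v 0) (fun v => 14 * m .degVL v + 4) ?_ ?_).mono le_rfl ?_
  · simpa [I, hT] using ⟨hB, Same.rfl, hV.adj⟩
  · rintro v hv m₁ o₁ ⟨h1, h2, h2'⟩
    refine Run.read (Run.read (Run.read ?_))
    rw [h2 .offset (by simp), h2 .degG (by simp), h2 .degVL (by simp), hoff v hv, ← hgdef]
    refine (Run.loop_const (c := 13) (I v) ⟨h1, h2, h2'⟩ ?_).mono le_rfl ?_
    · rintro i hi m₂ o₂ ⟨h3, h4, h5⟩
      have hgv := hg v hv
      refine Run.read (c := 12) (Run.write (c := 11) ?_)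
      rw [h4 .nbrVL (by simp)]
      change Run A (if g v + 3 ≤ (f v i + N - rrStart N g v) % N then
        (do emit (del (orig v) (left (f v i))); drop (f v i)) else pure ()) _ _ _ _
      have hx : f v i < N := hV.nbr_lt hBsub hv hi
      have hmB : (v, f v i) ∈ B := hV.nbr_mem hv hi
      have hTn : (v, f v i) ∉ T v i := notMem_tab_of_inj fun j hj e => by
        have := hV.inj v hv j (by omega) i hi e
        omega
      have hTs : T v (i + 1) = insert (v, f v i) (T v i) := tab_succ
      have hadj : ∀ w < n, ∀ x < N, put m₂ .adjVL (v * N + f v i) 0 .adjVL (w * N + x) =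
          if (w, x) ∈ B \ T v (i + 1) then 1 else 0 := by
        intro w hw x hxN
        rw [put_same, update_cell _ _ hx hxN, h5 w hw x hxN, hTs]
        by_cases e : w = v ∧ x = f v i
        · simp [e]
        · rw [if_neg e]
          simp only [Finset.mem_sdiff, Finset.mem_insert, Prod.mk.injEq, e, false_or]
      have hRm : (v, f v i) ∈ R ↔ ¬ g v + 3 ≤ (f v i + N - rrStart N g v) % N := by
        rw [hR, mem_rrSet hx hgv]; simp [hv]
      by_cases hc : g v + 3 ≤ (f v i + N - rrStart N g v) % N
      · rw [if_pos hc]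
        have hnR : (v, f v i) ∉ R := by rw [hRm]; simpa using hc
        refine ((h3.put).run_del_VL (v := v) (x := f v i) hn ?_).mono le_rfl ?_
        · simp [hmB, hTn]
        · rintro _ m' o' ⟨h6, h7⟩
          refine ⟨?_, (h4.put (by simp)).trans (h7.mono (by simp)), ?_⟩
          · convert h6 using 1
            rw [hTs]
            ext p
            simp only [Finset.mem_union, Finset.mem_sdiff, Finset.mem_insert, Finset.mem_erase]
            by_cases hp : p = (v, f v i)
            · subst hp; simp [hnR]
            · simp [hp]
          · rw [h7 .adjVL (by simp)]
            exact hadj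
      · rw [if_neg hc]
        refine Run.pure ⟨?_, h4.put (by simp), hadj⟩
        have hmR : (v, f v i) ∈ R := by rw [hRm]; exact hc
        convert h3.put (a := .adjVL) (i := v * N + f v i) (w := 0) using 1
        rw [hTs]
        ext p
        simp only [Finset.mem_union, Finset.mem_sdiff, Finset.mem_insert]
        by_cases hp : p = (v, f v i)
        · subst hp; simp [hmR]
        · simp [hp]
    · intro _ m' o' h
      have : T v (m .degVL v) = T (v + 1) 0 := tab_len
      simpa only [I, this] using h
  · rintro _ m' o' ⟨h1, h2, h3⟩
    simp only [← hBT, Finset.sdiff_self, Finset.empty_union, Finset.notMem_empty, if_false] at h1 h3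
    exact ⟨h1, h2, h3⟩

/-- BALANCE, fourth loop: the arrays are made to describe the Round-Robin edges. -/
theorem balance_store_run (hN : 0 < N) (hB : Base N G (rrSet N (m .degG) n) X m o)
    (hadj : ∀ v < n, ∀ x < N, m .adjVL (v * N + x) = 0)
    (hg : ∀ v < n, m .degG v + 3 ≤ N)
    (hoff : ∀ v < n, m .offset v = rrStart N (m .degG) v) :
    Run A (loop n fun v => do
        let s ← read .offset v
        let g ← read .degG v
        write .degVL v (g + 3)
        loop (g + 3) fun i => do
          let x := (s + i) % N
          write .nbrVL (v * N + i) x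
          write .adjVL (v * N + x) 1) m o
      (1 + ∑ v ∈ Finset.range n, ((3 * (m .degG v + 3) + 4) + 1))
      fun _ m' o' => Base N G (rrSet N (m .degG) n) X m' o' ∧
        Same [.degVL, .nbrVL, .adjVL] m m' ∧ VLArrays n N (rrSet N (m .degG) n) m' ∧
        ∀ v < n, m' .degVL v = m .degG v + 3 := by
  set g := m .degG with hgdef
  set R := rrSet N g n with hR
  set T := tab (rrNbr N g) (fun v => g v + 3) with hT
  have hRT : R = T n 0 := rfl
  let I : ℕ → ℕ → Mem → Out → Prop := fun v i m' o' =>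
    Base N G R X m' o' ∧ Same [.degVL, .nbrVL, .adjVL] m m' ∧
      (∀ w < n, ∀ x < N, m' .adjVL (w * N + x) = if (w, x) ∈ T v i then 1 else 0) ∧
      (∀ w < v, m' .degVL w = g w + 3) ∧
      (∀ w < v, ∀ j < g w + 3, m' .nbrVL (w * N + j) = rrNbr N g w j) ∧
      ∀ j < i, m' .nbrVL (v * N + j) = rrNbr N g v j
  refine (Run.loop (fun v => I v 0) (fun v => 3 * (g v + 3) + 4) ?_ ?_).mono le_rfl ?_
  · refine ⟨hB, Same.rfl, ?_, by simp, by simp, by simp⟩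
    intro w hw x hx
    simp [hadj w hw x hx, hT]
  · rintro v hv m₁ o₁ ⟨h1, h2, h3, h4, h5, h6⟩
    have hgv := hg v hv
    refine Run.read (Run.read (Run.write ?_))
    rw [h2 .offset (by simp), h2 .degG (by simp), hoff v hv, ← hgdef]
    refine (Run.loop_const (c := 2) (fun i m' o' => I v i m' o' ∧ m' .degVL v = g v + 3)
      ⟨⟨h1.put, h2.put (by simp), ?_, ?_, ?_, ?_⟩, ?_⟩ ?_).mono le_rfl ?_
    · simpa [put_ne] using h3
    · intro w hw
      rw [put_same, Function.update_of_ne (by omega)]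
      exact h4 w hw
    · simpa [put_ne] using h5
    · simp
    · simp
    · rintro i hi m₂ o₂ ⟨⟨g1, g2, g3, g4, g5, g6⟩, g7⟩
      change Run A (write .nbrVL (v * N + i) (rrNbr N g v i) >>= fun _ =>
        write .adjVL (v * N + rrNbr N g v i) 1) _ _ _ _
      have hx : rrNbr N g v i < N := Nat.mod_lt _ hN
      refine Run.write (c := 1) (Run.write_last (c := 0)
        ⟨⟨g1.put.put, (g2.put (by simp)).put (by simp), ?_, ?_, ?_, ?_⟩, ?_⟩)
      · intro w hw x hxN
        have hTs : T v (i + 1) = insert (v, rrNbr N g v i) (T v i) := tab_succ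
        rw [put_same, update_cell _ _ hx hxN, hTs, put_ne _ _ _ (by decide), g3 w hw x hxN]
        by_cases e : w = v ∧ x = rrNbr N g v i
        · simp [e]
        · rw [if_neg e]
          simp only [Finset.mem_insert, Prod.mk.injEq, e, false_or]
      · simpa [put_ne] using g4
      · intro w hw j hj
        have := hg w (by omega)
        rw [put_ne _ _ _ (by decide), put_same, update_cell _ _ (by omega) (by omega),
          if_neg (by omega), g5 w hw j hj]
      · intro j hj
        rw [put_ne _ _ _ (by decide), put_same, update_cell _ _ (by omega) (by omega)]
        split_ifs with e
        · rw [e.2]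
        · exact g6 j (by omega)
      · simpa [put_ne] using g7
    · rintro _ m' o' ⟨⟨g1, g2, g3, g4, g5, g6⟩, g7⟩
      have hTl : T v (g v + 3) = T (v + 1) 0 := tab_len (len := fun v => g v + 3)
      rw [hTl] at g3
      refine ⟨g1, g2, g3, ?_, ?_, by simp⟩
      · intro w hw
        rcases Nat.lt_succ_iff_lt_or_eq.1 hw with h | rfl
        · exact g4 w h
        · exact g7
      · intro w hw
        rcases Nat.lt_succ_iff_lt_or_eq.1 hw with h | rfl
        · exact g5 w h
        · exact g6
  · rintro _ m' o' ⟨h1, h2, h3, h4, h5, h6⟩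
    refine ⟨h1, h2, ⟨?_, ?_, ?_⟩, h4⟩
    · refine tab_congr (fun w hw => (h4 w hw).symm) fun w hw j hj => (h5 w hw j hj).symm
    · intro v hv i hi j hj e
      have := hg v hv
      rw [h4 v hv] at hi hj
      rw [h5 v hv i hi, h5 v hv j hj] at e
      exact rrNbr_inj (by omega) (by omega) e
    · exact h3

/-- BALANCE replaces the edges between `V` and `L` by the Round-Robin edges, in time linear in the
number of vertices and of old and new edges. -/
theorem balance_run (hn : n ≤ N) (hN : 0 < N) (hB : Base N G B X m o) (hV : VLArrays n N B m)
    (hg : ∀ v < n, m .degG v + 3 ≤ N) :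
    Run A (balance n N) m o
      (25 * (1 + n + (∑ v ∈ Finset.range n, (m .degG v + 3)) + ∑ v ∈ Finset.range n, m .degVL v))
      fun _ m' o' => Base N G (rrSet N (m .degG) n) X m' o' ∧
        VLArrays n N (rrSet N (m .degG) n) m' ∧ (∀ v < n, m' .degVL v = m .degG v + 3) ∧
        Same balanceArrs m m' := by
  unfold balance
  refine Run.mono (Run.write (Run.bind offsets_run ?_ (Q' := fun _ m' o' =>
    Base N G (rrSet N (m .degG) n) X m' o' ∧
        VLArrays n N (rrSet N (m .degG) n) m' ∧ (∀ v < n, m' .degVL v = m .degG v + 3) ∧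
        Same balanceArrs m m')
    (c₂ := (1 + ∑ v ∈ Finset.range n, ((13 * (m .degG v + 3) + 3) + 1)) +
      ((1 + ∑ v ∈ Finset.range n, ((14 * m .degVL v + 4) + 1)) +
      (1 + ∑ v ∈ Finset.range n, ((3 * (m .degG v + 3) + 4) + 1)))))) ?_ fun _ _ _ h => h
  · rintro _ m₁ o₁ ⟨rfl, a1, a2⟩
    have eG : m₁ .degG = m .degG := a1 .degG (by simp)
    have eV : m₁ .degVL = m .degVL := a1 .degVL (by simp)
    rw [← eG] at a2 hg ⊢
    rw [← eV]
    have hB1 : Base N G B X m₁ o₁ :=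
      hB.congr (a1 _ (by simp)) (a1 _ (by simp)) (a1 _ (by simp)) (a1 _ (by simp))
    have hV1 : VLArrays n N B m₁ := hV.congr eV (a1 _ (by simp)) (a1 _ (by simp))
    refine Run.bind (balance_insert_run hn hN hB1 hV1.adj hg fun v hv => a2 v hv.le) ?_
    rintro _ m₂ o₂ ⟨b1, b2⟩
    have eG2 : m₂ .degG = m₁ .degG := b2 .degG (by simp)
    have eV2 : m₂ .degVL = m₁ .degVL := b2 .degVL (by simp)
    have eO2 : m₂ .offset = m₁ .offset := b2 .offset (by simp)
    rw [← eG2] at a2 hg b1 ⊢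
    rw [← eO2] at a2
    rw [← eV2]
    have hV2 : VLArrays n N B m₂ := hV1.congr eV2 (b2 _ (by simp)) (b2 _ (by simp))
    refine Run.bind (balance_remove_run hn hV2 hB.B_sub b1 hg fun v hv => a2 v hv.le) ?_
    rintro _ m₃ o₃ ⟨c1, c2, c3⟩
    have eG3 : m₃ .degG = m₂ .degG := c2 .degG (by simp)
    have eO3 : m₃ .offset = m₂ .offset := c2 .offset (by simp)
    rw [← eG3] at a2 hg c1 ⊢
    rw [← eO3] at a2
    refine (balance_store_run hN c1 c3 hg fun v hv => a2 v hv.le).mono le_rfl ?_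
    rintro _ m₄ o₄ ⟨d1, d2, d3, d4⟩
    refine ⟨d1, d3, d4, ?_⟩
    exact (((a1.mono (by simp)).trans (b2.mono (by simp))).trans (c2.mono (by simp))).trans
      (d2.mono (by simp))
  · simp only [Finset.sum_add_distrib, ← Finset.mul_sum, Finset.sum_const, Finset.card_range,
      smul_eq_mul]
    omega

end balance

/-! ### RECOMPUTE -/

/-- The edges of the expander of degree `d`. -/
def expSet (P : ExpanderProcedure) (N d : ℕ) : Finset (ℕ × ℕ) := tab (P.nbr N d) (fun _ => d) N 0

/-- The arrays `degX`, `nbrX`, `adjX` describe the set `X` of edges between `L` and `R`. -/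
structure XArrays (N : ℕ) (X : Finset (ℕ × ℕ)) (m : Mem) : Prop where
  eq_tab : X = tab (fun x i => m .nbrX (x * N + i)) (fun _ => m .degX 0) N 0
  inj : ∀ x < N, ∀ i < m .degX 0, ∀ j < m .degX 0,
    m .nbrX (x * N + i) = m .nbrX (x * N + j) → i = j
  adj : ∀ x < N, ∀ y < N, m .adjX (x * N + y) = if (x, y) ∈ X then 1 else 0

theorem XArrays.congr {N : ℕ} {X : Finset (ℕ × ℕ)} {m m' : Mem} (h : XArrays N X m)
    (h1 : m' .degX = m .degX) (h2 : m' .nbrX = m .nbrX) (h3 : m' .adjX = m .adjX) :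
    XArrays N X m' :=
  ⟨by rw [h1, h2]; exact h.eq_tab, by rw [h1, h2]; exact h.inj, by rw [h3]; exact h.adj⟩

section recompute

variable {A n N d d' : ℕ} {G : SimpleGraph (Fin n)} {B X : Finset (ℕ × ℕ)} {m : Mem} {o : Out}
  {P : ExpanderProcedure}

/-- RECOMPUTE, first loop: the new expander is inserted, and its edges get the mark `2` in `adjX`,
so that the edges with mark `1` are those of the old expander that have to be removed. -/
theorem expander_insert_run (hn : n ≤ N) (hB : Base N G B X m o)
    (hadj : ∀ x < N, ∀ y < N, m .adjX (x * N + y) = if (x, y) ∈ X then 1 else 0)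
    (hnew : ∀ x < N, ∀ i < d', m .newX (x * N + i) = P.nbr N d' x i)
    (hlt : ∀ x < N, ∀ i < d', P.nbr N d' x i < N)
    (hinj : ∀ x < N, ∀ i < d', ∀ j < d', P.nbr N d' x i = P.nbr N d' x j → i = j) :
    Run A (loop N fun x => loop d' fun i => do
        let y ← read .newX (x * N + i)
        let b ← read .adjX (x * N + y)
        if b = 0 then
          emit (ins (left x) (right y))
          bump x
        write .adjX (x * N + y) 2) m o ((15 * d' + 2) * N + 1)
      fun _ m' o' => Base N G B (X ∪ expSet P N d') m' o' ∧ Same (.adjX :: orderArrs) m m' ∧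
        ∀ x < N, ∀ y < N, m' .adjX (x * N + y) =
          if (x, y) ∈ expSet P N d' then 2 else if (x, y) ∈ X then 1 else 0 := by
  set f := P.nbr N d' with hf
  set T := tab f (fun _ => d') with hT
  let I : ℕ → ℕ → Mem → Out → Prop := fun v i m' o' =>
    Base N G B (X ∪ T v i) m' o' ∧ Same (.adjX :: orderArrs) m m' ∧
      ∀ x < N, ∀ y < N, m' .adjX (x * N + y) =
        if (x, y) ∈ T v i then 2 else if (x, y) ∈ X then 1 else 0
  refine Run.loop_const (fun v => I v 0) _ ?_ ?_
  · simpa [I, hT] using ⟨hB, Same.rfl, hadj⟩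
  rintro v hv m₁ o₁ h1
  refine (Run.loop_const (c := 14) (I v) h1 ?_).mono le_rfl ?_
  · rintro i hi m₂ o₂ ⟨h2, h3, h4⟩
    refine Run.read (c := 13) ?_
    rw [h3 .newX (by simp), hnew v hv i hi]
    have hy : f v i < N := hlt v hv i hi
    refine Run.read (c := 12) ?_
    rw [h4 v hv _ hy]
    have hTn : (v, f v i) ∉ T v i := notMem_tab_of_inj fun j hj e => by
      have := hinj v hv j (by omega) i hi e
      omega
    have hTs : T v (i + 1) = insert (v, f v i) (T v i) := tab_succ
    rw [if_neg hTn]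
    have hfin : ∀ m' : Mem, m' .adjX = m₂ .adjX → ∀ x < N, ∀ y < N,
        put m' .adjX (v * N + f v i) 2 .adjX (x * N + y) =
          if (x, y) ∈ T v (i + 1) then 2 else if (x, y) ∈ X then 1 else 0 := by
      intro m' e x hx y hyN
      rw [put_same, update_cell _ _ hy hyN, hTs, e, h4 x hx y hyN]
      by_cases e : x = v ∧ y = f v i
      · simp [e]
      · rw [if_neg e]
        simp only [Finset.mem_insert, Prod.mk.injEq, e, false_or]
    by_cases hX : (v, f v i) ∈ X
    · simp only [if_pos hX, one_ne_zero, if_false]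
      refine Run.write_last (c := 11) ⟨?_, h3.put (by simp), hfin _ rfl⟩
      rw [hTs, Finset.union_insert, Finset.insert_eq_of_mem (Finset.mem_union_left _ hX)]
      exact h2.put
    · simp only [if_neg hX, if_true, ← bind_assoc]
      refine Run.bind (c₁ := 11) (c₂ := 1) (h2.run_ins_LR hn hv hy (by simp [hX, hTn])) ?_
      rintro _ m' o' ⟨h5, h6⟩
      refine Run.write_last (c := 0) ⟨?_, (h3.trans (h6.mono (by simp))).put (by simp),
        hfin _ (h6 .adjX (by simp))⟩
      rw [hTs, Finset.union_insert]
      exact h5.put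
  · intro _ m' o' h
    have : T v d' = T (v + 1) 0 := tab_len (len := fun _ => d')
    simpa only [I, this] using h

/-- RECOMPUTE, second loop. -/
theorem expander_remove_run {X' : Finset (ℕ × ℕ)} (hn : n ≤ N)
    (hXsub : X ⊆ Finset.range N ×ˢ Finset.range N)
    (hB : Base N G B (X ∪ X') m o)
    (hX : X = tab (fun x i => m .nbrX (x * N + i)) (fun _ => d) N 0)
    (hinj : ∀ x < N, ∀ i < d, ∀ j < d, m .nbrX (x * N + i) = m .nbrX (x * N + j) → i = j)
    (hadj : ∀ x < N, ∀ y < N, m .adjX (x * N + y) =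
      if (x, y) ∈ X' then 2 else if (x, y) ∈ X then 1 else 0) :
    Run A (loop N fun x => loop d fun i => do
        let y ← read .nbrX (x * N + i)
        let b ← read .adjX (x * N + y)
        if b = 1 then
          emit (del (left x) (right y))
          drop x
          write .adjX (x * N + y) 0) m o ((15 * d + 2) * N + 1)
      fun _ m' o' => Base N G B X' m' o' ∧ Same (.adjX :: orderArrs) m m' ∧
        ∀ x < N, ∀ y < N, m' .adjX (x * N + y) = if (x, y) ∈ X' then 2 else 0 := by
  set f : ℕ → ℕ → ℕ := fun x i => m .nbrX (x * N + i) with hf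
  set T := tab f (fun _ => d) with hT
  let I : ℕ → ℕ → Mem → Out → Prop := fun v i m' o' =>
    Base N G B (X \ T v i ∪ X') m' o' ∧ Same (.adjX :: orderArrs) m m' ∧
      ∀ x < N, ∀ y < N, m' .adjX (x * N + y) =
        if (x, y) ∈ X' then 2 else if (x, y) ∈ X \ T v i then 1 else 0
  refine (Run.loop_const (fun v => I v 0) (15 * d + 1) ?_ ?_).mono le_rfl ?_
  · simpa [I, hT] using ⟨hB, Same.rfl, hadj⟩
  · rintro v hv m₁ o₁ h1
    refine (Run.loop_const (c := 14) (I v) h1 ?_).mono le_rfl ?_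
    · rintro i hi m₂ o₂ ⟨h2, h3, h4⟩
      refine Run.read (c := 13) ?_
      rw [h3 .nbrX (by simp)]
      change Run A (read .adjX (v * N + f v i) >>= fun b => if b = 1 then
        (do emit (del (left v) (right (f v i))); drop v; write .adjX (v * N + f v i) 0)
        else pure ()) _ _ _ _
      have hmX : (v, f v i) ∈ X := by
        rw [hX, hT, mem_tab_zero]; exact ⟨hv, i, hi, rfl⟩
      have hy : f v i < N := by
        have := hXsub hmX
        simp at this
        exact this.2
      have hTn : (v, f v i) ∉ T v i := notMem_tab_of_inj fun j hj e => by
        have := hinj v hv j (by omega) i hi e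
        omega
      have hTs : T v (i + 1) = insert (v, f v i) (T v i) := tab_succ
      refine Run.read (c := 12) ?_
      rw [h4 v hv _ hy]
      by_cases hX' : (v, f v i) ∈ X'
      · simp only [if_pos hX', OfNat.ofNat_ne_one, if_false]
        refine Run.pure ⟨?_, h3, ?_⟩
        · convert h2 using 1
          rw [hTs]
          ext p
          simp only [Finset.mem_union, Finset.mem_sdiff, Finset.mem_insert]
          by_cases hp : p = (v, f v i)
          · subst hp; simp [hX']
          · simp [hp]
        · intro x hx y hyN
          rw [h4 x hx y hyN, hTs]
          by_cases e : x = v ∧ y = f v i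
          · simp [e, hX']
          · simp only [Finset.mem_sdiff, Finset.mem_insert, Prod.mk.injEq, e, false_or]
      · have hm : (v, f v i) ∈ X \ T v i := by simp [hmX, hTn]
        simp only [if_neg hX', if_pos hm, if_true]
        rw [← bind_assoc]
        refine Run.bind (c₁ := 11) (c₂ := 1) (h2.run_del_LR hn (Finset.mem_union_left _ hm)) ?_
        rintro _ m' o' ⟨h5, h6⟩
        refine Run.write_last (c := 0) ⟨?_, (h3.trans (h6.mono (by simp))).put (by simp), ?_⟩
        · convert h5.put (a := .adjX) (i := v * N + f v i) (w := 0) using 1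
          rw [hTs]
          ext p
          simp only [Finset.mem_union, Finset.mem_sdiff, Finset.mem_insert, Finset.mem_erase]
          by_cases hp : p = (v, f v i)
          · subst hp; simp [hX']
          · simp [hp]
        · intro x hx y hyN
          rw [put_same, update_cell _ _ hy hyN, h6 .adjX (by simp), h4 x hx y hyN, hTs]
          by_cases e : x = v ∧ y = f v i
          · simp [e, hX']
          · rw [if_neg e]
            simp only [Finset.mem_sdiff, Finset.mem_insert, Prod.mk.injEq, e, false_or]
    · intro _ m' o' h
      have : T v d = T (v + 1) 0 := tab_len (len := fun _ => d)
      simpa only [I, this] using h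
  · rintro _ m' o' ⟨h1, h2, h3⟩
    simp only [← hX, Finset.sdiff_self, Finset.empty_union, Finset.notMem_empty, if_false] at h1 h3
    exact ⟨h1, h2, h3⟩

/-- RECOMPUTE, third loop. -/
theorem expander_store_run (hd' : d' ≤ N) (hB : Base N G B X m o)
    (hadj : ∀ x < N, ∀ y < N, m .adjX (x * N + y) = if (x, y) ∈ expSet P N d' then 2 else 0)
    (hnew : ∀ x < N, ∀ i < d', m .newX (x * N + i) = P.nbr N d' x i)
    (hlt : ∀ x < N, ∀ i < d', P.nbr N d' x i < N) :
    Run A (loop N fun x => loop d' fun i => do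
        let y ← read .newX (x * N + i)
        write .nbrX (x * N + i) y
        write .adjX (x * N + y) 1) m o ((4 * d' + 2) * N + 1)
      fun _ m' o' => Base N G B X m' o' ∧ Same [.nbrX, .adjX] m m' ∧
        (∀ x < N, ∀ y < N, m' .adjX (x * N + y) = if (x, y) ∈ expSet P N d' then 1 else 0) ∧
        ∀ x < N, ∀ i < d', m' .nbrX (x * N + i) = P.nbr N d' x i := by
  set f := P.nbr N d' with hf
  set T := tab f (fun _ => d') with hT
  set X' := expSet P N d' with hX'
  have hXT : X' = T N 0 := rfl
  let I : ℕ → ℕ → Mem → Out → Prop := fun v i m' o' =>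
    Base N G B X m' o' ∧ Same [.nbrX, .adjX] m m' ∧
      (∀ x < N, ∀ y < N, m' .adjX (x * N + y) =
        if (x, y) ∈ T v i then 1 else if (x, y) ∈ X' then 2 else 0) ∧
      (∀ x < v, ∀ j < d', m' .nbrX (x * N + j) = f x j) ∧
      ∀ j < i, m' .nbrX (v * N + j) = f v j
  refine (Run.loop_const (fun v => I v 0) (4 * d' + 1) ?_ ?_).mono le_rfl ?_
  · refine ⟨hB, Same.rfl, ?_, by simp, by simp⟩
    simpa [hT] using hadj
  · rintro v hv m₁ o₁ h1
    refine (Run.loop_const (c := 3) (I v) h1 ?_).mono le_rfl ?_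
    · rintro i hi m₂ o₂ ⟨h2, h3, h4, h5, h6⟩
      refine Run.read (c := 2) ?_
      rw [h3 .newX (by simp), hnew v hv i hi]
      have hy : f v i < N := hlt v hv i hi
      have hTs : T v (i + 1) = insert (v, f v i) (T v i) := tab_succ
      refine Run.write (c := 1) (Run.write_last (c := 0)
        ⟨h2.put.put, (h3.put (by simp)).put (by simp), ?_, ?_, ?_⟩)
      · intro x hx y hyN
        rw [put_same, update_cell _ _ hy hyN, hTs, put_ne _ _ _ (by decide), h4 x hx y hyN]
        by_cases e : x = v ∧ y = f v i
        · simp [e]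
        · rw [if_neg e]
          simp only [Finset.mem_insert, Prod.mk.injEq, e, false_or]
      · intro x hx j hj
        rw [put_ne _ _ _ (by decide), put_same, update_cell _ _ (by omega) (by omega),
          if_neg (by omega), h5 x hx j hj]
      · intro j hj
        rw [put_ne _ _ _ (by decide), put_same, update_cell _ _ (by omega) (by omega)]
        split_ifs with e
        · rw [e.2]
        · exact h6 j (by omega)
    · rintro _ m' o' ⟨h2, h3, h4, h5, h6⟩
      have hTl : T v d' = T (v + 1) 0 := tab_len (len := fun _ => d')
      rw [hTl] at h4
      refine ⟨h2, h3, h4, ?_, by simp⟩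
      intro w hw
      rcases Nat.lt_succ_iff_lt_or_eq.1 hw with h | rfl
      · exact h5 w h
      · exact h6
  · rintro _ m' o' ⟨h1, h2, h3, h4, -⟩
    refine ⟨h1, h2, ?_, h4⟩
    intro x hx y hy
    rw [h3 x hx y hy, ← hXT]
    split_ifs <;> rfl

/-- RECOMPUTE replaces the expander by the one of degree `d'` and the edges between `V` and `L` by
the Round-Robin edges, in time linear in the numbers of vertices and of old and new edges; so is
the time spent in the expander procedure if it takes time `A` per edge. -/
theorem recompute_run {first : Bool} (hn : n ≤ N) (hN : 0 < N) (hB : Base N G B X m o)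
    (hV : VLArrays n N B m) (hX : XArrays N X m) (hg : ∀ v < n, m .degG v + 3 ≤ N)
    (hd : d' = expanderDegree n N (m .edges 0)) (hd' : d' ≤ N)
    (hlt : ∀ x < N, ∀ i < d', P.nbr N d' x i < N)
    (hinj : ∀ x < N, ∀ i < d', ∀ j < d', P.nbr N d' x i = P.nbr N d' x j → i = j)
    (hA : (if first then P.firstTime N d' else P.time N d') ≤ A * (N * d')) :
    Run A (recompute P first n N) m o
      (35 * (1 + n + N + N * m .degX 0 + N * d' + (∑ v ∈ Finset.range n, (m .degG v + 3)) +
        ∑ v ∈ Finset.range n, m .degVL v))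
      fun _ m' o' => Base N G (rrSet N (m .degG) n) (expSet P N d') m' o' ∧
        VLArrays n N (rrSet N (m .degG) n) m' ∧ (∀ v < n, m' .degVL v = m .degG v + 3) ∧
        XArrays N (expSet P N d') m' ∧ m' .degX 0 = d' ∧ m' .edgesLast 0 = m .edges 0 ∧
        m' .edges = m .edges ∧ m' .degG = m .degG := by
  unfold recompute
  refine Run.mono (c := (((15 * d' + 2) * N + 1) + (((15 * m .degX 0 + 2) * N + 1) +
    (((4 * d' + 2) * N + 1) + (25 * (1 + n + (∑ v ∈ Finset.range n, (m .degG v + 3)) +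
      ∑ v ∈ Finset.range n, m .degVL v) + 1 + 1))) + N * d') + 1 + 1) ?_ ?_ fun _ _ _ h => h
  · refine Run.read (Run.read ?_)
    dsimp only
    rw [← hd]
    refine Run.construct hA ?_
    set m₁ : Mem := Function.update m Arr.newX fun j => P.nbr N d' (j / N) (j % N) with hm₁
    have hs : Same [.newX] m m₁ := by
      intro a ha
      simp only [List.mem_singleton] at ha
      rw [hm₁, Function.update_of_ne ha]
    have hnew : ∀ x < N, ∀ i < d', m₁ .newX (x * N + i) = P.nbr N d' x i := by
      intro x hx i hi
      rw [hm₁, Function.update_self, Nat.mul_comm x, Nat.mul_add_div hN, Nat.mul_add_mod,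
        Nat.div_eq_of_lt (by omega), Nat.mod_eq_of_lt (by omega), add_zero]
    have hB1 : Base N G B X m₁ o :=
      hB.congr (hs _ (by simp)) (hs _ (by simp)) (hs _ (by simp)) (hs _ (by simp))
    have hX1 : XArrays N X m₁ := hX.congr (hs _ (by simp)) (hs _ (by simp)) (hs _ (by simp))
    refine Run.bind (expander_insert_run hn hB1 hX1.adj hnew hlt hinj) ?_
    rintro _ m₂ o₂ ⟨b1, b2, b3⟩
    have b2' : Same (.newX :: .adjX :: orderArrs) m m₂ :=
      (hs.mono (by simp)).trans (b2.mono (by simp))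
    refine Run.bind (expander_remove_run (X := X) (d := m .degX 0) hn hB.X_sub b1 ?_ ?_ b3) ?_
    · rw [b2' .nbrX (by simp)]; exact hX.eq_tab
    · rw [b2' .nbrX (by simp)]; exact hX.inj
    rintro _ m₃ o₃ ⟨c1, c2, c3⟩
    have c2' : Same (.newX :: .adjX :: orderArrs) m m₃ := b2'.trans (c2.mono (by simp))
    refine Run.bind (expander_store_run (P := P) hd' c1 c3 ?_ hlt) ?_
    · rw [c2 .newX (by simp), b2 .newX (by simp)]
      exact hnew
    rintro _ m₄ o₄ ⟨d1, d2, d3, d4⟩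
    have d2' : Same (.nbrX :: .newX :: .adjX :: orderArrs) m m₄ :=
      (c2'.mono (by simp)).trans (d2.mono (by simp))
    refine Run.write (Run.write ?_)
    set m₅ := put (put m₄ .degX 0 d') .edgesLast 0 (m .edges 0) with hm₅
    have e1 : Same (.degX :: .edgesLast :: .nbrX :: .newX :: .adjX :: orderArrs) m m₅ :=
      ((d2'.mono (by simp)).put (by simp)).put (by simp)
    have eG : m₅ .degG = m .degG := e1 .degG (by simp)
    have eV : m₅ .degVL = m .degVL := e1 .degVL (by simp)
    have hV5 : VLArrays n N B m₅ := hV.congr (e1 _ (by simp)) (e1 _ (by simp)) (e1 _ (by simp))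
    have hb := balance_run (A := A) (m := m₅) hn hN d1.put.put hV5 (by rw [eG]; exact hg)
    rw [eG, eV] at hb
    refine hb.mono le_rfl ?_
    rintro _ m₆ o₆ ⟨f1, f2, f3, f4⟩
    have k1 : m₆ .degX 0 = d' := by rw [f4 .degX (by simp), hm₅]; simp [put_ne]
    have k2 : m₆ .nbrX = m₄ .nbrX := by rw [f4 .nbrX (by simp), hm₅]; simp [put_ne]
    have k3 : m₆ .adjX = m₄ .adjX := by rw [f4 .adjX (by simp), hm₅]; simp [put_ne]
    refine ⟨f1, f2, f3, ⟨?_, ?_, ?_⟩, k1, ?_, ?_, ?_⟩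
    · rw [k1, k2]
      exact tab_congr (fun _ _ => rfl) fun x hx j hj => (d4 x hx j hj).symm
    · rw [k1, k2]
      intro x hx i hi j hj h
      rw [d4 x hx i hi, d4 x hx j hj] at h
      exact hinj x hx i hi j hj h
    · rw [k3]; exact d3
    · rw [f4 .edgesLast (by simp), hm₅]; simp
    · rw [f4 .edges (by simp), e1 .edges (by simp)]
    · rw [f4 .degG (by simp), eG]
  · ring_nf; omega

end recompute

/-! ### UPDATE -/

section update

variable {A n N v : ℕ} {G : SimpleGraph (Fin n)} {B X : Finset (ℕ × ℕ)} {m : Mem} {o : Out}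

/-- The number of neighbours of `v` at the positions `p, …, N - 1` of the order. They are the
vertices that the scan from position `p` on may have to skip. -/
def skipCount (N v : ℕ) (m : Mem) (p : ℕ) : ℕ :=
  ((Finset.Ico p N).filter fun i => m .adjVL (v * N + m .order i) ≠ 0).card

/-- The first `c` entries of the scratch memory list the vertices of the first `p` positions of
the order that are not adjacent to `v`. -/
def Collected (N v p c : ℕ) (m : Mem) : Prop :=
  (∀ i < c, ∀ j < c, m .scratch i = m .scratch j → i = j) ∧
    ∀ x, (∃ j < c, m .scratch j = x) ↔ ∃ i < p, m .order i = x ∧ m .adjVL (v * N + x) = 0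

/-- The scan stops when `need` vertices are collected or all of `L` has been seen. It pays for every
vertex collected or skipped. -/
theorem collect_run {need fuel p c : ℕ} (hp : p + fuel = N) (hc : c ≤ need)
    (ho : ∀ i < N, ∀ j < N, m .order i = m .order j → i = j) (h : Collected N v p c m) :
    Run A (collect N v need fuel p c) m o (4 * ((need - c) + skipCount N v m p) + 2)
      fun _ m' o' => o' = o ∧ Same [.scratch] m m' ∧ ∃ q ≤ N, ∃ c' ≤ need, (c' = need ∨ q = N) ∧
        Collected N v q c' m' := by
  induction fuel generalizing p c m with
  | zero =>
    exact Run.tick_last ⟨rfl, Same.rfl, p, by omega, c, hc, Or.inr (by omega), h⟩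
  | succ fuel ih =>
    unfold collect
    by_cases hlt : c < need
    · have hIco : Finset.Ico p N = insert p (Finset.Ico (p + 1) N) := by
        rw [Finset.insert_Ico_add_one_left_eq_Ico (by omega)]
      have hk : skipCount N v m p = skipCount N v m (p + 1) +
          if m .adjVL (v * N + m .order p) ≠ 0 then 1 else 0 := by
        unfold skipCount
        rw [hIco, Finset.filter_insert]
        split_ifs with e
        · rw [Finset.card_insert_of_notMem (by simp)]
        · rfl
      simp only [if_pos hlt]
      by_cases hb : m .adjVL (v * N + m .order p) = 0
      · set m' := put m .scratch c (m .order p) with hm'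
        have hs : skipCount N v m' (p + 1) = skipCount N v m (p + 1) := by
          simp [skipCount, hm', put_ne]
        have hC : Collected N v (p + 1) (c + 1) m' := by
          have hx : ∀ j < c, m .scratch j ≠ m .order p := fun j hj e => by
            obtain ⟨i, hi, e', -⟩ := (h.2 _).1 ⟨j, hj, rfl⟩
            have := ho i (by omega) p (by omega) (e'.trans e)
            omega
          have hsc : ∀ j, m' .scratch j = if j = c then m .order p else m .scratch j := by
            intro j; rw [hm', put_same, Function.update_apply]
          have hoo : m' .order = m .order := by simp [hm', put_ne]
          have hoa : m' .adjVL = m .adjVL := by simp [hm', put_ne]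
          constructor
          · intro i hi j hj e
            rw [hsc, hsc] at e
            split_ifs at e with e1 e2 e2
            · omega
            · exact absurd e.symm (hx j (by omega))
            · exact absurd e (hx i (by omega))
            · exact h.1 i (by omega) j (by omega) e
          · intro x
            rw [hoo, hoa]
            constructor
            · rintro ⟨j, hj, e⟩
              rw [hsc] at e
              split_ifs at e with e1
              · exact ⟨p, by omega, e, by rw [← e]; exact hb⟩
              · obtain ⟨i, hi, e', h0⟩ := (h.2 x).1 ⟨j, by omega, e⟩
                exact ⟨i, by omega, e', h0⟩
            · rintro ⟨i, hi, e, h0⟩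
              rcases Nat.lt_succ_iff_lt_or_eq.1 hi with hi | rfl
              · obtain ⟨j, hj, e'⟩ := (h.2 x).2 ⟨i, hi, e, h0⟩
                exact ⟨j, by omega, by rw [hsc, if_neg (by omega)]; exact e'⟩
              · exact ⟨c, by omega, by rw [hsc, if_pos rfl]; exact e⟩
        have := ih (m := m') (p := p + 1) (c := c + 1) (by omega) (by omega)
          (by simpa [hm', put_ne] using ho) hC
        rw [hs] at this
        refine Run.mono (Run.tick (Run.read (Run.read ?_ (c :=
          4 * ((need - (c + 1)) + skipCount N v m (p + 1)) + 2 + 1)))) ?_ fun _ _ _ h => h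
        · rw [if_pos hb]
          refine Run.write (this.mono le_rfl ?_)
          rintro _ m'' o'' ⟨g1, g2, g3⟩
          exact ⟨g1, (Same.rfl.put (by simp)).trans g2, g3⟩
        · omega
      · have hC : Collected N v (p + 1) c m := by
          refine ⟨h.1, fun x => (h.2 x).trans ?_⟩
          constructor
          · rintro ⟨i, hi, e⟩; exact ⟨i, by omega, e⟩
          · rintro ⟨i, hi, e, h0⟩
            rcases Nat.lt_succ_iff_lt_or_eq.1 hi with hi | rfl
            · exact ⟨i, hi, e, h0⟩
            · rw [← e] at h0; exact absurd h0 hb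
        refine Run.mono (Run.tick (Run.read (Run.read ?_ (c :=
          4 * ((need - c) + skipCount N v m (p + 1)) + 2)))) ?_ fun _ _ _ h => h
        · rw [if_neg hb]
          exact ih (by omega) hc ho hC
        · rw [hk, if_pos hb]; omega
    · simp only [if_neg hlt]
      exact Run.tick (Run.pure ⟨rfl, Same.rfl, p, by omega, c, hc, Or.inl (by omega), h⟩)

/-- The set `S` of vertices that UPDATE chooses: `k + 3` vertices of minimum degree among those not
adjacent to `v`. -/
structure IsMinChoice (N v k : ℕ) (B : Finset (ℕ × ℕ)) (deg : ℕ → ℕ) (S : Finset ℕ) : Prop where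
  card_eq : S.card = k + 3
  lt : ∀ x ∈ S, x < N
  notMem : ∀ x ∈ S, (v, x) ∉ B
  le : ∀ x ∈ S, ∀ y < N, y ∉ S → (v, y) ∉ B → deg x ≤ deg y

theorem VLArrays.card_neighbours_le (hV : VLArrays n N B m) (hv : v < n) :
    ((Finset.range N).filter fun x => (v, x) ∈ B).card ≤ m .degVL v := by
  rw [← hV.rowDeg_eq hv]
  refine Finset.card_le_card_of_injOn (fun x => (v, x)) ?_ ?_
  · intro x hx
    simp only [Finset.coe_filter, Finset.mem_range, Set.mem_ofPred_eq] at hx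
    simpa using hx.2
  · intro x _ y _ e
    exact (Prod.mk.inj e).2

/-- With `k = deg_L(v)`, the scan skips at most `k` vertices, and it finds `k + 3` vertices because
`2 k + 3 ≤ N`. Those not collected come later in the order, hence have at least the degree of those
collected. -/
theorem collect_choice_run (hB : Base N G B X m o) (hV : VLArrays n N B m) (hv : v < n)
    (hn : n ≤ N) (hk : 2 * m .degVL v + 3 ≤ N) :
    Run A (collect N v (m .degVL v + 3) N 0 0) m o (8 * m .degVL v + 14)
      fun _ m' o' => o' = o ∧ Same [.scratch] m m' ∧
        (∀ i < m .degVL v + 3, ∀ j < m .degVL v + 3, m' .scratch i = m' .scratch j → i = j) ∧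
        IsMinChoice N v (m .degVL v) B (m .degL)
          ((Finset.range (m .degVL v + 3)).image (m' .scratch)) := by
  have hs := hB.sorted
  have ho : ∀ i < N, ∀ j < N, m .order i = m .order j → i = j := fun i hi j hj e => by
    rw [← hs.pos_order i hi, e, hs.pos_order j hj]
  have hcard := hV.card_neighbours_le hv
  have hskip : skipCount N v m 0 ≤ m .degVL v := by
    refine le_trans (Finset.card_le_card_of_injOn (m .order) ?_ ?_) hcard
    · intro i hi
      simp only [Finset.coe_filter, Finset.mem_Ico, zero_le, true_and, Set.mem_ofPred_eq] at hi
      have h1 := hs.order_lt i hi.1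
      rw [hV.adj v hv _ h1] at hi
      simpa [h1] using hi.2
    · intro i hi j hj e
      simp only [Finset.coe_filter, Finset.mem_Ico, zero_le, true_and, Set.mem_ofPred_eq] at hi hj
      exact ho i hi.1 j hj.1 e
  refine (collect_run (by omega) (by omega) ho ⟨by simp, by simp⟩).mono (by omega) ?_
  rintro _ m' o' ⟨rfl, h1, q, hq, c', hc', hor, h2, h3⟩
  rw [h1 .order (by simp), h1 .adjVL (by simp)] at h3
  -- even a scan of all of `L` finds enough vertices
  have hc : c' = m .degVL v + 3 := by
    rcases hor with h | rfl
    · exact h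
    · have : Finset.range q ⊆ ((Finset.range q).filter fun x => (v, x) ∈ B) ∪
          (Finset.range c').image (m' .scratch) := by
        intro x hx
        rw [Finset.mem_range] at hx
        by_cases hxB : (v, x) ∈ B
        · simp [hx, hxB]
        · obtain ⟨j, hj, e⟩ := (h3 x).2 ⟨m .pos x, hs.pos_lt x hx, hs.order_pos x hx, by
            rw [hV.adj v hv x hx, if_neg hxB]⟩
          exact Finset.mem_union_right _ (Finset.mem_image.2 ⟨j, by simpa using hj, e⟩)
      have := Finset.card_le_card this
      have := this.trans (Finset.card_union_le _ _)
      have h5 : ((Finset.range c').image (m' .scratch)).card ≤ c' :=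
        Finset.card_image_le.trans (by simp)
      rw [Finset.card_range] at this
      omega
  subst hc
  have hmem : ∀ x, x ∈ (Finset.range (m .degVL v + 3)).image (m' .scratch) ↔
      ∃ i < q, m .order i = x ∧ m .adjVL (v * N + x) = 0 := by
    intro x
    rw [← h3]
    simp
  refine ⟨rfl, h1, h2, ?_, ?_, ?_, ?_⟩
  · rw [Finset.card_image_of_injOn, Finset.card_range]
    intro i hi j hj e
    simp only [Finset.coe_range, Set.mem_Iio] at hi hj
    exact h2 i hi j hj e
  · intro x hx
    obtain ⟨i, hi, rfl, -⟩ := (hmem x).1 hx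
    exact hs.order_lt i (by omega)
  · intro x hx hxB
    obtain ⟨i, hi, rfl, h0⟩ := (hmem x).1 hx
    rw [hV.adj v hv _ (hs.order_lt i (by omega)), if_pos hxB] at h0
    omega
  · intro x hx y hy hyS hyB
    obtain ⟨i, hi, rfl, h0⟩ := (hmem x).1 hx
    have hp : q ≤ m .pos y := by
      by_contra hlt
      exact hyS ((hmem y).2 ⟨m .pos y, by omega, hs.order_pos y hy, by
        rw [hV.adj v hv y hy, if_neg hyB]⟩)
    have := hs.mono (i := i) (j := m .pos y) (by omega) (hs.pos_lt y hy)
      (by rw [hs.order_pos y hy]; exact hB.deg_le hn hy)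
    rwa [hs.order_pos y hy] at this

/-- The arrays that UPDATE may change. -/
abbrev updateArrs : List Arr :=
  [.degL, .order, .pos, .start, .scratch, .adjVL, .nbrVL, .degVL]

/-- UPDATE joins `v` to a set of vertices of minimum degree, in time linear in its size. -/
theorem update_run (hB : Base N G B X m o) (hV : VLArrays n N B m) (hv : v < n)
    (hn : n ≤ N) (hk : 2 * m .degVL v + 3 ≤ N) :
    Run A (update N v) m o (25 * (m .degVL v + 3)) fun _ m' o' => ∃ S B',
      IsMinChoice N v (m .degVL v) B (m .degL) S ∧
      (∀ x < N, m' .degL x = m .degL x + if x ∈ S then 1 else 0) ∧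
      Base N G B' X m' o' ∧ VLArrays n N B' m' ∧ Same updateArrs m m' ∧
      m' .degVL = Function.update (m .degVL) v (2 * m .degVL v + 3) := by
  set k := m .degVL v with hkdef
  unfold update
  refine Run.mono (Run.read (Run.bind (collect_choice_run hB hV hv hn hk) ?_
    (c₂ := (15 * (k + 3) + 1) + 1)
    (Q' := fun _ m' o' => ∃ S B',
      IsMinChoice N v k B (m .degL) S ∧
      (∀ x < N, m' .degL x = m .degL x + if x ∈ S then 1 else 0) ∧
      Base N G B' X m' o' ∧ VLArrays n N B' m' ∧ Same updateArrs m m' ∧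
      m' .degVL = Function.update (m .degVL) v (2 * k + 3)))) (by omega) fun _ _ _ h => h
  rintro _ m₁ o₁ ⟨rfl, a1, a2, a3⟩
  simp only [← hkdef] at a2 a3 ⊢
  set s := m₁ .scratch with hs
  have hmemS : ∀ j < k + 3, s j ∈ (Finset.range (k + 3)).image s := fun j hj =>
    Finset.mem_image.2 ⟨j, by simpa using hj, rfl⟩
  have hB1 : Base N G B X m₁ o₁ :=
    hB.congr (a1 _ (by simp)) (a1 _ (by simp)) (a1 _ (by simp)) (a1 _ (by simp))
  -- the first `i` new edges
  let T := tabRow (fun _ => s) v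
  have hT : ∀ i w x, (w, x) ∈ T i ↔ w = v ∧ ∃ j < i, s j = x := by
    intro i w x
    simp only [T, tabRow, Finset.mem_image, Finset.mem_range, Prod.mk.injEq]
    constructor
    · rintro ⟨j, hj, rfl, rfl⟩; exact ⟨rfl, j, hj, rfl⟩
    · rintro ⟨rfl, j, hj, rfl⟩; exact ⟨j, hj, rfl, rfl⟩
  let I : ℕ → Mem → Out → Prop := fun i m' o' =>
    Base N G (B ∪ T i) X m' o' ∧ Same (.adjVL :: .nbrVL :: orderArrs) m₁ m' ∧
      (∀ w < n, ∀ x < N, m' .adjVL (w * N + x) = if (w, x) ∈ B ∪ T i then 1 else 0) ∧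
      (∀ w < n, ∀ j < N, m' .nbrVL (w * N + j) =
        if w = v ∧ k ≤ j ∧ j < k + i then s (j - k) else m .nbrVL (w * N + j)) ∧
      ∀ x < N, m' .degL x = m .degL x + if ∃ j < i, s j = x then 1 else 0
  refine Run.bind (Q := fun _ => I (k + 3)) ((Run.loop_const (c := 14) I ?_ ?_).mono le_rfl
    fun _ _ _ h => h) ?_
  · refine ⟨?_, Same.rfl, ?_, ?_, ?_⟩
    · simpa [T, tabRow] using hB1
    · rw [a1 .adjVL (by simp)]
      simpa [T, tabRow] using hV.adj
    · rw [a1 .nbrVL (by simp)]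
      intro w _ j _
      rw [if_neg (by omega)]
    · rw [a1 .degL (by simp)]
      simp
  · rintro i hi m₂ o₂ ⟨h1, h2, h3, h4, h5⟩
    refine Run.read (c := 13) ?_
    rw [h2 .scratch (by simp), ← hs]
    have hx : s i < N := a3.lt _ (hmemS i hi)
    have hxB : (v, s i) ∉ B := a3.notMem _ (hmemS i hi)
    have hxT : (v, s i) ∉ T i := by
      rw [hT]
      rintro ⟨-, j, hj, e⟩
      have := a2 j (by omega) i hi e
      omega
    have hTs : T (i + 1) = insert (v, s i) (T i) := by
      simp [T, tabRow, Finset.range_add_one]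
    have hadj : ∀ m' : Mem, m' .adjVL = m₂ .adjVL → ∀ w < n, ∀ x < N,
        put m' .adjVL (v * N + s i) 1 .adjVL (w * N + x) =
          if (w, x) ∈ B ∪ T (i + 1) then 1 else 0 := by
      intro m' e w hw x hxN
      rw [put_same, update_cell _ _ hx hxN, hTs, e, h3 w hw x hxN]
      by_cases e : w = v ∧ x = s i
      · simp [e]
      · rw [if_neg e]
        simp only [Finset.mem_union, Finset.mem_insert, Prod.mk.injEq, e, false_or]
    rw [← bind_assoc]
    refine Run.bind (c₁ := 11) (c₂ := 2) (h1.run_ins_VL hn hv hx (by simp [hxB, hxT])) ?_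
    rintro _ m₃ o₃ ⟨g1, g2⟩
    refine Run.write (c := 1) (Run.write_last (c := 0) ⟨?_, ?_, ?_, ?_, ?_⟩)
    · rw [hTs, Finset.union_insert]
      exact g1.put.put
    · exact ((h2.trans (g2.mono (by simp))).put (by simp)).put (by simp)
    · rw [put_ne _ _ _ (by decide)]
      exact hadj m₃ (g2 .adjVL (by simp))
    · intro w hw j hj
      rw [put_same, update_cell _ _ (by omega) hj, put_ne _ _ _ (by decide), g2 .nbrVL (by simp),
        h4 w hw j hj]
      by_cases e : w = v ∧ j = k + i
      · rw [if_pos e, if_pos (by omega)]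
        congr 1
        omega
      · rw [if_neg e]
        refine if_congr ?_ rfl rfl
        omega
    · intro x hxN
      rw [put_ne _ _ _ (by decide), put_ne _ _ _ (by decide)]
      have e1 := h1.deg x hxN
      have e2 := g1.deg x hxN
      rw [colDeg_insert (by simp [hxB, hxT])] at e2
      have e3 := h5 x hxN
      by_cases e : x = s i
      · subst e
        have n1 : ¬ ∃ j < i, s j = s i := by
          rintro ⟨j, hj, e⟩
          have := a2 j (by omega) i hi e
          omega
        rw [if_neg n1] at e3
        rw [if_pos ⟨i, by omega, rfl⟩]
        simp at e2
        omega
      · have n1 : (∃ j < i + 1, s j = x) ↔ ∃ j < i, s j = x := by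
          constructor
          · rintro ⟨j, hj, ej⟩
            refine ⟨j, ?_, ej⟩
            rcases Nat.lt_succ_iff_lt_or_eq.1 hj with h | rfl
            · exact h
            · exact absurd ej.symm e
          · rintro ⟨j, hj, ej⟩; exact ⟨j, by omega, ej⟩
        simp only [n1, if_neg e] at e2 ⊢
        omega
  · rintro _ m₂ o₂ ⟨h1, h2, h3, h4, h5⟩
    have hdeg : put m₂ .degVL v (k + (k + 3)) .degVL =
        Function.update (m .degVL) v (2 * k + 3) := by
      rw [put_same, h2 .degVL (by simp), a1 .degVL (by simp), show k + (k + 3) = 2 * k + 3 by omega]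
    have hlen : ∀ w, put m₂ .degVL v (k + (k + 3)) .degVL w =
        if w = v then 2 * k + 3 else m .degVL w := by
      intro w; rw [hdeg, Function.update_apply]
    have hle : ∀ w < n, m .degVL w ≤ N := fun w hw => by
      rw [← hV.rowDeg_eq hw]; exact rowDeg_le hB.B_sub w
    refine Run.write_last (c := 0) ⟨_, B ∪ T (k + 3), a3, ?_, h1.put, ⟨?_, ?_, ?_⟩,
      ((a1.mono (by simp)).trans (h2.mono (by simp))).put (by simp), hdeg⟩
    · intro x hx
      rw [put_ne _ _ _ (by decide), h5 x hx]
      congr 1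
      refine if_congr ?_ rfl rfl
      simp
    · ext ⟨w, x⟩
      rw [Finset.mem_union, hT, mem_tab_zero]
      simp only [hlen, put_ne m₂ (a := .degVL) (b := .nbrVL) v (k + (k + 3)) (by decide)]
      nth_rw 1 [hV.eq_tab]
      rw [mem_tab_zero]
      constructor
      · rintro (⟨hw, j, hj, rfl⟩ | ⟨rfl, j, hj, rfl⟩)
        · have := hle w hw
          refine ⟨hw, j, ?_, ?_⟩
          · split_ifs with e
            · subst e; omega
            · exact hj
          · rw [h4 w hw j (by omega), if_neg]
            rintro ⟨rfl, h, -⟩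
            omega
        · refine ⟨hv, k + j, ?_, ?_⟩
          · rw [if_pos rfl]; omega
          · rw [h4 w hv _ (by omega), if_pos (by omega)]
            congr 1
            omega
      · rintro ⟨hw, j, hj, e⟩
        have := hle w hw
        split_ifs at hj with ew
        · subst ew
          rw [h4 w hw j (by omega)] at e
          split_ifs at e with h
          · exact Or.inr ⟨rfl, j - k, by omega, e⟩
          · exact Or.inl ⟨hw, j, by omega, e⟩
        · rw [h4 w hw j (by omega), if_neg (by tauto)] at e
          exact Or.inl ⟨hw, j, hj, e⟩
    · intro w hw i hi j hj e
      simp only [hlen, put_ne m₂ (a := .degVL) (b := .nbrVL) v (k + (k + 3)) (by decide)]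
        at hi hj e
      have := hle w hw
      by_cases ew : w = v
      · subst ew
        rw [if_pos rfl] at hi hj
        rw [h4 w hw i (by omega), h4 w hw j (by omega)] at e
        -- the new neighbours differ from the old ones
        have old : ∀ p < k, ∀ q < k + 3, m .nbrVL (w * N + p) ≠ s q := fun p hp q hq he =>
          a3.notMem _ (hmemS q hq) (by rw [← he]; exact hV.nbr_mem hw hp)
        split_ifs at e with c1 c2 c2
        · have := a2 _ (by omega) _ (by omega) e
          omega
        · exact absurd e.symm (old _ (by omega) _ (by omega))
        · exact absurd e (old _ (by omega) _ (by omega))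
        · exact hV.inj w hw i (by omega) j (by omega) e
      · rw [if_neg ew] at hi hj
        rw [h4 w hw i (by omega), h4 w hw j (by omega), if_neg (by tauto), if_neg (by tauto)] at e
        exact hV.inj w hw i hi j hj e
    · rw [put_ne _ _ _ (by decide)]
      exact h3

end update

/-! ### Degrees and numbers of edges -/

section degrees

variable {n N : ℕ} {G : SimpleGraph (Fin n)} {u v : Fin n}

theorem edgeSet_ins (huv : u ≠ v) : ((ins u v).apply G).edgeSet = insert s(u, v) G.edgeSet := by
  simp only [EdgeUpdate.apply, SimpleGraph.edgeSet_sup, SimpleGraph.edgeSet_edge_of_ne huv]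
  rw [Set.union_comm, Set.singleton_union]

theorem ncard_edgeSet_ins (h : (ins u v).Legal G) :
    ((ins u v).apply G).edgeSet.ncard = G.edgeSet.ncard + 1 := by
  have h2 : s(u, v) ∉ G.edgeSet := h.2
  rw [edgeSet_ins h.1, Set.ncard_insert_of_notMem h2 (Set.toFinite _)]

theorem ncard_neighborSet_ins (h : (ins u v).Legal G) (w : Fin n) :
    (((ins u v).apply G).neighborSet w).ncard =
      (G.neighborSet w).ncard + if w = u ∨ w = v then 1 else 0 := by
  obtain ⟨huv, hG⟩ := h
  by_cases hu : w = u
  · subst hu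
    have : ((ins w v).apply G).neighborSet w = insert v (G.neighborSet w) := by
      ext x
      simp only [EdgeUpdate.apply, SimpleGraph.mem_neighborSet, SimpleGraph.sup_adj,
        SimpleGraph.edge_adj, Set.mem_insert_iff]
      grind
    have hv : v ∉ G.neighborSet w := hG
    rw [this, Set.ncard_insert_of_notMem hv (Set.toFinite _), if_pos (Or.inl rfl)]
  by_cases hv : w = v
  · subst hv
    have : ((ins u w).apply G).neighborSet w = insert u (G.neighborSet w) := by
      ext x
      simp only [EdgeUpdate.apply, SimpleGraph.mem_neighborSet, SimpleGraph.sup_adj,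
        SimpleGraph.edge_adj, Set.mem_insert_iff]
      grind
    have hu : u ∉ G.neighborSet w := fun h => hG h.symm
    rw [this, Set.ncard_insert_of_notMem hu (Set.toFinite _), if_pos (Or.inr rfl)]
  · have : ((ins u v).apply G).neighborSet w = G.neighborSet w := by
      ext x
      simp only [EdgeUpdate.apply, SimpleGraph.mem_neighborSet, SimpleGraph.sup_adj,
        SimpleGraph.edge_adj]
      grind
    rw [this, if_neg (by tauto), add_zero]

/-- A deletion is the inverse of an insertion. -/
theorem legal_ins_del (h : (del u v).Legal G) : (ins u v).Legal ((del u v).apply G) :=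
  ⟨SimpleGraph.Adj.ne h, by simp [EdgeUpdate.apply]⟩

theorem ins_del (h : (del u v).Legal G) : (ins u v).apply ((del u v).apply G) = G := by
  have h' : G.Adj u v := h
  ext x y
  simp only [EdgeUpdate.apply, SimpleGraph.sup_adj, SimpleGraph.edge_adj,
    SimpleGraph.deleteEdges_adj, Set.mem_singleton_iff, Sym2.eq_iff]
  have := h'.symm
  have := h'.ne
  grind

theorem ncard_edgeSet_del (h : (del u v).Legal G) :
    ((del u v).apply G).edgeSet.ncard + 1 = G.edgeSet.ncard := by
  rw [← ncard_edgeSet_ins (legal_ins_del h), ins_del h]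

theorem ncard_neighborSet_del (h : (del u v).Legal G) (w : Fin n) :
    (((del u v).apply G).neighborSet w).ncard + (if w = u ∨ w = v then 1 else 0) =
      (G.neighborSet w).ncard := by
  rw [← ncard_neighborSet_ins (legal_ins_del h), ins_del h]

theorem ncard_neighborSet [DecidableRel G.Adj] (w : Fin n) :
    (G.neighborSet w).ncard = G.degree w := by
  rw [← Nat.card_coe_set_eq, Nat.card_eq_fintype_card, SimpleGraph.card_neighborSet_eq_degree]

/-- The arrays `edges` and `degG` hold the number of edges and the degrees of `G`. -/
structure GArrays (G : SimpleGraph (Fin n)) (m : Mem) : Prop where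
  edges : m .edges 0 = G.edgeSet.ncard
  deg : ∀ v : Fin n, m .degG v = (G.neighborSet v).ncard

namespace GArrays

variable {m m' : Mem}

theorem congr (h : GArrays G m) (h1 : m' .edges = m .edges) (h2 : m' .degG = m .degG) :
    GArrays G m' :=
  ⟨by rw [h1]; exact h.edges, by rw [h2]; exact h.deg⟩

theorem sum_deg (h : GArrays G m) : ∑ v ∈ Finset.range n, m .degG v = 2 * m .edges 0 := by
  classical
  rw [h.edges, Finset.sum_range]
  have := G.sum_degrees_eq_twice_card_edges
  rw [← SimpleGraph.coe_edgeFinset, Set.ncard_coe_finset, ← this]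
  refine Finset.sum_congr rfl fun v _ => ?_
  rw [h.deg v, ncard_neighborSet]

theorem deg_lt (h : GArrays G m) {v : ℕ} (hv : v < n) : m .degG v < n := by
  classical
  have := h.deg ⟨v, hv⟩
  rw [ncard_neighborSet] at this
  have h2 := G.degree_lt_card_verts ⟨v, hv⟩
  rw [Fintype.card_fin] at h2
  simp only at this
  omega

theorem two_mul_edges_le (h : GArrays G m) : 2 * m .edges 0 ≤ n * (n - 1) := by
  rw [← h.sum_deg]
  calc ∑ v ∈ Finset.range n, m .degG v ≤ ∑ _v ∈ Finset.range n, (n - 1) := by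
        refine Finset.sum_le_sum fun v hv => ?_
        have := h.deg_lt (Finset.mem_range.1 hv)
        omega
    _ = n * (n - 1) := by simp

theorem ins (h : GArrays G m) (hl : (EdgeUpdate.ins u v).Legal G)
    (h1 : m' .edges 0 = m .edges 0 + 1)
    (h2 : m' .degG = Function.update (Function.update (m .degG) u (m .degG u + 1)) v
      (m .degG v + 1)) :
    GArrays ((EdgeUpdate.ins u v).apply G) m' := by
  refine ⟨by rw [h1, h.edges, ncard_edgeSet_ins hl], fun w => ?_⟩
  rw [h2, ncard_neighborSet_ins hl w, Function.update_apply, Function.update_apply, ← h.deg w]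
  have := hl.1
  by_cases e1 : w = v
  · subst e1; simp
  by_cases e2 : w = u
  · subst e2; simp [Fin.val_inj, e1]
  · simp [Fin.val_inj, e1, e2]

theorem del (h : GArrays G m) (hl : (EdgeUpdate.del u v).Legal G)
    (h1 : m' .edges 0 = m .edges 0 - 1)
    (h2 : m' .degG = Function.update (Function.update (m .degG) u (m .degG u - 1)) v
      (m .degG v - 1)) :
    GArrays ((EdgeUpdate.del u v).apply G) m' := by
  refine ⟨?_, fun w => ?_⟩
  · have := ncard_edgeSet_del hl
    rw [h1, h.edges]; omega
  have h3 := ncard_neighborSet_del hl w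
  rw [← h.deg w] at h3
  rw [h2, Function.update_apply, Function.update_apply]
  have := (SimpleGraph.Adj.ne hl)
  by_cases e1 : w = v
  · subst e1; simp at h3 ⊢; omega
  by_cases e2 : w = u
  · subst e2; simp [Fin.val_inj, e1] at h3 ⊢; omega
  · simp [Fin.val_inj, e1, e2] at h3 ⊢; omega

end GArrays

theorem Base.ins_V {B X : Finset (ℕ × ℕ)} {m : Mem} {o : Out} (h : Base N G B X m o)
    (hl : (ins u v).Legal G) :
    Base N ((ins u v).apply G) B X m (o ++ [ins (orig u) (orig v)]) := by
  refine ⟨h.legal_snoc ⟨?_, ?_⟩, ?_, h.B_sub, h.X_sub, h.deg, h.sorted⟩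
  · simpa [Fin.val_inj] using hl.1
  · rintro ⟨_, _, h'⟩; exact hl.2 h'
  · rw [h.replay_snoc, expGraph_ins_V]

theorem Base.del_V {B X : Finset (ℕ × ℕ)} {m : Mem} {o : Out} (h : Base N G B X m o)
    (hl : (del u v).Legal G) :
    Base N ((del u v).apply G) B X m (o ++ [del (orig u) (orig v)]) := by
  refine ⟨h.legal_snoc ⟨u.2, v.2, hl⟩, ?_, h.B_sub, h.X_sub, h.deg, h.sorted⟩
  rw [h.replay_snoc, expGraph_del_V]

end degrees

theorem sum_colDeg {n N : ℕ} {B : Finset (ℕ × ℕ)} (hB : B ⊆ Finset.range n ×ˢ Finset.range N) :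
    ∑ x ∈ Finset.range N, colDeg B x = B.card :=
  (Finset.card_eq_sum_card_fiberwise fun _ hp =>
    Finset.mem_coe.2 (Finset.mem_product.1 (hB hp)).2).symm

theorem XArrays.rowDeg_eq {N x : ℕ} {X : Finset (ℕ × ℕ)} {m : Mem} (h : XArrays N X m)
    (hx : x < N) : rowDeg X x = m .degX 0 := by
  rw [h.eq_tab]
  exact rowDeg_tab hx (h.inj x hx)

theorem mul_expanderDegree {N : ℕ} (hN : 0 < N) (n m : ℕ) :
    2 * m + 3 * n ≤ N * expanderDegree n N m ∧
      N * expanderDegree n N m ≤ 2 * m + 3 * n + (N - 1) := by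
  unfold expanderDegree
  have h1 := Nat.div_add_mod (2 * m + 3 * n + (N - 1)) N
  have h2 := Nat.mod_lt (2 * m + 3 * n + (N - 1)) hN
  omega

/-- A simple graph has too few edges to demand an expander of degree more than `N`. -/
theorem expanderDegree_le {n N m : ℕ} (hN : n + 2 ≤ N) (hm : 2 * m ≤ n * (n - 1)) :
    expanderDegree n N m ≤ N := by
  by_contra h
  have h1 := (mul_expanderDegree (N := N) (by omega) n m).2
  have h2 : N * (N + 1) ≤ N * expanderDegree n N m := Nat.mul_le_mul_left _ (by omega)
  have h3 : n * (n - 1) + n = n * n := by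
    cases n with
    | zero => rfl
    | succ n => simp; ring
  have h4 : n * n ≤ N * N := Nat.mul_le_mul (by omega) (by omega)
  have h5 : (n + 2) * (n + 2) ≤ N * N := Nat.mul_le_mul hN hN
  ring_nf at *
  omega

theorem three_le_expanderDegree {n N : ℕ} (hN0 : 0 < N) (hN : 2 * N < 3 * n) (m : ℕ) :
    3 ≤ expanderDegree n N m := by
  by_contra h
  have h1 := (mul_expanderDegree hN0 n m).1
  have : N * expanderDegree n N m ≤ N * 2 := Nat.mul_le_mul_left _ (by omega)
  omega

/-! ### Amortized analysis -/

/-- Amortized Hoare triple: a run of `p` with `Φ` credits, where every step consumes one credit,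
leaves `Φ'` credits, and `Q` holds for the result, memory, output and remaining credits. -/
def Am {α : Type} (A : ℕ) (p : Prog α) (m : Mem) (o : Out) (Φ : ℕ)
    (Q : α → Mem → Out → ℕ → Prop) : Prop :=
  ∀ t pt, ∃ c Φ', c + Φ' ≤ Φ ∧
    Q (p ⟨m, o, t, pt⟩).1 (p ⟨m, o, t, pt⟩).2.mem (p ⟨m, o, t, pt⟩).2.out Φ' ∧
    (p ⟨m, o, t, pt⟩).2.time ≤ t + c ∧ (p ⟨m, o, t, pt⟩).2.procTime ≤ pt + A * c ∧
    ∃ es, (p ⟨m, o, t, pt⟩).2.out = o ++ es ∧ es.length ≤ c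

namespace Am

variable {α β : Type} {A : ℕ} {m : Mem} {o : Out} {Φ : ℕ}

theorem of_run {p : Prog α} {c : ℕ} {Q : α → Mem → Out → Prop} {Q' : α → Mem → Out → ℕ → Prop}
    (h : Run A p m o c Q) (hQ : ∀ r m' o', Q r m' o' → ∃ Φ', c + Φ' ≤ Φ ∧ Q' r m' o' Φ') :
    Am A p m o Φ Q' := by
  intro t pt
  obtain ⟨h1, h2⟩ := h t pt
  obtain ⟨Φ', h3, h4⟩ := hQ _ _ _ h1
  exact ⟨c, Φ', h3, h4, h2⟩

theorem mono {p : Prog α} {Φ₁ : ℕ} {Q Q' : α → Mem → Out → ℕ → Prop} (h : Am A p m o Φ₁ Q)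
    (hΦ : Φ₁ ≤ Φ) (hQ : ∀ r m' o' Φ', Q r m' o' Φ' → Q' r m' o' Φ') : Am A p m o Φ Q' := by
  intro t pt
  obtain ⟨c, Φ', h1, h2, h3⟩ := h t pt
  exact ⟨c, Φ', h1.trans hΦ, hQ _ _ _ _ h2, h3⟩

theorem pure {a : α} {Q : α → Mem → Out → ℕ → Prop} (h : Q a m o Φ) :
    Am A (Pure.pure a : Prog α) m o Φ Q :=
  of_run (Run.pure (c := 0) (Q := fun r m' o' => Q r m' o' Φ) h)
    fun _ _ _ h => ⟨Φ, by omega, h⟩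

theorem bind {p : Prog α} {f : α → Prog β} {Q : α → Mem → Out → ℕ → Prop}
    {Q' : β → Mem → Out → ℕ → Prop} (h : Am A p m o Φ Q)
    (hf : ∀ r m' o' Φ', Q r m' o' Φ' → Am A (f r) m' o' Φ' Q') : Am A (p >>= f) m o Φ Q' := by
  intro t pt
  obtain ⟨c, Φ', h0, h1, h2, h3, es, h4, h5⟩ := h t pt
  have e : (p >>= f) ⟨m, o, t, pt⟩ = f (p ⟨m, o, t, pt⟩).1 (p ⟨m, o, t, pt⟩).2 := rfl
  rw [e]
  obtain ⟨c', Φ'', g0, g1, g2, g3, es', g4, g5⟩ := hf _ _ _ _ h1 (p ⟨m, o, t, pt⟩).2.time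
    (p ⟨m, o, t, pt⟩).2.procTime
  refine ⟨c + c', Φ'', by omega, g1, g2.trans (by omega), g3.trans (by rw [mul_add]; omega),
    es ++ es', ?_, ?_⟩
  · rw [← List.append_assoc, ← h4, ← g4]
  · simp; omega

/-- Additional credits remain. -/
theorem add_credits {p : Prog α} {Q : α → Mem → Out → ℕ → Prop} (h : Am A p m o Φ Q) (e : ℕ) :
    Am A p m o (Φ + e) fun r m' o' Φ' => ∃ Φ'', Q r m' o' Φ'' ∧ Φ' = Φ'' + e := by
  intro t pt
  obtain ⟨c, Φ', h1, h2, h3⟩ := h t pt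
  exact ⟨c, Φ' + e, by omega, ⟨Φ', h2, rfl⟩, h3⟩

theorem read {a : Arr} {i : ℕ} {f : ℕ → Prog β} {Q : β → Mem → Out → ℕ → Prop}
    (h : Am A (f (m a i)) m o Φ Q) : Am A (CoreGadget.read a i >>= f) m o (Φ + 1) Q := by
  refine bind (Q := fun r m' o' Φ' => r = m a i ∧ m' = m ∧ o' = o ∧ Φ' = Φ) ?_ ?_
  · intro t pt
    exact ⟨1, Φ, by omega, ⟨rfl, rfl, rfl, rfl⟩, le_rfl, Nat.le_add_right _ _, [],
      by simp [CoreGadget.read], by simp⟩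
  · rintro r m' o' _ ⟨rfl, rfl, rfl, rfl⟩
    exact h

theorem write {a : Arr} {i w : ℕ} {f : Unit → Prog β} {Q : β → Mem → Out → ℕ → Prop}
    (h : Am A (f ()) (put m a i w) o Φ Q) :
    Am A (CoreGadget.write a i w >>= f) m o (Φ + 1) Q := by
  refine bind (Q := fun r m' o' Φ' => m' = put m a i w ∧ o' = o ∧ Φ' = Φ) ?_ ?_
  · exact of_run (Run.write_last (c := 0) (Q := fun _ m' o' => m' = put m a i w ∧ o' = o)
      ⟨rfl, rfl⟩) fun _ _ _ h => ⟨Φ, by omega, h.1, h.2, rfl⟩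
  · rintro r m' o' _ ⟨rfl, rfl, rfl⟩
    exact h

theorem emit {e : EdgeUpdate XVertex} {f : Unit → Prog β} {Q : β → Mem → Out → ℕ → Prop}
    (h : Am A (f ()) m (o ++ [e]) Φ Q) : Am A (CoreGadget.emit e >>= f) m o (Φ + 1) Q := by
  refine bind (Q := fun r m' o' Φ' => m' = m ∧ o' = o ++ [e] ∧ Φ' = Φ) ?_ ?_
  · intro t pt
    exact ⟨1, Φ, by omega, ⟨rfl, rfl, rfl⟩, le_rfl, Nat.le_add_right _ _, [e], rfl, by simp⟩
  · rintro r m' o' _ ⟨rfl, rfl, rfl⟩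
    exact h

end Am

/-- The tables of neighbours that the expander procedure returns for `N` are well formed. -/
def ValidTables (P : ExpanderProcedure) (N : ℕ) : Prop :=
  ∀ d, 3 ≤ d → d ≤ N → (∀ x < N, ∀ i < d, P.nbr N d x i < N) ∧
    ∀ x < N, ∀ i < d, ∀ j < d, P.nbr N d x i = P.nbr N d x j → i = j

/-- The invariant of the gadget, except for the balance of the degrees in `L`. The number `m₀` of
edges of `G` at the last BALANCE or RECOMPUTE and the number `E` of edges that UPDATE has inserted
since then are not stored in memory. For a vertex in `W`, the invariant allows
`deg_G(v) = 2 deg_L(v)`. -/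
structure Inv {n : ℕ} (P : ExpanderProcedure) (N : ℕ) (G : SimpleGraph (Fin n)) (W : ℕ → Prop)
    (B : Finset (ℕ × ℕ)) (m₀ E : ℕ) (m : Mem) (o : Out) : Prop where
  base : Base N G B (expSet P N (m .degX 0)) m o
  vl : VLArrays n N B m
  xa : XArrays N (expSet P N (m .degX 0)) m
  ga : GArrays G m
  degX_eq : m .degX 0 = expanderDegree n N (m .edgesLast 0)
  edges_lt : m .edges 0 < 2 * m .edgesLast 0 + n
  edgesLast_lt : m .edgesLast 0 < 2 * n ∨ m .edgesLast 0 < 2 * m .edges 0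
  three_le : ∀ v < n, 3 ≤ m .degVL v
  degG_le : ∀ v < n, m .degG v ≤ 2 * m .degVL v
  degG_lt : ∀ v < n, ¬ W v → m .degG v < 2 * m .degVL v
  m₀_le : m₀ ≤ 2 * m .edgesLast 0 + n
  sum_degVL : ∑ v ∈ Finset.range n, m .degVL v = 2 * m₀ + 3 * n + E
  low : ∀ x < N, m .degX 0 + (2 * m₀ + 3 * n) / N ≤ m .degL x
  /-- The maximum degree rises above its level after the last BALANCE only by insertions of
  proportionally many edges. -/
  high : ∀ x < N, N * m .degL x ≤ N * (m .degX 0 + (2 * m₀ + 3 * n) / N + 3) + 4 * E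

/-- All degrees in `L` are less than twice the minimum degree. -/
def Balanced (N : ℕ) (m : Mem) : Prop := ∀ x < N, ∀ y < N, m .degL x < 2 * m .degL y

/-- The potential. The first term pays for RECOMPUTE, the second for UPDATE, the third for
BALANCE. Subtractions are truncated: the first term is `|m_cur - m_t|`, and a vertex `v` has
positive potential only if `deg_G(v) > deg_L(v)`. -/
def pot (n : ℕ) (m : Mem) (E : ℕ) : ℕ :=
  1300 * ((m .edges 0 - m .edgesLast 0) + (m .edgesLast 0 - m .edges 0)) +
    1260 * (∑ v ∈ Finset.range n, (m .degG v - m .degVL v)) + 600 * E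

section amortized

variable {A n N : ℕ} {G : SimpleGraph (Fin n)} {P : ExpanderProcedure} {W : ℕ → Prop}
  {B : Finset (ℕ × ℕ)} {m₀ E : ℕ} {m : Mem} {o : Out}

/-- After a Round-Robin allocation, the invariant holds with `E = 0`. -/
theorem inv_of_roundRobin (hN : n + 2 ≤ N) (hN' : 4 * N ≤ 5 * n)
    (base : Base N G (rrSet N (m .degG) n) (expSet P N (m .degX 0)) m o)
    (vl : VLArrays n N (rrSet N (m .degG) n) m) (xa : XArrays N (expSet P N (m .degX 0)) m)
    (ga : GArrays G m) (hd : m .degX 0 = expanderDegree n N (m .edgesLast 0))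
    (h1 : m .edges 0 < 2 * m .edgesLast 0 + n)
    (h2 : m .edgesLast 0 < 2 * n ∨ m .edgesLast 0 < 2 * m .edges 0)
    (hV : ∀ v < n, m .degVL v = m .degG v + 3) :
    Inv P N G (fun _ => False) (rrSet N (m .degG) n) (m .edges 0) 0 m o ∧ Balanced N m ∧
      pot n m 0 = 1300 * ((m .edges 0 - m .edgesLast 0) + (m .edgesLast 0 - m .edges 0)) := by
  have hT : ∑ v ∈ Finset.range n, (m .degG v + 3) = 2 * m .edges 0 + 3 * n := by
    rw [Finset.sum_add_distrib, ga.sum_deg]; simp [mul_comm]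
  have hg : ∀ v < n, m .degG v + 3 ≤ N := fun v hv => by have := ga.deg_lt hv; omega
  have hdeg : ∀ x < N, m .degX 0 + (2 * m .edges 0 + 3 * n) / N ≤ m .degL x ∧
      m .degL x ≤ m .degX 0 + (2 * m .edges 0 + 3 * n) / N + 1 := by
    intro x hx
    have := colDeg_rrSet hg hx
    rw [hT] at this
    rw [base.deg x hx, xa.rowDeg_eq hx]
    omega
  have h3 : 3 ≤ m .degX 0 := hd ▸ three_le_expanderDegree (by omega) (by omega) _
  refine ⟨⟨base, vl, xa, ga, hd, h1, h2, ?_, ?_, ?_, by omega, ?_, fun x hx => (hdeg x hx).1, ?_⟩,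
    ?_, ?_⟩
  · intro v hv; rw [hV v hv]; omega
  · intro v hv; rw [hV v hv]; omega
  · intro v hv _; rw [hV v hv]; omega
  · rw [← hT, add_zero]
    exact Finset.sum_congr rfl fun v hv => hV v (Finset.mem_range.1 hv)
  · intro x hx
    have := hdeg x hx
    exact (Nat.mul_le_mul_left _ (by omega)).trans (Nat.le_add_right _ _)
  · intro x hx y hy
    have h4 := hdeg x hx
    have h5 := hdeg y hy
    generalize (2 * m .edges 0 + 3 * n) / N = q at *
    omega
  · unfold pot
    rw [Finset.sum_eq_zero]
    · omega
    · intro v hv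
      rw [hV v (Finset.mem_range.1 hv)]; omega

/-- Two functions on the vertices, the first at most the second except at `w`. -/
theorem sum_change {f f' : ℕ → ℕ} {w a b : ℕ} (hw : w < n) (h : ∀ v < n, v ≠ w → f' v ≤ f v)
    (h' : f' w + a ≤ f w + b) :
    ∑ v ∈ Finset.range n, f' v + a ≤ ∑ v ∈ Finset.range n, f v + b := by
  rw [← Finset.add_sum_erase _ _ (Finset.mem_range.2 hw),
    ← Finset.add_sum_erase _ f (Finset.mem_range.2 hw)]
  have : ∑ v ∈ (Finset.range n).erase w, f' v ≤ ∑ v ∈ (Finset.range n).erase w, f v := by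
    refine Finset.sum_le_sum fun v hv => ?_
    rw [Finset.mem_erase, Finset.mem_range] at hv
    exact h v hv.2 hv.1
  omega

/-- If UPDATE joins `v` to a vertex `x` while at least half of the vertices of `L` are neither old
nor new neighbours of `v`, then these have at least the degree of `x`, so that `E` is large. -/
theorem Inv.high_of_choice (hI : Inv P N G W B m₀ E m o) {v : ℕ} (hv : v < n) {S : Finset ℕ}
    (hS : IsMinChoice N v (m .degVL v) B (m .degL) S) (hk : 2 * (2 * m .degVL v + 3) ≤ N) {x : ℕ}
    (hx : x ∈ S) :
    N * (m .degL x + 1) ≤ N * (m .degX 0 + (2 * m₀ + 3 * n) / N + 3) + 4 * E := by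
  set q := (2 * m₀ + 3 * n) / N with hq
  set D := m .degX 0 + q with hD
  have hxN := hS.lt x hx
  -- the vertices that are neither old nor new neighbours
  set Q := (Finset.range N).filter fun y => (v, y) ∉ B ∧ y ∉ S with hQ
  have hQcard : N ≤ 2 * Q.card := by
    have h1 : Finset.range N ⊆ Q ∪ (((Finset.range N).filter fun y => (v, y) ∈ B) ∪ S) := by
      intro y hy
      simp only [hQ, Finset.mem_union, Finset.mem_filter]
      tauto
    have h2 := Finset.card_le_card h1
    have h3 := Finset.card_union_le Q (((Finset.range N).filter fun y => (v, y) ∈ B) ∪ S)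
    have h4 := Finset.card_union_le ((Finset.range N).filter fun y => (v, y) ∈ B) S
    have h5 := hI.vl.card_neighbours_le hv
    rw [hS.card_eq] at h4
    rw [Finset.card_range] at h2
    omega
  have hsum : ∑ y ∈ Finset.range N, m .degL y = N * m .degX 0 + (2 * m₀ + 3 * n + E) := by
    rw [← hI.sum_degVL, ← hI.vl.card_eq, ← sum_colDeg hI.base.B_sub]
    rw [Finset.sum_congr rfl fun y hy => hI.base.deg y (Finset.mem_range.1 hy),
      Finset.sum_add_distrib, add_comm]
    congr 1
    rw [Finset.sum_congr rfl fun y hy => hI.xa.rowDeg_eq (Finset.mem_range.1 hy)]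
    simp
  have hsum2 : ∑ y ∈ Finset.range N, m .degL y =
      N * D + ∑ y ∈ Finset.range N, (m .degL y - D) := by
    have : ∑ y ∈ Finset.range N, m .degL y = ∑ y ∈ Finset.range N, (D + (m .degL y - D)) := by
      refine Finset.sum_congr rfl fun y hy => ?_
      have := hI.low y (Finset.mem_range.1 hy)
      omega
    rw [this, Finset.sum_add_distrib]
    simp
  have hsum3 : Q.card * (m .degL x - D) ≤ ∑ y ∈ Finset.range N, (m .degL y - D) := by
    calc Q.card * (m .degL x - D) = ∑ _y ∈ Q, (m .degL x - D) := by simp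
      _ ≤ ∑ y ∈ Q, (m .degL y - D) := by
        refine Finset.sum_le_sum fun y hy => ?_
        simp only [hQ, Finset.mem_filter, Finset.mem_range] at hy
        have := hS.le x hx y hy.1 hy.2.2 hy.2.1
        omega
      _ ≤ ∑ y ∈ Finset.range N, (m .degL y - D) :=
        Finset.sum_le_sum_of_subset (Finset.filter_subset _ _)
  have hlow := hI.low x hxN
  obtain ⟨e, he⟩ : ∃ e, m .degL x = D + e := ⟨m .degL x - D, by omega⟩
  have h6 : N * e ≤ 2 * (Q.card * e) := by
    rw [← mul_assoc]; exact Nat.mul_le_mul_right _ hQcard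
  rw [he, Nat.add_sub_cancel_left] at hsum3
  have h7 := Nat.div_add_mod (2 * m₀ + 3 * n) N
  have h8 := Nat.mod_lt (2 * m₀ + 3 * n) (show N > 0 by omega)
  rw [← hq] at h7
  rw [he]
  have h9 : N * D = N * m .degX 0 + N * q := by rw [hD, mul_add]
  have h10 : N * (D + e + 1) = N * D + N * e + N := by ring
  have h11 : N * (D + 3) = N * D + 3 * N := by ring
  omega

/-- UPDATE for a vertex with `deg_G(v) = 2 deg_L(v)` keeps the invariant, and `E` grows by the
number of inserted edges. -/
theorem update_inv_run (hN : n + 2 ≤ N) (hI : Inv P N G W B m₀ E m o) {v : ℕ}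
    (hv : v < n) (hg : m .degG v = 2 * m .degVL v) :
    Run A (update N v) m o (25 * (m .degVL v + 3)) fun _ m' o' => ∃ B',
      Inv P N G (fun w => W w ∧ w ≠ v) B' m₀ (E + (m .degVL v + 3)) m' o' ∧
      m' .edges = m .edges ∧ m' .edgesLast = m .edgesLast ∧ m' .degG = m .degG ∧
      m' .degVL = Function.update (m .degVL) v (2 * m .degVL v + 3) := by
  have hgv := hI.ga.deg_lt hv
  refine (update_run hI.base hI.vl hv (by omega) (by omega)).mono le_rfl ?_
  rintro _ m' o' ⟨S, B', hS, hdeg, hB, hV, hs, hVL⟩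
  set k := m .degVL v with hk
  have e1 : m' .edges = m .edges := hs _ (by simp)
  have e2 : m' .edgesLast = m .edgesLast := hs _ (by simp)
  have e3 : m' .degG = m .degG := hs _ (by simp)
  have e4 : m' .degX = m .degX := hs _ (by simp)
  have hlen : ∀ w, m' .degVL w = if w = v then 2 * k + 3 else m .degVL w := by
    intro w; rw [hVL, Function.update_apply]
  refine ⟨B', ⟨by rw [e4]; exact hB, hV, ?_, hI.ga.congr e1 e3, by rw [e4, e2]; exact hI.degX_eq,
    by rw [e1, e2]; exact hI.edges_lt, by rw [e1, e2]; exact hI.edgesLast_lt, ?_, ?_, ?_,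
    by rw [e2]; exact hI.m₀_le, ?_, ?_, ?_⟩, e1, e2, e3, hVL⟩
  · rw [e4]
    exact hI.xa.congr e4 (hs _ (by simp)) (hs _ (by simp))
  · intro w hw
    have := hI.three_le w hw
    rw [hlen]; split_ifs <;> omega
  · intro w hw
    have := hI.degG_le w hw
    rw [hlen, e3]
    split_ifs with e
    · subst e; omega
    · exact this
  · intro w hw hW
    rw [hlen, e3]
    split_ifs with e
    · subst e; omega
    · exact hI.degG_lt w hw fun h => hW ⟨h, e⟩
  · have h1 := hI.sum_degVL
    have h2 := sum_change (f := m .degVL) (f' := m' .degVL) (a := 0) (b := k + 3) hv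
      (fun w _ hw => by rw [hlen, if_neg hw]) (by rw [hlen, if_pos rfl]; omega)
    have h3 := sum_change (f := m' .degVL) (f' := m .degVL) (a := k + 3) (b := 0) hv
      (fun w _ hw => by rw [hlen, if_neg hw]) (by rw [hlen, if_pos rfl]; omega)
    omega
  · intro x hx
    rw [e4, hdeg x hx]
    exact (hI.low x hx).trans (Nat.le_add_right _ _)
  · intro x hx
    rw [e4, hdeg x hx]
    have h0 := hI.high x hx
    split_ifs with hxS
    · -- if `v` gets few neighbours, compare with the vertices not chosen; otherwise the increase of
      -- `E` by at least `N / 4` pays for the increase of the degree by one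
      by_cases hsm : 2 * (2 * k + 3) ≤ N
      · have := hI.high_of_choice hv hS hsm hxS
        omega
      · rw [mul_add]
        omega
    · rw [add_zero]; omega

/-- BALANCE is called only if the potential of the edges inserted by UPDATE pays for it. -/
theorem balance_inv_run (hN : n + 2 ≤ N) (hN' : 4 * N ≤ 5 * n)
    (hI : Inv P N G W B m₀ E m o) {x y : ℕ} (hx : x < N) (hy : y < N)
    (hxy : 2 * m .degL x ≤ m .degL y) :
    Run A (balance n N) m o (600 * E) fun _ m' o' => ∃ B' m₀',
      Inv P N G (fun _ => False) B' m₀' 0 m' o' ∧ Balanced N m' ∧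
      pot n m' 0 + 600 * E ≤ pot n m E := by
  have hg : ∀ v < n, m .degG v + 3 ≤ N := fun v hv => by have := hI.ga.deg_lt hv; omega
  have hT : ∑ v ∈ Finset.range n, (m .degG v + 3) = 2 * m .edges 0 + 3 * n := by
    rw [Finset.sum_add_distrib, hI.ga.sum_deg]; simp [mul_comm]
  refine (balance_run (by omega) (by omega) hI.base hI.vl hg).mono ?_ ?_
  · rw [hT, hI.sum_degVL]
    -- with `δ₀ = d + q`, the degree condition gives `N (δ₀ - 3) ≤ 4 E`; since `δ₀ ≥ 5`, this makes
    -- `E` proportional to `N δ₀`, hence to `m_t + m₀ + n`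
    have h1 := hI.low x hx
    have h2 := hI.high y hy
    have h3 := (mul_expanderDegree (N := N) (by omega) n (m .edgesLast 0)).1
    have h4 : 3 ≤ m .degX 0 := hI.degX_eq ▸ three_le_expanderDegree (by omega) (by omega) _
    rw [← hI.degX_eq] at h3
    have h5 := Nat.div_add_mod (2 * m₀ + 3 * n) N
    have h6 := Nat.mod_lt (2 * m₀ + 3 * n) (show N > 0 by omega)
    have h7 : 2 ≤ (2 * m₀ + 3 * n) / N := by
      rw [Nat.le_div_iff_mul_le (by omega)]; omega
    have h8 := hI.edges_lt
    generalize (2 * m₀ + 3 * n) / N = q at *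
    generalize (2 * m₀ + 3 * n) % N = r at *
    generalize m .degX 0 = d at *
    have h9 : N * (2 * (d + q)) ≤ N * m .degL y := Nat.mul_le_mul_left _ (by omega)
    have h10 : N * 3 ≤ N * d := Nat.mul_le_mul_left _ h4
    have h11 : N * 2 ≤ N * q := Nat.mul_le_mul_left _ h7
    have h12 : N * (2 * (d + q)) = 2 * (N * d) + 2 * (N * q) := by ring
    have h13 : N * (d + q + 3) = N * d + N * q + 3 * N := by ring
    omega
  · rintro _ m' o' ⟨h1, h2, h3, h4⟩
    have e1 : m' .edges = m .edges := h4 _ (by simp)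
    have e2 : m' .edgesLast = m .edgesLast := h4 _ (by simp)
    have e3 : m' .degG = m .degG := h4 _ (by simp)
    have e4 : m' .degX = m .degX := h4 _ (by simp)
    rw [← e3, ← e4] at h1
    rw [← e3] at h2 h3
    obtain ⟨g1, g2, g3⟩ := inv_of_roundRobin (m := m') hN hN' h1 h2
      (by rw [e4]; exact hI.xa.congr e4 (h4 _ (by simp)) (h4 _ (by simp))) (hI.ga.congr e1 e3)
      (by rw [e4, e2]; exact hI.degX_eq) (by rw [e1, e2]; exact hI.edges_lt)
      (by rw [e1, e2]; exact hI.edgesLast_lt) h3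
    refine ⟨_, _, g1, g2, ?_⟩
    rw [g3, e1, e2]
    unfold pot
    omega

/-- UPDATE consumes the potential `deg_G(v) - deg_L(v) = deg_L(v)` of `v`, which pays for its steps
and for the growth of `E`. -/
theorem serveEndpoint_am (hN : n + 2 ≤ N) (hN' : 4 * N ≤ 5 * n)
    (hI : Inv P N G W B m₀ E m o) (hb : Balanced N m) {v : ℕ} (hv : v < n) :
    Am A (serveEndpoint n N v) m o (pot n m E + 6) fun _ m' o' Φ' => ∃ B' m₀' E',
      Inv P N G (fun w => W w ∧ w ≠ v) B' m₀' E' m' o' ∧ Balanced N m' ∧ pot n m' E' ≤ Φ' := by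
  unfold serveEndpoint
  refine Am.read (Am.read ?_)
  by_cases hg : 2 * m .degVL v ≤ m .degG v
  · rw [if_pos hg]
    have hg' : m .degG v = 2 * m .degVL v := le_antisymm (hI.degG_le v hv) hg
    have h3 := hI.three_le v hv
    refine Am.bind (Am.of_run (update_inv_run hN hI hv hg') (Q' := fun _ m' o' Φ' => ∃ B' E',
      Inv P N G (fun w => W w ∧ w ≠ v) B' m₀ E' m' o' ∧ Φ' = pot n m' E' + 4) ?_) ?_
    · rintro _ m' o' ⟨B', h1, e1, e2, e3, e4⟩
      refine ⟨_, ?_, B', _, h1, rfl⟩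
      have hlen : ∀ w, m' .degVL w = if w = v then 2 * m .degVL v + 3 else m .degVL w := by
        intro w; rw [e4, Function.update_apply]
      have := sum_change (f := fun w => m .degG w - m .degVL w)
        (f' := fun w => m' .degG w - m' .degVL w) (a := m .degVL v) (b := 0) hv
        (fun w _ hw => by simp [hlen, if_neg hw, e3]) (by simp only [hlen, e3, if_pos]; omega)
      unfold pot
      rw [e1, e2]
      omega
    · rintro _ m₁ o₁ _ ⟨B₁, E₁, h1, rfl⟩
      refine Am.read (Am.read (Am.read (Am.read ?_)))
      have hs := h1.base.sorted
      have ho := hs.order_lt 0 (by omega)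
      have ho' := hs.order_lt (N - 1) (by omega)
      by_cases hc : 2 * m₁ .degL (m₁ .order 0) ≤ m₁ .degL (m₁ .order (N - 1))
      · rw [if_pos hc]
        refine Am.of_run (balance_inv_run hN hN' h1 ho ho' hc) ?_
        rintro _ m₂ o₂ ⟨B₂, m₂', h4, h5, h6⟩
        refine ⟨pot n m₂ 0, by omega, B₂, m₂', 0, ?_, h5, le_rfl⟩
        exact { h4 with degG_lt := fun w hw _ => h4.degG_lt w hw id }
      · rw [if_neg hc]
        refine Am.pure ⟨B₁, m₀, E₁, h1, ?_, le_rfl⟩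
        have hle : ∀ x < N, m₁ .degL (m₁ .order 0) ≤ m₁ .degL x ∧
            m₁ .degL x ≤ m₁ .degL (m₁ .order (N - 1)) := by
          intro x hx
          have hp := hs.pos_lt x hx
          have hd := h1.base.deg_le (by omega) hx
          have a := hs.mono (i := 0) (j := m₁ .pos x) (by omega) hp
            (by rw [hs.order_pos x hx]; exact hd)
          have b := hs.mono (i := m₁ .pos x) (j := N - 1) (by omega) (by omega)
            (h1.base.deg_le (by omega) ho')
          rw [hs.order_pos x hx] at a b
          exact ⟨a, b⟩
        intro x hx y hy
        have := hle x hx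
        have := hle y hy
        omega
  · rw [if_neg hg]
    refine Am.pure ⟨B, m₀, E, ?_, hb, by omega⟩
    refine { hI with degG_lt := fun w hw hW => ?_ }
    by_cases e : w = v
    · subst e; omega
    · exact hI.degG_lt w hw fun h => hW ⟨h, e⟩

end amortized

/-! ### Insertions and deletions -/

section updates

variable {A n N : ℕ} {G : SimpleGraph (Fin n)} {P : ExpanderProcedure} {W : ℕ → Prop}
  {B X : Finset (ℕ × ℕ)} {m₀ E : ℕ} {m m₁ : Mem} {o o₁ : Out} {u v : Fin n}

/-- RECOMPUTE establishes the invariant, with potential `0`. -/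
theorem recompute_inv_run {first : Bool} (hN : n + 2 ≤ N) (hN' : 4 * N ≤ 5 * n)
    (hP : ValidTables P N)
    (hA : ∀ d, 3 ≤ d → d ≤ N → (if first then P.firstTime N d else P.time N d) ≤ A * (N * d))
    (hB : Base N G B X m o) (hV : VLArrays n N B m) (hX : XArrays N X m) (hG : GArrays G m) :
    Run A (recompute P first n N) m o
      (35 * (4 * m .edges 0 + 7 * n + 2 * N + N * m .degX 0 +
        ∑ v ∈ Finset.range n, m .degVL v))
      fun _ m' o' => ∃ B', Inv P N G (fun _ => False) B' (m .edges 0) 0 m' o' ∧ Balanced N m' ∧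
        pot n m' 0 = 0 := by
  have hg : ∀ v < n, m .degG v + 3 ≤ N := fun v hv => by have := hG.deg_lt hv; omega
  have hT : ∑ v ∈ Finset.range n, (m .degG v + 3) = 2 * m .edges 0 + 3 * n := by
    rw [Finset.sum_add_distrib, hG.sum_deg]; simp [mul_comm]
  set d' := expanderDegree n N (m .edges 0) with hd'
  have h3 : 3 ≤ d' := three_le_expanderDegree (by omega) (by omega) _
  have hdN : d' ≤ N := expanderDegree_le hN hG.two_mul_edges_le
  have hm := (mul_expanderDegree (N := N) (by omega) n (m .edges 0)).2
  rw [← hd'] at hm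
  refine (recompute_run (by omega) (by omega) hB hV hX hg hd' hdN (hP d' h3 hdN).1
    (hP d' h3 hdN).2 (hA d' h3 hdN)).mono ?_ ?_
  · rw [hT]; omega
  · rintro _ m' o' ⟨h1, h2, h4, h5, h6, h7, h8, h9⟩
    rw [← h9, ← h6] at h1
    rw [← h9] at h2 h4
    rw [← h6] at h5
    obtain ⟨g1, g2, g3⟩ := inv_of_roundRobin hN hN' h1 h2 h5 (hG.congr h8 h9)
      (by rw [h6, h7]) (by rw [h7, h8]; omega) (by rw [h7, h8]; omega) h4
    rw [h8] at g1
    refine ⟨_, g1, g2, ?_⟩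
    rw [g3, h7, h8]
    omega

/-- Replace the graph `G` in the invariant. -/
theorem Inv.graph_update {G' : SimpleGraph (Fin n)} {W' : ℕ → Prop} (hI : Inv P N G W B m₀ E m o)
    (hs : Same [.edges, .degG] m m₁) (hB : Base N G' B (expSet P N (m .degX 0)) m o₁)
    (hG : GArrays G' m₁) (h1 : m₁ .edges 0 < 2 * m .edgesLast 0 + n)
    (h2 : m .edgesLast 0 < 2 * n ∨ m .edgesLast 0 < 2 * m₁ .edges 0)
    (h3 : ∀ v < n, m₁ .degG v ≤ 2 * m .degVL v)
    (h4 : ∀ v < n, ¬ W' v → m₁ .degG v < 2 * m .degVL v) :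
    Inv P N G' W' B m₀ E m₁ o₁ := by
  have eV : m₁ .degVL = m .degVL := hs _ (by simp)
  have eX : m₁ .degX = m .degX := hs _ (by simp)
  have eL : m₁ .degL = m .degL := hs _ (by simp)
  have eE : m₁ .edgesLast = m .edgesLast := hs _ (by simp)
  refine ⟨?_, hI.vl.congr eV (hs _ (by simp)) (hs _ (by simp)), ?_, hG, ?_, ?_, ?_, ?_, ?_, ?_, ?_,
    ?_, ?_, ?_⟩
  · rw [eX]
    exact hB.congr eL (hs _ (by simp)) (hs _ (by simp)) (hs _ (by simp))
  · rw [eX]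
    exact hI.xa.congr eX (hs _ (by simp)) (hs _ (by simp))
  · rw [eX, eE]; exact hI.degX_eq
  · rw [eE]; exact h1
  · rw [eE]; exact h2
  · rw [eV]; exact hI.three_le
  · rw [eV]; exact h3
  · rw [eV]; exact h4
  · rw [eE]; exact hI.m₀_le
  · rw [eV]; exact hI.sum_degVL
  · rw [eL, eX]; exact hI.low
  · rw [eL, eX]; exact hI.high

/-- RECOMPUTE after an update of `G` is paid for by the potential of the updates since the last
RECOMPUTE: there were at least `m_t + n` insertions, or `m_t / 2` deletions with `m_t ≥ 2 n`. -/
theorem recompute_am {G' : SimpleGraph (Fin n)} (hN : n + 2 ≤ N) (hN' : 4 * N ≤ 5 * n)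
    (hP : ValidTables P N) (hA : ∀ d, 3 ≤ d → d ≤ N → P.time N d ≤ A * (N * d))
    (hI : Inv P N G W B m₀ E m o)
    (hs : Same [.edges, .degG] m m₁) (hB : Base N G' B (expSet P N (m .degX 0)) m o₁)
    (hG : GArrays G' m₁)
    (h : (m₁ .edges 0 = m .edges 0 + 1 ∧ 2 * m .edgesLast 0 + n ≤ m .edges 0 + 1) ∨
      (m₁ .edges 0 + 1 = m .edges 0 ∧ n ≤ m₁ .edges 0 ∧ 2 * m₁ .edges 0 ≤ m .edgesLast 0)) :
    Am A (recompute P false n N) m₁ o₁ (pot n m E + 1300) fun _ m' o' Φ' => ∃ B' m₀' E',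
      Inv P N G' (fun _ => False) B' m₀' E' m' o' ∧ Balanced N m' ∧ pot n m' E' ≤ Φ' := by
  have eV : m₁ .degVL = m .degVL := hs _ (by simp)
  have eX : m₁ .degX = m .degX := hs _ (by simp)
  have hB1 := hB.congr (hs _ (by simp)) (hs _ (by simp)) (hs _ (by simp)) (hs _ (by simp))
  have hV1 := hI.vl.congr eV (hs _ (by simp)) (hs _ (by simp))
  have hX1 := hI.xa.congr eX (hs _ (by simp)) (hs _ (by simp))
  refine Am.of_run (recompute_inv_run (first := false) hN hN' hP (by simpa using hA) hB1 hV1 hX1 hG)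
    ?_
  rintro _ m' o' ⟨B', g1, g2, g3⟩
  refine ⟨0, ?_, B', _, 0, g1, g2, g3.le⟩
  have hd := (mul_expanderDegree (N := N) (by omega) n (m .edgesLast 0)).2
  rw [← hI.degX_eq] at hd
  have h1 := hI.m₀_le
  have h2 := hI.edges_lt
  rw [eV, hI.sum_degVL, eX]
  unfold pot
  omega

theorem insertEdge_am (hN : n + 2 ≤ N) (hN' : 4 * N ≤ 5 * n) (hP : ValidTables P N)
    (hA : ∀ d, 3 ≤ d → d ≤ N → P.time N d ≤ A * (N * d))
    (hI : Inv P N G (fun _ => False) B m₀ E m o) (hb : Balanced N m) (hl : (ins u v).Legal G) :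
    Am A (insertEdge P n N u v) m o (pot n m E + 6000) fun _ m' o' Φ' => ∃ B' m₀' E',
      Inv P N ((ins u v).apply G) (fun _ => False) B' m₀' E' m' o' ∧ Balanced N m' ∧
        pot n m' E' ≤ Φ' := by
  unfold insertEdge
  have huv : (v : ℕ) ≠ u := fun e => hl.1 (Fin.ext e.symm)
  refine Am.mono (Am.emit (Am.read (Am.write (Am.read (Am.write (Am.read (Am.write (Am.read ?_
    (Φ := pot n m E + 5000)))))))))  (by omega) fun _ _ _ _ h => h
  set m₁ := put (put (put m .edges 0 (m .edges 0 + 1)) .degG u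
    (put m .edges 0 (m .edges 0 + 1) .degG u + 1)) .degG v
    (put (put m .edges 0 (m .edges 0 + 1)) .degG u
    (put m .edges 0 (m .edges 0 + 1) .degG u + 1) .degG v + 1) with hm₁
  have hs : Same [.edges, .degG] m m₁ :=
    ((Same.rfl.put (by simp)).put (by simp)).put (by simp)
  have e1 : m₁ .edges 0 = m .edges 0 + 1 := by simp [hm₁, put_ne]
  have e2 : m₁ .degG = Function.update (Function.update (m .degG) u (m .degG u + 1)) v
      (m .degG v + 1) := by
    simp [hm₁, put_ne, Function.update_of_ne huv]
  have hG := hI.ga.ins hl e1 e2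
  have hB := hI.base.ins_V hl
  have e3 : m₁ .edgesLast = m .edgesLast := hs _ (by simp)
  rw [e3]
  by_cases hc : 2 * m .edgesLast 0 + n ≤ m .edges 0 + 1
  · rw [if_pos hc]
    exact (recompute_am hN hN' hP hA hI hs hB hG (Or.inl ⟨e1, hc⟩)).mono (by omega)
      fun _ _ _ _ h => h
  · rw [if_neg hc]
    have hdeg : ∀ w, m₁ .degG w = m .degG w + if w = u ∨ w = v then 1 else 0 := by
      intro w
      rw [e2, Function.update_apply, Function.update_apply]
      grind
    have hI1 : Inv P N ((ins u v).apply G) (fun w => w = u ∨ w = v) B m₀ E m₁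
        (o ++ [ins (orig u) (orig v)]) := by
      refine hI.graph_update hs hB hG (by omega) ?_ ?_ ?_
      · have := hI.edgesLast_lt
        omega
      · intro w hw
        have := hI.degG_lt w hw id
        rw [hdeg]
        split_ifs <;> omega
      · intro w hw hW
        have := hI.degG_lt w hw id
        rw [hdeg, if_neg hW]
        exact this
    have hb1 : Balanced N m₁ := by
      unfold Balanced
      rw [hs .degL (by simp)]
      exact hb
    -- the edge count changes by one, and two degrees grow by one: `3820 = 1300 + 2 * 1260`
    have hpot : pot n m₁ E ≤ pot n m E + 3820 := by
      let f : ℕ → ℕ := fun w => if w = u then m .degG w + 1 - m .degVL w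
        else m .degG w - m .degVL w
      have s1 := sum_change (f := fun w => m .degG w - m .degVL w) (f' := f) (a := 0) (b := 1)
        u.2 (fun w _ hw => by simp [f, if_neg hw]) (by simp only [f, if_true]; omega)
      have s2 := sum_change (f := f) (f' := fun w => m₁ .degG w - m₁ .degVL w) (a := 0) (b := 1)
        v.2 (fun w _ hw => by
          simp only [f, hdeg, hs .degVL (by simp), hw, or_false]
          split_ifs <;> omega)
        (by simp only [f, hdeg, hs .degVL (by simp), huv, if_false, or_true, if_true]; omega)
      unfold pot
      rw [e1, e3]
      omega
    refine Am.bind (((serveEndpoint_am hN hN' hI1 hb1 v.2).add_credits 6).mono (by omega)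
      fun _ _ _ _ h => h) ?_
    rintro _ m₂ o₂ _ ⟨Φ, ⟨B₂, m₂', E₂, k1, k2, k3⟩, rfl⟩
    refine (serveEndpoint_am hN hN' k1 k2 u.2).mono (by omega) ?_
    rintro _ m₃ o₃ Φ' ⟨B₃, m₃', E₃, l1, l2, l3⟩
    refine ⟨B₃, m₃', E₃, ?_, l2, l3⟩
    exact { l1 with degG_lt := fun w hw _ => l1.degG_lt w hw (by tauto) }

theorem deleteEdge_am (hN : n + 2 ≤ N) (hN' : 4 * N ≤ 5 * n) (hP : ValidTables P N)
    (hA : ∀ d, 3 ≤ d → d ≤ N → P.time N d ≤ A * (N * d))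
    (hI : Inv P N G (fun _ => False) B m₀ E m o) (hb : Balanced N m) (hl : (del u v).Legal G) :
    Am A (deleteEdge P n N u v) m o (pot n m E + 6000) fun _ m' o' Φ' => ∃ B' m₀' E',
      Inv P N ((del u v).apply G) (fun _ => False) B' m₀' E' m' o' ∧ Balanced N m' ∧
        pot n m' E' ≤ Φ' := by
  unfold deleteEdge
  have huv : (v : ℕ) ≠ u := fun e => SimpleGraph.Adj.ne hl (Fin.ext e.symm)
  refine Am.mono (Am.emit (Am.read (Am.write (Am.read (Am.write (Am.read (Am.write (Am.read ?_
    (Φ := pot n m E + 5000)))))))))  (by omega) fun _ _ _ _ h => h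
  set m₁ := put (put (put m .edges 0 (m .edges 0 - 1)) .degG u
    (put m .edges 0 (m .edges 0 - 1) .degG u - 1)) .degG v
    (put (put m .edges 0 (m .edges 0 - 1)) .degG u
    (put m .edges 0 (m .edges 0 - 1) .degG u - 1) .degG v - 1) with hm₁
  have hs : Same [.edges, .degG] m m₁ :=
    ((Same.rfl.put (by simp)).put (by simp)).put (by simp)
  have e1 : m₁ .edges 0 = m .edges 0 - 1 := by simp [hm₁, put_ne]
  have hpos : 0 < m .edges 0 := by
    rw [hI.ga.edges, ← ncard_edgeSet_del hl]; omega
  have e2 : m₁ .degG = Function.update (Function.update (m .degG) u (m .degG u - 1)) v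
      (m .degG v - 1) := by
    simp [hm₁, put_ne, Function.update_of_ne huv]
  have hG := hI.ga.del hl e1 e2
  have hB := hI.base.del_V hl
  have e3 : m₁ .edgesLast = m .edgesLast := hs _ (by simp)
  rw [e3]
  by_cases hc : n ≤ m .edges 0 - 1 ∧ 2 * (m .edges 0 - 1) ≤ m .edgesLast 0
  · rw [if_pos hc]
    exact (recompute_am hN hN' hP hA hI hs hB hG (Or.inr (by omega))).mono (by omega)
      fun _ _ _ _ h => h
  · rw [if_neg hc]
    have hdeg : ∀ w, m₁ .degG w ≤ m .degG w := by
      intro w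
      rw [e2, Function.update_apply, Function.update_apply]
      split_ifs with h1 h2
      · subst h1; omega
      · subst h2; omega
      · exact le_rfl
    have h5 := hI.edges_lt
    have h6 := hI.edgesLast_lt
    refine Am.pure ⟨B, m₀, E, hI.graph_update hs hB hG (by omega) (by omega) ?_ ?_, ?_, ?_⟩
    · intro w hw
      exact (hdeg w).trans (hI.degG_le w hw)
    · intro w hw _
      exact (hdeg w).trans_lt (hI.degG_lt w hw id)
    · unfold Balanced
      rw [hs .degL (by simp)]
      exact hb
    · have s1 : ∑ w ∈ Finset.range n, (m₁ .degG w - m₁ .degVL w) ≤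
          ∑ w ∈ Finset.range n, (m .degG w - m .degVL w) := by
        refine Finset.sum_le_sum fun w _ => ?_
        have := hdeg w
        rw [hs .degVL (by simp)]
        omega
      unfold pot
      rw [e1, e3]
      omega

/-- A sequence of updates has constant amortized cost. -/
theorem serve_am (hN : n + 2 ≤ N) (hN' : 4 * N ≤ 5 * n) (hP : ValidTables P N)
    (hA : ∀ d, 3 ≤ d → d ≤ N → P.time N d ≤ A * (N * d)) {us : List (EdgeUpdate (Fin n))}
    (hI : Inv P N G (fun _ => False) B m₀ E m o) (hb : Balanced N m) (hl : LegalSeq G us) :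
    Am A (serve P N us) m o (pot n m E + 6000 * us.length) fun _ m' o' _ => ∃ B' m₀' E',
      Inv P N (replay G us) (fun _ => False) B' m₀' E' m' o' ∧ Balanced N m' := by
  induction us generalizing G B m₀ E m o with
  | nil => exact Am.pure ⟨B, m₀, E, hI, hb⟩
  | cons e us ih =>
    obtain ⟨h1, h2⟩ := hl
    have step : ∀ p : Prog Unit, Am A p m o (pot n m E + 6000) (fun _ m' o' Φ' => ∃ B' m₀' E',
        Inv P N (e.apply G) (fun _ => False) B' m₀' E' m' o' ∧ Balanced N m' ∧
          pot n m' E' ≤ Φ') →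
        Am A (p >>= fun _ => serve P N us) m o (pot n m E + 6000 * (e :: us).length)
          fun _ m' o' _ => ∃ B' m₀' E',
            Inv P N (replay G (e :: us)) (fun _ => False) B' m₀' E' m' o' ∧ Balanced N m' := by
      intro p hp
      refine Am.bind ((hp.add_credits (6000 * us.length)).mono (by simp; omega)
        fun _ _ _ _ h => h) ?_
      rintro _ m₁ o₁ _ ⟨Φ, ⟨B₁, m₁', E₁, k1, k2, k3⟩, rfl⟩
      exact (ih k1 k2 h2).mono (by omega) fun _ _ _ _ h => h
    cases e with
    | ins u v => exact step _ (insertEdge_am hN hN' hP hA hI hb h1)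
    | del u v => exact step _ (deleteEdge_am hN hN' hP hA hI hb h1)

end updates

/-! ### Preprocessing -/

section preprocess

variable {A n N : ℕ} {G : SimpleGraph (Fin n)} {P : ExpanderProcedure} {m : Mem} {o : Out}

/-- The insertions of the edges in a list. -/
def insAll (es : List (Fin n × Fin n)) : List (EdgeUpdate (Fin n)) := es.map fun e => ins e.1 e.2

theorem insAll_spec {es : List (Fin n × Fin n)} (hnd : (es.map fun e => s(e.1, e.2)).Nodup)
    (hne : ∀ e ∈ es, e.1 ≠ e.2 ∧ ¬ G.Adj e.1 e.2) :
    LegalSeq G (insAll es) ∧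
      (replay G (insAll es)).edgeSet = G.edgeSet ∪ {p | p ∈ es.map fun e => s(e.1, e.2)} := by
  induction es generalizing G with
  | nil => simp [insAll, LegalSeq, replay]
  | cons e es ih =>
    obtain ⟨h1, h2⟩ := hne e (by simp)
    rw [List.map_cons, List.nodup_cons] at hnd
    have hl : (ins e.1 e.2).Legal G := ⟨h1, h2⟩
    have := ih (G := (ins e.1 e.2).apply G) hnd.2 fun e' he' => by
      obtain ⟨h3, h4⟩ := hne e' (List.mem_cons_of_mem _ he')
      refine ⟨h3, fun h => ?_⟩
      rw [← SimpleGraph.mem_edgeSet, edgeSet_ins h1] at h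
      rcases h with h | h
      · exact hnd.1 (h ▸ List.mem_map.2 ⟨e', he', rfl⟩)
      · exact h4 h
    refine ⟨⟨hl, this.1⟩, ?_⟩
    change (replay ((ins e.1 e.2).apply G) (insAll es)).edgeSet = _
    rw [this.2, edgeSet_ins h1]
    ext p
    simp only [Set.mem_union, Set.mem_insert_iff, Set.mem_ofPred_eq, List.map_cons, List.mem_cons]
    tauto

/-- Inserting the edges of `G` into the empty graph is legal and yields `G`. -/
theorem insAll_of_isEdgeList {es : List (Fin n × Fin n)} (h : IsEdgeList G es) :
    LegalSeq ⊥ (insAll es) ∧ replay ⊥ (insAll es) = G ∧ es.length = G.edgeSet.ncard := by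
  obtain ⟨h1, h2⟩ := h
  have hs := insAll_spec (G := ⊥) h1 fun e he => by
    have : s(e.1, e.2) ∈ G.edgeSet := (h2 _).1 (List.mem_map.2 ⟨e, he, rfl⟩)
    exact ⟨SimpleGraph.Adj.ne this, by simp⟩
  refine ⟨hs.1, ?_, ?_⟩
  · rw [← SimpleGraph.edgeSet_inj, hs.2]
    ext p
    simpa using h2 p
  · classical
    have : G.edgeSet = ((es.map fun e => s(e.1, e.2)).toFinset : Set (Sym2 (Fin n))) := by
      ext p
      rw [← h2 p]
      simp
    rw [this, Set.ncard_coe_finset, List.toFinset_card_of_nodup h1, List.length_map]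

/-- The order of `L` is not yet initialized here, so `Base` is not available. -/
theorem readGraph_run {es : List (Fin n × Fin n)} (hl : LegalSeq G (insAll es)) (h1 : LegalSeq ⊥ o)
    (h2 : replay ⊥ o = expGraph G ∅ ∅) (h3 : GArrays G m) :
    Run A (readGraph es) m o (8 * es.length + 1) fun _ m' o' => LegalSeq ⊥ o' ∧
      replay ⊥ o' = expGraph (replay G (insAll es)) ∅ ∅ ∧ GArrays (replay G (insAll es)) m' ∧
      Same [.edges, .degG] m m' := by
  induction es generalizing G m o with
  | nil => exact Run.tick_last (c := 0) ⟨h1, h2, h3, Same.rfl⟩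
  | cons e es ih =>
    obtain ⟨k1, k2⟩ := hl
    have huv : (e.2 : ℕ) ≠ e.1 := fun h => k1.1 (Fin.ext h.symm)
    unfold readGraph
    refine Run.mono (c := (8 * es.length + 1) + 1 + 1 + 1 + 1 + 1 + 1 + 1 + 1) (Run.tick (Run.emit
      (Run.read (Run.write (Run.read (Run.write (Run.read (Run.write ?_)))))))) (by simp; omega)
      fun _ _ _ h => h
    have hg := h3.ins (m' := put (put (put m .edges 0 (m .edges 0 + 1)) .degG e.1
      (m .degG e.1 + 1)) .degG e.2 (m .degG e.2 + 1)) k1 (by simp [put_ne]) (by simp [put_ne])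
    have := ih (m := put (put (put m .edges 0 (m .edges 0 + 1)) .degG e.1
      (m .degG e.1 + 1)) .degG e.2 (m .degG e.2 + 1))
      (o := o ++ [ins (orig e.1) (orig e.2)]) k2 ?_ ?_ hg
    · simp only [put_same, put_ne m (a := .edges) (b := .degG) 0 _ (by decide),
        Function.update_of_ne huv]
      refine this.mono le_rfl ?_
      rintro _ m' o' ⟨g1, g2, g3, g4⟩
      exact ⟨g1, g2, g3, (((Same.rfl.put (by simp)).put (by simp)).put (by simp)).trans g4⟩
    · rw [legalSeq_append, h2]
      refine ⟨h1, ⟨?_, ?_⟩, trivial⟩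
      · simpa using huv.symm
      · rintro ⟨_, _, h⟩; exact k1.2 h
    · rw [replay_append, h2, ← expGraph_ins_V]
      rfl

/-- Preprocessing establishes the invariant in linear time. -/
theorem preprocess_run (hN : n + 2 ≤ N) (hN' : 4 * N ≤ 5 * n) (hP : ValidTables P N)
    (hA : ∀ d, 3 ≤ d → d ≤ N → P.firstTime N d ≤ A * (N * d)) {es : List (Fin n × Fin n)}
    (hes : IsEdgeList G es) :
    Run A (preprocess P N es) (fun _ _ => 0) [] (1000 * (G.edgeSet.ncard + n))
      fun _ m' o' => ∃ B m₀, Inv P N G (fun _ => False) B m₀ 0 m' o' ∧ Balanced N m' ∧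
        pot n m' 0 = 0 := by
  obtain ⟨hl, hr, hlen⟩ := insAll_of_isEdgeList hes
  unfold preprocess
  set c₃ := 35 * (4 * G.edgeSet.ncard + 7 * n + 2 * N) with hc₃
  refine Run.mono (c := (8 * es.length + 1) + (((2 + 1) * N + 1) + (((1 + 1) * (2 * N + 1) + 1) +
    c₃))) ?_ (by omega) fun _ _ _ h => h
  refine Run.bind (readGraph_run (G := ⊥) hl trivial ?_ ?_) ?_
  · ext a b
    rcases a with i | i | i <;> rcases b with j | j | j <;> simp [replay, expGraph]
  · exact ⟨by simp, fun v => by simp [SimpleGraph.neighborSet]⟩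
  rintro _ m₁ o₁ ⟨a1, a2, a3, a4⟩
  rw [hr] at a2 a3
  refine Run.bind (Run.loop_const (c := 2) (fun i m' o' => o' = o₁ ∧ Same [.order, .pos] m₁ m' ∧
    (∀ x < i, m' .order x = x) ∧ ∀ x < i, m' .pos x = x) ⟨rfl, Same.rfl, by simp, by simp⟩ ?_) ?_
  · rintro i hi m' o' ⟨rfl, h1, h2, h3⟩
    refine Run.write (c := 1) (Run.write_last (c := 0)
      ⟨rfl, (h1.put (by simp)).put (by simp), ?_, ?_⟩)
    · intro x hx
      rw [put_ne _ _ _ (by decide), put_same, Function.update_apply]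
      split_ifs with e
      · exact e.symm
      · exact h2 x (by omega)
    · intro x hx
      rw [put_same, put_ne _ _ _ (by decide), Function.update_apply]
      split_ifs with e
      · exact e.symm
      · exact h3 x (by omega)
  rintro _ m₂ o₂ ⟨rfl, b1, b2, b3⟩
  refine Run.bind (Run.loop_const (c := 1) (fun i m' o' => o' = o₂ ∧ Same [.start] m₂ m' ∧
    m' .start 0 = 0 ∧ ∀ k < i, m' .start (k + 1) = N) ⟨rfl, Same.rfl, ?_, by simp⟩ ?_) ?_
  · rw [b1 .start (by simp), a4 .start (by simp)]
  · rintro i hi m' o' ⟨rfl, h1, h2, h3⟩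
    refine Run.write_last (c := 0) ⟨rfl, h1.put (by simp), ?_, ?_⟩
    · rw [put_same, Function.update_of_ne (by omega), h2]
    · intro k hk
      rw [put_same, Function.update_apply]
      split_ifs with e
      · rfl
      · exact h3 k (by omega)
  rintro _ m₃ o₃ ⟨rfl, c1, c2, c3⟩
  have hs : Same [.start, .order, .pos, .edges, .degG] (fun _ _ => 0) m₃ :=
    ((a4.mono (by simp)).trans (b1.mono (by simp))).trans (c1.mono (by simp))
  have hG : GArrays G m₃ := a3.congr
    ((c1 _ (by simp)).trans (b1 _ (by simp))) ((c1 _ (by simp)).trans (b1 _ (by simp)))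
  have eo : m₃ .order = m₂ .order := c1 _ (by simp)
  have ep : m₃ .pos = m₂ .pos := c1 _ (by simp)
  have eL : m₃ .degL = fun _ => 0 := hs _ (by simp)
  have eX : m₃ .degX = fun _ => 0 := hs _ (by simp)
  have eV : m₃ .degVL = fun _ => 0 := hs _ (by simp)
  have hB : Base N G ∅ ∅ m₃ o₃ := by
    refine ⟨a1, a2, by simp, by simp, ?_, ?_⟩
    · intro x _
      simp [eL, colDeg, rowDeg]
    · rw [eo, ep, eL]
      refine ⟨?_, ?_, ?_, ?_, ?_, ?_⟩
      · intro x hx; rwa [b3 x hx]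
      · intro x hx; rwa [b2 x hx]
      · intro x hx; rw [b3 x hx, b2 x hx]
      · intro x hx; rw [b2 x hx, b3 x hx]
      · intro k hk
        cases k with
        | zero => rw [c2]; omega
        | succ k => rw [c3 k (by omega)]
      · intro k hk i hi
        cases k with
        | zero => rw [c2]; omega
        | succ k => rw [c3 k (by omega)]; omega
  have hV : VLArrays n N ∅ m₃ := by
    refine ⟨?_, by simp [eV], ?_⟩
    · ext ⟨v, x⟩; simp [mem_tab_zero, eV]
    · intro v _ x _
      rw [hs .adjVL (by simp)]; simp
  have hX : XArrays N ∅ m₃ := by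
    refine ⟨?_, by simp [eX], ?_⟩
    · ext ⟨v, x⟩; simp [mem_tab_zero, eX]
    · intro v _ x _
      rw [hs .adjX (by simp)]; simp
  refine (recompute_inv_run (first := true) hN hN' hP (by simpa using hA) hB hV hX hG).mono ?_ ?_
  · rw [hG.edges, eX, eV]
    simp [hc₃]
  · rintro _ m' o' ⟨B', h⟩
    exact ⟨B', _, h⟩

end preprocess

/-! ### The form of `G_exp` -/

theorem ncard_row (B : Finset (ℕ × ℕ)) (v : ℕ) : {x | (v, x) ∈ B}.ncard = rowDeg B v := by
  have : {x | (v, x) ∈ B} = (((B.filter fun p => p.1 = v).image Prod.snd : Finset ℕ) : Set ℕ) := by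
    ext x
    simp
  rw [this, Set.ncard_coe_finset, rowDeg, Finset.card_image_of_injOn]
  rintro ⟨a, b⟩ h ⟨c, d⟩ h' e
  simp only [Finset.coe_filter, Set.mem_ofPred_eq] at h h'
  exact Prod.ext (h.2.trans h'.2.symm) e

theorem ncard_col (B : Finset (ℕ × ℕ)) (x : ℕ) : {v | (v, x) ∈ B}.ncard = colDeg B x := by
  have : {v | (v, x) ∈ B} = (((B.filter fun p => p.2 = x).image Prod.fst : Finset ℕ) : Set ℕ) := by
    ext x
    simp
  rw [this, Set.ncard_coe_finset, colDeg, Finset.card_image_of_injOn]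
  rintro ⟨a, b⟩ h ⟨c, d⟩ h' e
  simp only [Finset.coe_filter, Set.mem_ofPred_eq] at h h'
  exact Prod.ext e (h.2.trans h'.2.symm)

theorem finite_row (B : Finset (ℕ × ℕ)) (v : ℕ) : {x | (v, x) ∈ B}.Finite :=
  (B.finite_toSet.image Prod.snd).subset fun _ hx => ⟨_, hx, rfl⟩

theorem finite_col (B : Finset (ℕ × ℕ)) (x : ℕ) : {v | (v, x) ∈ B}.Finite :=
  (B.finite_toSet.image Prod.fst).subset fun _ hx => ⟨_, hx, rfl⟩

theorem ncard_neighborSet_left {n : ℕ} (G : SimpleGraph (Fin n)) (B X : Finset (ℕ × ℕ)) (x : ℕ) :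
    ((expGraph G B X).neighborSet (left x)).ncard = colDeg B x + rowDeg X x := by
  have : (expGraph G B X).neighborSet (left x) =
      orig '' {v | (v, x) ∈ B} ∪ right '' {y | (x, y) ∈ X} := by
    ext z
    rcases z with z | z | z <;> simp [SimpleGraph.neighborSet, expGraph]
  rw [this, Set.ncard_union_eq ?_ ((finite_col B x).image _) ((finite_row X x).image _),
    Set.ncard_image_of_injective _ fun a b h => by simpa using h,
    Set.ncard_image_of_injective _ fun a b h => by simpa using h, ncard_row, ncard_col]
  rw [Set.disjoint_left]
  rintro _ ⟨a, -, rfl⟩ ⟨b, -, h⟩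
  cases h

/-- The invariant contains all that is required of `G_exp`. -/
theorem Inv.isGadget {n N m₀ E : ℕ} {P : ExpanderProcedure} {G : SimpleGraph (Fin n)}
    {B : Finset (ℕ × ℕ)} {m : Mem} {o : Out} (h : Inv P N G (fun _ => False) B m₀ E m o)
    (hb : Balanced N m) : IsGadget P N G (replay ⊥ o) := by
  have hrow : ∀ v : Fin n, {x | (expGraph G B (expSet P N (m .degX 0))).Adj (orig v) (left x)}.ncard
      = m .degVL v := fun v => by
    rw [← h.vl.rowDeg_eq v.2, ← ncard_row]
    rfl
  rw [h.base.graph]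
  refine ⟨fun i j => Iff.rfl, ?_, fun i y h => h, fun x y h => h, fun x y h => h, ?_, ?_, ?_, ?_⟩
  · intro i x hx
    simpa using h.base.B_sub hx
  · refine ⟨m .edgesLast 0, ?_, ?_, ?_⟩
    · intro x y
      rw [← h.degX_eq]
      constructor
      · intro hxy
        have := h.base.X_sub hxy
        simp only [Finset.mem_product, Finset.mem_range] at this
        obtain ⟨-, i, hi, e⟩ := mem_tab_zero.1 hxy
        refine ⟨this.1, this.2, ?_⟩
        rw [ExpanderProcedure.graph, SimpleGraph.fromRel_adj]
        exact ⟨by simp, Or.inl ⟨_, _, rfl, rfl, i, hi, e⟩⟩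
      · rintro ⟨hx, hy, h'⟩
        rw [ExpanderProcedure.graph, SimpleGraph.fromRel_adj] at h'
        obtain ⟨-, ⟨x', y', ex, ey, i, hi, e⟩ | ⟨x', y', ex, -⟩⟩ := h'
        · cases ex
          cases ey
          exact mem_tab_zero.2 ⟨hx, i, hi, e⟩
        · cases ex
    · rw [← h.ga.edges]; exact h.edges_lt
    · rw [← h.ga.edges]
      have := h.edgesLast_lt
      omega
  · intro v
    rw [hrow]
    exact h.three_le v v.2
  · intro v
    rw [hrow, ← h.ga.deg]
    exact h.degG_lt v v.2 id
  · intro x hx y hy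
    rw [ncard_neighborSet_left, ncard_neighborSet_left, ← h.base.deg x hx, ← h.base.deg y hy]
    exact hb x hx y hy

/-! ### The bounds for large `n` -/

theorem ExpanderProcedure.Correct.validTables {P : ExpanderProcedure} {φ : ℝ} {N₀ N : ℕ}
    (h : P.Correct φ N₀) (hN : N₀ ≤ N) : ValidTables P N :=
  fun d hd hdN => ⟨h.nbr_lt N d hN hd hdN, h.nbr_inj N d hN hd hdN⟩

/-- The polylogarithmic factors in `N` and in `n` differ by a constant. -/
theorem log_pow_le {n N : ℕ} (hn : 2 ≤ n) (hN : 4 * N ≤ 5 * n) (a : ℕ) :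
    Nat.log 2 N ^ a ≤ 2 ^ a * Nat.log 2 n ^ a := by
  rw [← mul_pow]
  refine Nat.pow_le_pow_left ?_ a
  have h1 : Nat.log 2 N ≤ Nat.log 2 (n * 2) := Nat.log_mono_right (by omega)
  rw [Nat.log_mul_base (by omega) (by omega)] at h1
  have h2 : 1 ≤ Nat.log 2 n := Nat.log_pos (by omega) hn
  omega

theorem eventually_le_of_tendsto {N : ℕ → ℕ}
    (h : Tendsto (fun n => (N n : ℝ) / (n : ℝ)) atTop (𝓝 1)) :
    ∀ᶠ n in atTop, 4 * N n ≤ 5 * n := by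
  filter_upwards [h.eventually_lt_const (show (1 : ℝ) < 5 / 4 by norm_num), eventually_gt_atTop 0]
    with n hn hn0
  have h0 : (0 : ℝ) < n := by exact_mod_cast hn0
  rw [div_lt_iff₀ h0] at hn
  have : (4 * N n : ℝ) ≤ 5 * n := by linarith
  exact_mod_cast this

end CoreGadget

theorem mainTheorem6 (K a : ℕ) :
    ∃ C b : ℕ, ∀ (φ : ℝ) (N₀ : ℕ) (N : ℕ → ℕ), 0 < φ → (∀ n, n + 2 ≤ N n) →
      Tendsto (fun n => (N n : ℝ) / (n : ℝ)) atTop (𝓝 1) →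
      ∃ n₀ : ℕ, ∀ P : CoreGadget.ExpanderProcedure, P.Correct φ N₀ → P.NearLinearTime N₀ K a →
        ∀ n ≥ n₀, ∀ (G₀ : SimpleGraph (Fin n)) (es : List (Fin n × Fin n)),
          CoreGadget.IsEdgeList G₀ es →
        ∀ us : List (CoreGadget.EdgeUpdate (Fin n)), CoreGadget.LegalSeq G₀ us →
        ∃ s₀ s : CoreGadget.State,
          s₀ = CoreGadget.initial P (N n) es ∧ s = CoreGadget.final P (N n) es us ∧
          -- preprocessing outputs `G_exp` for `G₀` in time `Õ(m + n)`
          (CoreGadget.LegalSeq ⊥ s₀.out ∧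
            CoreGadget.IsGadget P (N n) G₀ (CoreGadget.replay ⊥ s₀.out) ∧
            s₀.time + s₀.procTime ≤ C * (G₀.edgeSet.ncard + n) * Nat.log 2 n ^ b) ∧
          -- the `M` updates of `G` are turned into `O(M)` updates of `G_exp`
          (∃ out : List (CoreGadget.EdgeUpdate CoreGadget.XVertex), s.out = s₀.out ++ out ∧
            CoreGadget.LegalSeq (CoreGadget.replay ⊥ s₀.out) out ∧
            CoreGadget.IsGadget P (N n) (CoreGadget.replay G₀ us) (CoreGadget.replay ⊥ s.out) ∧
            out.length ≤ C * us.length) ∧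
          -- in `O(M)` steps outside the expander procedure, and in time `Õ(M)` inside it
          s.time ≤ s₀.time + C * us.length ∧
          s.procTime ≤ s₀.procTime + C * us.length * Nat.log 2 n ^ b ∧
          -- if later calls of the expander procedure take `O(1)` time per edge, then the updates
          -- take time `O(M)`, and the total time is `Õ(m + n) + O(M)`
          (P.LinearLaterTime N₀ K →
            s.time + s.procTime ≤ s₀.time + s₀.procTime + C * us.length ∧
            s.time + s.procTime ≤
              C * (G₀.edgeSet.ncard + n) * Nat.log 2 n ^ b + C * us.length) := by
  refine ⟨6000 * (1 + K * 2 ^ a), a, fun φ N₀ N _ hN hlim => ?_⟩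
  obtain ⟨n₁, hn₁⟩ := eventually_atTop.1 (CoreGadget.eventually_le_of_tendsto hlim)
  refine ⟨max n₁ (max N₀ 2), fun P hP hT n hn G₀ es hes us hus => ?_⟩
  simp only [ge_iff_le, max_le_iff] at hn
  have hn2 : 2 ≤ n := hn.2.2
  have hN' := hn₁ n hn.1
  have hN2 := hN n
  have hNN : N₀ ≤ N n := by omega
  have hvalid := hP.validTables hNN
  -- `A` bounds the time of the expander procedure per edge
  set A := K * Nat.log 2 (N n) ^ a with hAdef
  have hA1 : ∀ d, 3 ≤ d → d ≤ N n → P.firstTime (N n) d ≤ A * (N n * d) := fun d h1 h2 =>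
    (hT (N n) d hNN h1 h2).1.trans_eq (by rw [hAdef]; ring)
  have hA2 : ∀ d, 3 ≤ d → d ≤ N n → P.time (N n) d ≤ A * (N n * d) := fun d h1 h2 =>
    (hT (N n) d hNN h1 h2).2.trans_eq (by rw [hAdef]; ring)
  have hAle : A ≤ K * 2 ^ a * Nat.log 2 n ^ a := by
    rw [mul_assoc]
    exact Nat.mul_le_mul_left _ (CoreGadget.log_pow_le hn2 hN' a)
  have hlog : 1 ≤ Nat.log 2 n ^ a := Nat.one_le_pow _ _ (Nat.log_pos (by omega) hn2)
  obtain ⟨⟨B, m₀, hI, hb, hpot⟩, ht, hpt, -⟩ :=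
    CoreGadget.preprocess_run (A := A) hN2 hN' hvalid hA1 hes 0 0
  have hpre : (CoreGadget.preprocess P (N n) es ⟨fun _ _ => 0, [], 0, 0⟩).2 =
    CoreGadget.initial P (N n) es := rfl
  rw [hpre] at hI hb hpot ht hpt
  set s₀ := CoreGadget.initial P (N n) es with hs₀
  have hfin : CoreGadget.serve P (N n) us ⟨s₀.mem, s₀.out, s₀.time, s₀.procTime⟩ =
    ((), CoreGadget.final P (N n) es us) := rfl
  -- this is used twice, with the polylogarithmic and with the constant bound on the time per edge
  have hserve := fun (A' : ℕ) (hA' : ∀ d, 3 ≤ d → d ≤ N n → P.time (N n) d ≤ A' * (N n * d)) =>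
    CoreGadget.serve_am hN2 hN' hvalid hA' hI hb hus s₀.time s₀.procTime
  simp only [hfin, hpot, zero_add] at hserve
  set s := CoreGadget.final P (N n) es us with hs
  have hfirst : s₀.time + s₀.procTime ≤
      6000 * (1 + K * 2 ^ a) * (G₀.edgeSet.ncard + n) * Nat.log 2 n ^ a := by
    generalize G₀.edgeSet.ncard + n = q at *
    calc s₀.time + s₀.procTime ≤ 1000 * q + A * (1000 * q) := by omega
      _ ≤ 1000 * q * Nat.log 2 n ^ a + K * 2 ^ a * Nat.log 2 n ^ a * (1000 * q) :=
        Nat.add_le_add (Nat.le_mul_of_pos_right _ hlog) (Nat.mul_le_mul_right _ hAle)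
      _ = 1000 * ((1 + K * 2 ^ a) * q * Nat.log 2 n ^ a) := by ring
      _ ≤ 6000 * ((1 + K * 2 ^ a) * q * Nat.log 2 n ^ a) := Nat.mul_le_mul_right _ (by norm_num)
      _ = _ := by ring
  obtain ⟨c, Φ', hc, ⟨B', m₀', E', hI', hb'⟩, ht', hpt', out, hout, hlen⟩ := hserve A hA2
  have hC : 6000 * us.length ≤ 6000 * (1 + K * 2 ^ a) * us.length :=
    Nat.mul_le_mul_right _ (Nat.le_mul_of_pos_right _ (by omega))
  refine ⟨s₀, s, rfl, rfl, ⟨hI.base.legal, hI.isGadget hb, hfirst⟩,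
    ⟨out, hout, ?_, hI'.isGadget hb', by omega⟩, by omega, ?_, ?_⟩
  · have := hI'.base.legal
    rw [hout, CoreGadget.legalSeq_append] at this
    exact this.2
  · refine hpt'.trans (Nat.add_le_add_left ?_ _)
    calc A * c ≤ K * 2 ^ a * Nat.log 2 n ^ a * (6000 * us.length) :=
          Nat.mul_le_mul hAle (by omega)
      _ = 6000 * (K * 2 ^ a) * us.length * Nat.log 2 n ^ a := by ring
      _ ≤ 6000 * (1 + K * 2 ^ a) * us.length * Nat.log 2 n ^ a := by gcongr; omega
  · intro hlin
    obtain ⟨c, Φ', hc, -, ht', hpt', -⟩ := hserve K fun d h1 h2 => hlin (N n) d hNN h1 h2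
    have h1 : K * c ≤ K * 2 ^ a * (6000 * us.length) :=
      Nat.mul_le_mul (Nat.le_mul_of_pos_right _ (by positivity)) (by omega)
    have h2 : 6000 * (1 + K * 2 ^ a) * us.length =
        6000 * us.length + K * 2 ^ a * (6000 * us.length) := by ring
    constructor <;> omega
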